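/- Let $\Omega=\mathbb T^2$ be the two-dimensional unit torus, $m>0$, and let $\mathcal P(r)=\sum_{k=0}^{d}a_kr^k$ be a real polynomial of even degree $d\ge 2$ with $a_d>0$. For $c>0$ and a field $\phi$, Wick powers are $:\!\phi^n(x)\!:\,=c^{n/2}H_n(\phi(x)/\sqrt c)$ with $H_n$ the probabilists' Hermite polynomials, and $:\!\mathcal P(\phi(x))\!:\,=\sum_k a_k:\!\phi^k(x)\!:$. **Lattice.** For $\epsilon=1/N$, $N\in\{1,2,\dots\}$, let $\Omega_\epsilon=\Omega\cap\epsilon\mathbb Z^2$, $X_\epsilon=\mathbb R^{\Omega_\epsilon}$, let $\Delta^\epsilon f(x)=\epsilon^{-2}\sum_{i=1}^{2}\big(f(x+\epsilon e_i)+f(x-\epsilon e_i)-2f(x)\big)$, and, for $0<t<\infty$, $c_t^\epsilon=(-\Delta^\epsilon+m^2+1/t)^{-1}$, $c_\infty^\epsilon=(-\Delta^\epsilon+m^2)^{-1}$, with kernels taken with respect to the inner product $\epsilon^2\sum_{x}f(x)g(x)$. Write $\mathbf E_c$ for the expectation under the centred Gaussian measure with covariance $c$. Let $v_0^\epsilon(\phi)=\epsilon^2\sum_{x\in\Omega_\epsilon}:\!\mathcal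 P(\phi(x))\!:$, Wick ordered with respect to the variance $c_\infty^\epsilon(0,0)$, let $e^{-v_t^\epsilon(\phi)}=\mathbf E_{c_t^\epsilon}[e^{-v_0^\epsilon(\phi+\zeta)}]$ for $t\in(0,\infty]$, and define the renormalised measure $\nu_t^{\mathcal P_\epsilon}$ on $X_\epsilon$ by $$\mathbb E_{\nu_t^{\mathcal P_\epsilon}}[F]=e^{v_\infty^\epsilon(0)}\,\mathbf E_{c_\infty^\epsilon-c_t^\epsilon}\big[F(\zeta)e^{-v_t^\epsilon(\zeta)}\big].$$ Let $I_\epsilon f=\sum_{k}\hat f(k)e^{ik\cdot x}$ be the trigonometric extension of $f\in X_\epsilon$, where the sum is over $k\in2\pi\mathbb Z^2$ with $-\pi/\epsilon<k_i\le\pi/\epsilon$ and $\hat f(k)=\epsilon^2\sum_{x\in\Omega_\epsilon}f(x)e^{-ik\cdot x}$; it is regarded as an element of $C(\Omega;\mathbb C)$. **Continuum.** For $t\in(0,\infty)$ let $Y_t$ and $Y_\infty-Y_t$ be independent real centred Gaussian fields on $\Omega$ whose covariances have the Fourier multipliers $\frac1{|k|^2+m^2+1/t}$ and $\frac1{|k|^2+m^2}-\frac1{|k|^2+m^2+1/t}$,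 $k\in2\pi\mathbb Z^2$. For $s\in(0,\infty]$ and $\varphi\in C(\Omega;\mathbb R)$ let $\int_\Omega:\!\mathcal P(\varphi+Y_s)\!:dx$ be the $L^2(\mathbb P)$-limit as $K\to\infty$ of $\int_\Omega:\!\mathcal P(\varphi(x)+Y_{s,K}(x))\!:dx$, where $Y_{s,K}$ is the Fourier truncation of $Y_s$ to $|k_i|\le 2\pi K$ and the Wick ordering is with respect to the variance $\sum_{|k_i|\le2\pi K}\frac1{|k|^2+m^2}$ of $Y_{\infty,K}$; set $e^{-v_s^0(\varphi)}=\mathbb E\big[e^{-\int_\Omega:\mathcal P(\varphi+Y_s):dx}\big]$. **Proposition 5.6.** Let $0<t<\infty$. The limits defining $\int_\Omega:\!\mathcal P(\varphi+Y_t)\!:dx$ and $\int_\Omega:\!\mathcal P(\varphi+Y_\infty)\!:dx$ exist and $e^{-\int_\Omega:\mathcal P(\varphi+Y_t):dx}$, $e^{-\int_\Omega:\mathcal P(\varphi+Y_\infty):dx}$ are integrable for every $\varphi\in C(\Omega;\mathbb R)$; the field $Y_\infty-Y_t$ has a version with values in $C(\Omega;\mathbb R)$; and there is a probability measure $\nu_t^{\mathcal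 P}$ on $C(\Omega;\mathbb R)$ such that $$\mathbb E_{\nu_t^{\mathcal P}}[F]=e^{v_\infty^0(0)}\,\mathbb E\big[F(Y_\infty-Y_t)\,e^{-v_t^0(Y_\infty-Y_t)}\big],\qquad e^{-v_\infty^0(0)}=\mathbb E\big[e^{-\int_\Omega:\mathcal P(Y_\infty):dx}\big],$$ for all bounded measurable $F\colon C(\Omega;\mathbb R)\to\mathbb R$ (the expectand on the right being integrable), and such that, as $\epsilon=1/N\to0$, the pushforwards $(I_\epsilon)_*\nu_t^{\mathcal P_\epsilon}$ are probability measures that converge weakly on $C(\Omega;\mathbb C)$ to $\nu_t^{\mathcal P}$ (regarded as a measure on $C(\Omega;\mathbb C)$ through $C(\Omega;\mathbb R)\subset C(\Omega;\mathbb C)$). In particular the limit along any subsequence is this same measure. -/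

import Mathlib

open MeasureTheory ProbabilityTheory Filter Topology

namespace PPhi2

noncomputable section

/-! ### Wick powers -/

/-- The Wick power `c ^ (n / 2) * H_n (x / c ^ (1 / 2))` of `x` with respect to the variance `c`,
where `H_n` is the `n`-th probabilists' Hermite polynomial. It is monic of degree `n` in `x`; for
`n = 4` it is `x ^ 4 - 6 * c * x ^ 2 + 3 * c ^ 2`. -/
def wickPow (c : ℝ) (n : ℕ) (x : ℝ) : ℝ :=
  √c ^ n * Polynomial.aeval (x / √c) (Polynomial.hermite n)

/-- The Wick ordering of the polynomial `P` with respect to the variance `c`, evaluated at `x`. -/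
def wickPoly (P : Polynomial ℝ) (c x : ℝ) : ℝ :=
  ∑ k ∈ Finset.range (P.natDegree + 1), P.coeff k * wickPow c k x

/-! ### The discretised torus with mesh `ε = 1 / N`, Gaussian fields on it -/

/-- The discretised unit torus: the residue `x` stands for the point `ε * x`, with `ε = 1 / N`. -/
abbrev Site (N : ℕ) := Fin 2 → ZMod N

/-- Real-valued fields on the discretised torus. -/
abbrev LatticeField (N : ℕ) := EuclideanSpace ℝ (Site N)

/-- The discrete Laplacian `ε⁻² * ∑_{y ∼ x} (f y - f x)`. -/
def latticeLaplacian (N : ℕ) : (Site N → ℝ) →ₗ[ℝ] (Site N → ℝ) where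
  toFun f x := (N : ℝ) ^ 2 *
    ∑ i : Fin 2, ((f (x + Pi.single i 1) - f x) + (f (x - Pi.single i 1) - f x))
  map_add' f g := by
    funext x
    simp only [Pi.add_apply, ← mul_add, ← Finset.sum_add_distrib]
    congr 1
    exact Finset.sum_congr rfl fun i _ => by ring
  map_smul' a f := by
    funext x
    simp only [Pi.smul_apply, smul_eq_mul, RingHom.id_apply, Finset.mul_sum]
    exact Finset.sum_congr rfl fun i _ => by ring

/-- The kernel of `(-Δ^ε + M)⁻¹` with respect to the inner product `ε² * ∑ₓ f x * g x`, that is,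
`ε⁻²` times the inverse matrix. A Gaussian field with covariance operator `(-Δ^ε + M)⁻¹` has
`E[Φ x * Φ y] = latticeCov N M x y`. The covariance `c_t^ε` of the Pauli–Villars decomposition is
obtained for `M = m ^ 2 + 1 / t`, and `c_∞^ε` for `M = m ^ 2`. -/
def latticeCov (N : ℕ) [NeZero N] (M : ℝ) : Matrix (Site N) (Site N) ℝ :=
  (N : ℝ) ^ 2 • (M • (1 : Matrix (Site N) (Site N) ℝ) - LinearMap.toMatrix' (latticeLaplacian N))⁻¹

/-- The interaction `v_0^ε(φ) = ε² * ∑ₓ :P(φ x):`, Wick ordered with respect to the variance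
`c_ε` of the massive discrete Gaussian free field at a point. -/
def latticeInteraction (N : ℕ) [NeZero N] (m : ℝ) (P : Polynomial ℝ) (φ : LatticeField N) : ℝ :=
  1 / (N : ℝ) ^ 2 * ∑ x : Site N, wickPoly P (latticeCov N (m ^ 2) 0 0) (φ x)

/-- The renormalised potential `v`, given by `exp (-v(φ)) = E[exp (-v_0^ε(φ + ζ))]` with `ζ`
centred Gaussian of covariance `(-Δ^ε + M)⁻¹`. It is `v_t^ε` for `M = m ^ 2 + 1 / t` and
`v_∞^ε` for `M = m ^ 2`. -/
def latticePotential (N : ℕ) [NeZero N] (m : ℝ) (P : Polynomial ℝ) (M : ℝ)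
    (φ : LatticeField N) : ℝ :=
  -Real.log (∫ ζ, Real.exp (-latticeInteraction N m P (φ + ζ))
    ∂(multivariateGaussian 0 (latticeCov N M)))

/-- The renormalised measure: density `exp (v_∞^ε(0)) * exp (-v_t^ε(φ))` with respect to the
centred Gaussian measure with covariance `c_∞^ε - c_t^ε`. -/
def renormalisedMeasure (N : ℕ) [NeZero N] (m : ℝ) (P : Polynomial ℝ) (t : ℝ) :
    Measure (LatticeField N) :=
  ENNReal.ofReal (Real.exp (latticePotential N m P (m ^ 2) 0)) •
    (multivariateGaussian 0 (latticeCov N (m ^ 2) - latticeCov N (m ^ 2 + 1 / t))).withDensity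
      (fun φ => ENNReal.ofReal (Real.exp (-latticePotential N m P (m ^ 2 + 1 / t) φ)))

/-! ### The continuum torus and the trigonometric embedding -/

/-- The two-dimensional unit torus. -/
abbrev Torus := UnitAddTorus (Fin 2)

instance : MeasurableSpace C(Torus, ℝ) := borel _
instance : BorelSpace C(Torus, ℝ) := ⟨rfl⟩
instance : MeasurableSpace C(Torus, ℂ) := borel _
instance : BorelSpace C(Torus, ℂ) := ⟨rfl⟩

/-- Real-valued continuous functions as complex-valued ones. -/
def toComplex (f : C(Torus, ℝ)) : C(Torus, ℂ) :=
  ContinuousMap.comp ⟨Complex.ofReal, Complex.continuous_ofReal⟩ f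

theorem measurable_toComplex : Measurable toComplex :=
  (ContinuousMap.continuous_postcomp _).measurable

/-- The position `ε * x` in the torus of the lattice site `x`. -/
def latticePoint (N : ℕ) [NeZero N] (x : Site N) : Torus := fun i => ZMod.toAddCircle (x i)

/-- The frequencies `n` for which `k = 2 * π * n` satisfies `-π / ε < k i ≤ π / ε`. -/
def latticeDual (N : ℕ) : Finset (Fin 2 → ℤ) :=
  Fintype.piFinset fun _ => (Finset.Icc (-(N : ℤ)) N).filter fun j => -(N : ℤ) < 2 * j ∧ 2 * j ≤ N

/-- The discrete Fourier coefficient `ε² * ∑ₓ f x * exp (-i k · x)` at `k = 2 * π * n`. -/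
def latticeFourierCoeff (N : ℕ) [NeZero N] (f : LatticeField N) (n : Fin 2 → ℤ) : ℂ :=
  1 / (N : ℂ) ^ 2 * ∑ x : Site N, (f x : ℂ) * UnitAddTorus.mFourier (-n) (latticePoint N x)

/-- The trigonometric extension of a lattice field: the function on the torus whose Fourier
coefficients are those of `f` on the dual lattice and vanish elsewhere. -/
def trigExtension (N : ℕ) [NeZero N] (f : LatticeField N) : C(Torus, ℂ) :=
  ∑ n ∈ latticeDual N, latticeFourierCoeff N f n • UnitAddTorus.mFourier n

/-! ### Gaussian fields on the continuum torus -/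

/-- Sample space of the Gaussian noise: one real coordinate for each frequency. -/
abbrev Noise := (Fin 2 → ℤ) → ℝ

/-- Independent standard Gaussian coordinates. -/
def noiseLaw : Measure Noise := Measure.infinitePi fun _ => gaussianReal 0 1

/-- The Fourier multiplier `1 / (|k|² + M)` of `(-Δ + M)⁻¹` at `k = 2 * π * n`: the multiplier of
`c_t^0` for `M = m ^ 2 + 1 / t`, and that of `c_∞^0` for `M = m ^ 2`. -/
def covMultiplier (M : ℝ) (n : Fin 2 → ℤ) : ℝ :=
  1 / ((2 * Real.pi) ^ 2 * ∑ i, (n i : ℝ) ^ 2 + M)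

/-- The real orthonormal basis `cos (k · x) + sin (k · x)`, `k = 2 * π * n`, of `L²` of the torus.
If `σ` is nonnegative with `σ n = σ (-n)`, then for independent standard Gaussians `g n` the series
`∑ₙ √(σ n) * g n * hartley n x` is the real centred Gaussian field with covariance
`∑ₙ σ n * cos (k · (x - y))`, i.e. with the Fourier multipliers `σ`. -/
def hartley (n : Fin 2 → ℤ) (x : Torus) : ℝ :=
  (UnitAddTorus.mFourier n x).re + (UnitAddTorus.mFourier n x).im

/-- Frequencies with `|n i| ≤ K`. -/
def freqBox (K : ℕ) : Finset (Fin 2 → ℤ) :=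
  Fintype.piFinset fun _ => Finset.Icc (-(K : ℤ)) K

/-- The Gaussian field with Fourier multipliers `σ`, truncated to the frequencies `|n i| ≤ K`. -/
def truncField (σ : (Fin 2 → ℤ) → ℝ) (K : ℕ) (g : Noise) (x : Torus) : ℝ :=
  ∑ n ∈ freqBox K, √(σ n) * g n * hartley n x

/-- `X` is a version with continuous paths of the Gaussian field with Fourier multipliers `σ`: a
random element of `C(Ω)` that is almost surely given by the random series
`∑ₙ √(σ n) * g n * hartley n`, in the sense that it has these coefficients. -/
def IsContinuousField (σ : (Fin 2 → ℤ) → ℝ) (X : Noise → C(Torus, ℝ)) : Prop :=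
  Measurable X ∧ ∀ᵐ g ∂noiseLaw, ∀ n, ∫ x, X g x * hartley n x = √(σ n) * g n

/-- The variance at a point of the massive Gaussian free field truncated to `|n i| ≤ K`. -/
def truncVariance (m : ℝ) (K : ℕ) : ℝ := ∑ n ∈ freqBox K, covMultiplier (m ^ 2) n

/-- `∫ :P(φ + Z_K): dx`, where `Z_K` is the truncation of the Gaussian field with covariance
`(-Δ + M)⁻¹`. The Wick ordering is the one of the full Gaussian free field (mass `m`). -/
def truncInteraction (m : ℝ) (P : Polynomial ℝ) (M : ℝ) (φ : C(Torus, ℝ)) (K : ℕ)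
    (g : Noise) : ℝ :=
  ∫ x : Torus, wickPoly P (truncVariance m K) (φ x + truncField (covMultiplier M) K g x)

/-- `V` is the continuum interaction `∫ :P(φ + Z): dx`, where `Z` is the Gaussian field with
covariance `(-Δ + M)⁻¹`: the limit in `L²` of the probability space as the truncation is removed. -/
def IsInteraction (m : ℝ) (P : Polynomial ℝ) (M : ℝ) (φ : C(Torus, ℝ)) (V : Noise → ℝ) : Prop :=
  MemLp V 2 noiseLaw ∧
    Tendsto (fun K => eLpNorm (fun g => truncInteraction m P M φ K g - V g) 2 noiseLaw)
      atTop (𝓝 0)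

/-- The continuum interaction `v_0^0(φ + Z) = ∫ :P(φ + Z): dx` as a random variable (a choice of
the almost surely unique limit in `IsInteraction`). -/
def interaction (m : ℝ) (P : Polynomial ℝ) (M : ℝ) (φ : C(Torus, ℝ)) : Noise → ℝ :=
  Classical.epsilon (IsInteraction m P M φ)

/-- The continuum renormalised potential, `exp (-v(φ)) = E[exp (-∫ :P(φ + Z): dx)]`. It is `v_t^0`
for `M = m ^ 2 + 1 / t` (then `Z = Y_t`) and `v_∞^0` for `M = m ^ 2` (then `Z = Y_∞`). -/
def potential (m : ℝ) (P : Polynomial ℝ) (M : ℝ) (φ : C(Torus, ℝ)) : ℝ :=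
  -Real.log (∫ g, Real.exp (-interaction m P M φ g) ∂noiseLaw)

end

end PPhi2

/-!
The measures in question are laws of Gaussian fields reweighted by `exp (-V)`, so the proof puts all
of them on one probability space, a pair of independent Gaussian noises, and shows that fields and
weights converge there in probability while the weights stay bounded in `L²`.

*Uniform integrability.* The key estimate is Nelson's bound on `E[exp (-V)]`, uniform over all
finite Gaussian fields, on the torus or on a lattice in it, whose covariance multipliers are at most
`B * (1 + |n|) ^ (-2)` (`exists_lintegral_exp_wickSum_le`). The truncation of the interaction to
frequencies of size `K` is bounded below by minus a power of the truncated variance, which grows more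
slowly than any power of `K`, while its distance from the interaction in `L^p` is at most
`p ^ (d / 2)` times a negative power of `K`. The moments come from hypercontractivity, which
is proved in its holomorphic form: a Wick power is the average of an ordinary power over an
imaginary Gaussian shift (`wick_eq_integral`), so the chaos expansion is that of a holomorphic
polynomial, and the Segal-Bargmann norm is submultiplicative up to `2 ^ (a + b)` on polynomials of
degrees `a`, `b` (`fockNormSq_mul_le`). The second moments reduce to integrals of powers of the
covariance kernel, which are bounded on the torus and on the lattice alike by a multilinear
inequality for the Fourier coefficients (`sum_tuples_le`, `integral_cov_pow_le`).

*Continuum.* The truncated interactions are therefore Cauchy in `L²` and their exponentials are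
integrable, also after a shift `φ`, which only changes the coefficients of the Wick powers
(`shiftCoeff`). The field `Y_∞ - Y_t` has multipliers of order `|n| ^ (-4)`, and its series converges
in `C(Ω)` by Nikolskii's inequality on dyadic blocks (`exists_limit_fieldMap`). A coordinatewise
reflection of the pair of noises, which preserves their law, exchanges the pair
(`Y_∞ - Y_t`, `Y_t`) with (`Y_∞`, an independent field). Along it the interaction of `Y_t` shifted by
`Y_∞ - Y_t` becomes that of `Y_∞` (`interaction_mixNoise`); hence the limiting measure is the law of
`Y_∞ - Y_t` when the law of `Y_∞` is tilted by its interaction (`integral_tilted_interaction`).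

*Lattice.* The Hartley functions diagonalise the lattice Laplacian (`latticeCov_eq`), so the lattice
fields are finite Gaussian fields driven by the same noise, the same reflection represents the
renormalised measures (`renormalisedMeasure_eq`), and Nelson's bound applies. For finitely many
frequencies everything converges pathwise; the high frequencies are uniformly small, both in the
interaction (`tendstoInMeasure_noiseInteraction`) and in the sup norm of the extended field
(`tendstoInMeasure_extField`), where the frequencies `k i = π / ε` need a separate estimate because
the extension of a real field is not real there. Weak convergence follows (`tendsto_integral_tilted`).
-/

namespace PPhi2

open scoped NNReal ENNReal

/-! ### Wick powers -/

open Polynomial in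
/-- The Wick power as a polynomial in `x`, for an arbitrary (possibly zero) variance parameter:
`q 0 = 1` and `q (n + 1) = X * q n - c * q n'`. For `c > 0` it evaluates to `wickPow c n`, and for
`c = 0` to the ordinary power. -/
noncomputable def wickPolynomial (c : ℝ) : ℕ → Polynomial ℝ
  | 0 => 1
  | n + 1 => X * wickPolynomial c n - C c * derivative (wickPolynomial c n)

/-- Evaluation of `wickPolynomial`. -/
noncomputable def wick (c : ℝ) (n : ℕ) (x : ℝ) : ℝ := (wickPolynomial c n).eval x

open Polynomial in
theorem derivative_wickPolynomial (c : ℝ) (n : ℕ) :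
    derivative (wickPolynomial c (n + 1)) = C ((n : ℝ) + 1) * wickPolynomial c n := by
  induction n with
  | zero => simp [wickPolynomial]
  | succ n ih =>
    rw [wickPolynomial, derivative_sub, derivative_mul, derivative_mul, ih]
    simp only [derivative_X, derivative_mul, derivative_C, wickPolynomial]
    push_cast
    simp only [C_add, C_1]
    ring

@[simp] theorem wick_zero (c x : ℝ) : wick c 0 x = 1 := by simp [wick, wickPolynomial]

@[simp] theorem wick_one (c x : ℝ) : wick c 1 x = x := by simp [wick, wickPolynomial]

theorem wick_succ_succ (c : ℝ) (n : ℕ) (x : ℝ) :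
    wick c (n + 2) x = x * wick c (n + 1) x - c * (n + 1) * wick c n x := by
  rw [wick, wickPolynomial, derivative_wickPolynomial]
  simp [wick]
  ring

theorem wick_succ (c : ℝ) (n : ℕ) (x : ℝ) :
    wick c (n + 1) x = x * wick c n x - c * n * wick c (n - 1) x := by
  cases n with
  | zero => simp
  | succ n => rw [wick_succ_succ]; simp

theorem continuous_wick (c : ℝ) (n : ℕ) : Continuous (wick c n) :=
  (wickPolynomial c n).continuous

theorem continuous_wick_uncurry (n : ℕ) : Continuous (fun p : ℝ × ℝ => wick p.1 n p.2) := by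
  induction n using Nat.twoStepInduction with
  | zero => simpa using continuous_const
  | one => simpa using continuous_snd
  | more n h0 h1 =>
    simp only [wick_succ_succ]
    fun_prop

open Polynomial in
theorem wickPow_eq_wick {c : ℝ} (hc : 0 < c) (n : ℕ) (x : ℝ) : wickPow c n x = wick c n x := by
  have hs : √c ≠ 0 := (Real.sqrt_pos.2 hc).ne'
  have key : ∀ n, wickPolynomial c n =
      C (√c ^ n) * ((hermite n).map (algebraMap ℤ ℝ)).comp (C (√c)⁻¹ * X) := by
    intro n
    induction n with
    | zero => simp [wickPolynomial]
    | succ n ih =>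
      rw [wickPolynomial, ih, hermite_succ]
      simp only [Polynomial.map_sub, Polynomial.map_mul, map_X, sub_comp, mul_comp, X_comp,
        derivative_mul, derivative_C, derivative_comp, zero_mul, zero_add, derivative_X, mul_one,
        derivative_map]
      have e1 : (C (√c ^ (n + 1)) : Polynomial ℝ) * C (√c)⁻¹ = C (√c ^ n) := by
        rw [← C_mul, pow_succ, mul_assoc, mul_inv_cancel₀ hs, mul_one]
      have e2 : (C c : Polynomial ℝ) * C (√c ^ n) * C (√c)⁻¹ = C (√c ^ (n + 1)) := by
        rw [← C_mul, ← C_mul]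
        congr 1
        rw [mul_assoc, mul_comm c, mul_assoc, inv_mul_eq_div, Real.div_sqrt, pow_succ]
      linear_combination (-X * ((hermite n).map (algebraMap ℤ ℝ)).comp (C (√c)⁻¹ * X)) * e1 -
        ((derivative (hermite n)).map (algebraMap ℤ ℝ)).comp (C (√c)⁻¹ * X) * e2
  rw [wick, key, wickPow]
  simp [div_eq_inv_mul, Polynomial.aeval_def, Polynomial.eval_map]

/-- Addition theorem: the Wick power of a sum of independent fields. -/
theorem wick_add (a b x y : ℝ) (n : ℕ) :
    wick (a + b) n (x + y) =
      ∑ j ∈ Finset.range (n + 1), (n.choose j : ℝ) * wick a (n - j) x * wick b j y := by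
  -- Two families `u`, `v` with `u (n + 1) = x * u n - a * n * u (n - 1)` multiply binomially.
  have hsucc : ∀ (f : ℕ → ℕ → ℝ) (n : ℕ),
      ∑ j ∈ Finset.range (n + 2), ((n + 1).choose j : ℝ) * f (n + 1 - j) j =
        (∑ j ∈ Finset.range (n + 1), (n.choose j : ℝ) * f (n - j + 1) j) +
          ∑ j ∈ Finset.range (n + 1), (n.choose j : ℝ) * f (n - j) (j + 1) := by
    intro f n
    rw [Finset.sum_choose_succ_mul (fun i j => f j i)]
    congr 1
    refine Finset.sum_congr rfl fun j hj => ?_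
    rw [Nat.sub_add_comm (by have := Finset.mem_range.1 hj; omega)]
  have hlow1 : ∀ (n : ℕ) (f : ℕ → ℕ → ℝ),
      ∑ j ∈ Finset.range (n + 2), ((n + 1).choose j : ℝ) * ((n + 1 - j : ℕ) * f (n + 1 - j - 1) j) =
        (n + 1) * ∑ j ∈ Finset.range (n + 1), (n.choose j : ℝ) * f (n - j) j := by
    intro n f
    rw [Finset.sum_range_succ]
    simp only [Nat.sub_self, Nat.cast_zero, zero_mul, mul_zero, add_zero, Finset.mul_sum]
    refine Finset.sum_congr rfl fun j hj => ?_
    have hj := Finset.mem_range.1 hj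
    have h1 : n + 1 - j - 1 = n - j := by omega
    have h2 : ((n + 1).choose j : ℝ) * (n + 1 - j : ℕ) = (n + 1) * (n.choose j : ℝ) := by
      exact_mod_cast (Nat.choose_mul_succ_eq n j).symm.trans (mul_comm _ _)
    rw [h1, ← mul_assoc, h2, mul_assoc]
  have hlow2 : ∀ (n : ℕ) (f : ℕ → ℕ → ℝ),
      ∑ j ∈ Finset.range (n + 2), ((n + 1).choose j : ℝ) * (j * f (n + 1 - j) (j - 1)) =
        (n + 1) * ∑ j ∈ Finset.range (n + 1), (n.choose j : ℝ) * f (n - j) j := by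
    intro n f
    rw [Finset.sum_range_succ']
    simp only [Nat.cast_zero, zero_mul, mul_zero, add_zero, Finset.mul_sum,
      Nat.add_sub_add_right, Nat.add_sub_cancel]
    refine Finset.sum_congr rfl fun j hj => ?_
    have h2 : ((n + 1).choose (j + 1) : ℝ) * (j + 1 : ℕ) = (n + 1) * (n.choose j : ℝ) := by
      exact_mod_cast (Nat.add_one_mul_choose_eq n j).symm
    rw [← mul_assoc, h2, mul_assoc]
  induction n using Nat.twoStepInduction with
  | zero => simp
  | one => simp [Finset.sum_range_succ]
  | more n h0 h1 =>
    rw [wick_succ_succ, h0, h1]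
    have e := hsucc (fun i j => wick a i x * wick b j y) (n + 1)
    simp only [mul_assoc] at e ⊢
    rw [e]
    simp only [wick_succ]
    have l1 := hlow1 n (fun i j => wick a i x * wick b j y)
    have l2 := hlow2 n (fun i j => wick a i x * wick b j y)
    have f1 : ∀ (k j : ℕ), ((n + 1).choose j : ℝ) *
        ((x * wick a k x - a * (k * wick a (k - 1) x)) * wick b j y) =
        x * (((n + 1).choose j : ℝ) * (wick a k x * wick b j y)) -
          a * (((n + 1).choose j : ℝ) * (k * (wick a (k - 1) x * wick b j y))) := by
      intros; ring
    have f2 : ∀ (k j : ℕ), ((n + 1).choose j : ℝ) *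
        (wick a k x * (y * wick b j y - b * (j * wick b (j - 1) y))) =
        y * (((n + 1).choose j : ℝ) * (wick a k x * wick b j y)) -
          b * (((n + 1).choose j : ℝ) * (j * (wick a k x * wick b (j - 1) y))) := by
      intros; ring
    simp only [mul_assoc, f1, f2, Finset.sum_sub_distrib, ← Finset.mul_sum, l1, l2]
    ring

/-! ### Lower bounds for Wick ordered polynomials -/

/-- The Wick power differs from the power by a polynomial of lower degree in `x` whose coefficients
grow at most polynomially in the variance. -/
theorem exists_abs_wick_sub_pow_le (n : ℕ) : ∃ C, 0 ≤ C ∧ ∀ c x : ℝ, 0 ≤ c →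
    |wick c (n + 1) x - x ^ (n + 1)| ≤ C * (1 + c) ^ (n + 1) * (1 + |x|) ^ n := by
  induction n using Nat.strong_induction_on with
  | _ n ih =>
  match n, ih with
  | 0, _ => exact ⟨0, le_rfl, fun c x _ => by simp⟩
  | 1, _ =>
    refine ⟨1, zero_le_one, fun c x hc => ?_⟩
    rw [wick_succ_succ]
    simp only [zero_add, wick_one, wick_zero, Nat.cast_zero]
    rw [show x * x - c * 1 * 1 - x ^ (1 + 1) = -c by ring, abs_neg, abs_of_nonneg hc]
    have h1 : 1 + c ≤ (1 + c) ^ 2 := by nlinarith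
    have h2 : (1 + c) ^ 2 * 1 ≤ (1 + c) ^ 2 * (1 + |x|) := by
      gcongr; linarith [abs_nonneg x]
    norm_num at h2 ⊢
    linarith
  | n + 2, ih =>
    obtain ⟨C1, h1, hC1⟩ := ih (n + 1) (by omega)
    obtain ⟨C0, h0, hC0⟩ := ih n (by omega)
    refine ⟨C1 + (n + 2) * (C0 + 1), by positivity, fun c x hc => ?_⟩
    have e1 := hC1 c x hc
    have e0 := hC0 c x hc
    rw [show n + 2 + 1 = (n + 1) + 2 by ring, wick_succ_succ]
    have hx := abs_nonneg x
    have hw : |wick c (n + 1) x| ≤ (C0 + 1) * ((1 + c) ^ (n + 1) * (1 + |x|) ^ (n + 1)) := by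
      have : |x ^ (n + 1)| ≤ (1 + c) ^ (n + 1) * (1 + |x|) ^ (n + 1) := by
        rw [abs_pow]
        have a1 : |x| ^ (n + 1) ≤ (1 + |x|) ^ (n + 1) := by gcongr; linarith
        have a2 : 1 ≤ (1 + c) ^ (n + 1) := one_le_pow₀ (by linarith)
        nlinarith [pow_nonneg hx (n + 1)]
      have h3 : C0 * (1 + c) ^ (n + 1) * (1 + |x|) ^ n ≤
          C0 * ((1 + c) ^ (n + 1) * (1 + |x|) ^ (n + 1)) := by
        rw [mul_assoc]
        gcongr
        · linarith
        · omega
      calc |wick c (n + 1) x| = |(wick c (n + 1) x - x ^ (n + 1)) + x ^ (n + 1)| := by ring_nf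
        _ ≤ _ := abs_add_le _ _
        _ ≤ _ := by linarith
    have hd : x * wick c (n + 1 + 1) x - c * ((n + 1 : ℕ) + 1) * wick c (n + 1) x - x ^ (n + 1 + 2) =
      x * (wick c (n + 1 + 1) x - x ^ (n + 1 + 1)) - c * (n + 2) * wick c (n + 1) x := by
      push_cast; ring
    rw [hd]
    calc _ ≤ |x| * |wick c (n + 1 + 1) x - x ^ (n + 1 + 1)| + c * (n + 2) * |wick c (n + 1) x| := by
          refine (abs_sub _ _).trans ?_
          rw [abs_mul, abs_mul, abs_of_nonneg (by positivity : 0 ≤ c * ((n : ℝ) + 2))]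
      _ ≤ (1 + |x|) * (C1 * (1 + c) ^ (n + 1 + 1) * (1 + |x|) ^ (n + 1)) +
          (1 + c) * (n + 2) * ((C0 + 1) * ((1 + c) ^ (n + 1) * (1 + |x|) ^ (n + 1))) := by
          gcongr <;> linarith
      _ = C1 * (1 + c) ^ (n + 2) * (1 + |x|) ^ (n + 2) +
          (n + 2) * (C0 + 1) * (1 + c) ^ (n + 2) * (1 + |x|) ^ (n + 1) := by ring
      _ ≤ C1 * (1 + c) ^ (n + 3) * (1 + |x|) ^ (n + 2) +
          (n + 2) * (C0 + 1) * (1 + c) ^ (n + 3) * (1 + |x|) ^ (n + 2) := by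
          gcongr <;> linarith
      _ = _ := by ring

/-- Crude growth bound for Wick powers. -/
theorem exists_abs_wick_le (n : ℕ) : ∃ C, 0 ≤ C ∧ ∀ c x : ℝ, 0 ≤ c →
    |wick c n x| ≤ C * (1 + c) ^ n * (1 + |x|) ^ n := by
  cases n with
  | zero => exact ⟨1, zero_le_one, fun c x _ => by simp⟩
  | succ n =>
    obtain ⟨C, h, hC⟩ := exists_abs_wick_sub_pow_le n
    refine ⟨C + 1, by positivity, fun c x hc => ?_⟩
    have hx := abs_nonneg x
    calc |wick c (n + 1) x| = |(wick c (n + 1) x - x ^ (n + 1)) + x ^ (n + 1)| := by ring_nf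
      _ ≤ |wick c (n + 1) x - x ^ (n + 1)| + |x| ^ (n + 1) := by
        rw [← abs_pow]; exact abs_add_le _ _
      _ ≤ C * (1 + c) ^ (n + 1) * (1 + |x|) ^ n + 1 * (1 + |x|) ^ (n + 1) := by
        gcongr
        · exact hC c x hc
        · rw [one_mul]; gcongr; linarith
      _ ≤ C * (1 + c) ^ (n + 1) * (1 + |x|) ^ (n + 1) + (1 + c) ^ (n + 1) * (1 + |x|) ^ (n + 1) := by
        gcongr
        · linarith
        · omega
        · exact one_le_pow₀ (by linarith)
      _ = _ := by ring

/-- A Wick ordered polynomial of even degree with positive leading coefficient is bounded below,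
with a bound growing polynomially in the variance. -/
theorem exists_wick_lower_bound (P : Polynomial ℝ) (hdeg : Even P.natDegree)
    (hpos : 0 < P.natDegree) (hlead : 0 < P.leadingCoeff) :
    ∃ (D : ℝ) (E : ℕ), 0 ≤ D ∧ ∀ c y : ℝ, 0 ≤ c →
      -(D * (1 + c) ^ E) ≤ ∑ k ∈ Finset.range (P.natDegree + 1), P.coeff k * wick c k y := by
  obtain ⟨n, hn⟩ : ∃ n, P.natDegree = n + 1 := ⟨P.natDegree - 1, by omega⟩
  have hl : P.leadingCoeff = P.coeff (n + 1) := by rw [Polynomial.leadingCoeff, hn]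
  obtain ⟨C0, h0, hC0⟩ := exists_abs_wick_sub_pow_le n
  choose Ck hk0 hCk using exists_abs_wick_le
  set a := P.coeff (n + 1) with ha
  rw [hl] at hlead
  set B := a * C0 + ∑ k ∈ Finset.range (n + 1), |P.coeff k| * Ck k with hB
  have hB0 : 0 ≤ B := add_nonneg (by positivity)
    (Finset.sum_nonneg fun k _ => mul_nonneg (abs_nonneg _) (hk0 k))
  -- the lower order terms are dominated by `B * (1 + c) ^ (n + 1) * (1 + |y|) ^ n`
  have hlow : ∀ c y : ℝ, 0 ≤ c → a * y ^ (n + 1) - B * ((1 + c) ^ (n + 1) * (1 + |y|) ^ n) ≤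
      ∑ k ∈ Finset.range (n + 2), P.coeff k * wick c k y := by
    intro c y hc
    have hy := abs_nonneg y
    rw [Finset.sum_range_succ, ← ha]
    have e1 : -(a * (C0 * (1 + c) ^ (n + 1) * (1 + |y|) ^ n)) ≤
        a * (wick c (n + 1) y - y ^ (n + 1)) := by
      rw [← mul_neg]
      gcongr
      exact (abs_le.1 (hC0 c y hc)).1
    have e2 : -∑ k ∈ Finset.range (n + 1), |P.coeff k| * Ck k *
        ((1 + c) ^ (n + 1) * (1 + |y|) ^ n) ≤
        ∑ k ∈ Finset.range (n + 1), P.coeff k * wick c k y := by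
      rw [← Finset.sum_neg_distrib]
      refine Finset.sum_le_sum fun k hk => ?_
      have hk := Finset.mem_range.1 hk
      have : |P.coeff k * wick c k y| ≤
          |P.coeff k| * Ck k * ((1 + c) ^ (n + 1) * (1 + |y|) ^ n) := by
        rw [abs_mul]
        have h1 := hCk k c y hc
        calc _ ≤ |P.coeff k| * (Ck k * (1 + c) ^ k * (1 + |y|) ^ k) := by gcongr
          _ ≤ |P.coeff k| * (Ck k * (1 + c) ^ (n + 1) * (1 + |y|) ^ n) := by
            have := hk0 k
            gcongr <;> linarith
          _ = _ := by ring
      exact (abs_le.1 this).1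
    rw [← Finset.sum_mul] at e2
    rw [hB]
    linarith
  rw [hn]
  set R : ℝ := 1 + B * 2 ^ n / a with hR
  have hR1 : 1 ≤ R := by
    have : 0 ≤ B * 2 ^ n / a := by positivity
    linarith
  refine ⟨B * (2 * R) ^ n, (n + 1) + (n + 1) * n, by positivity, fun c y hc => ?_⟩
  refine le_trans ?_ (hlow c y hc)
  have hy := abs_nonneg y
  have hev : y ^ (n + 1) = |y| ^ (n + 1) := by rw [← hn, hdeg.pow_abs]
  have hu : 1 ≤ (1 + c) ^ (n + 1) := one_le_pow₀ (by linarith)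
  by_cases hcase : R * (1 + c) ^ (n + 1) ≤ |y|
  · have h1y : 1 ≤ |y| := by nlinarith
    have h2 : (1 + |y|) ^ n ≤ 2 ^ n * |y| ^ n := by
      rw [← mul_pow]; gcongr; linarith
    have h3 : B * ((1 + c) ^ (n + 1) * (1 + |y|) ^ n) ≤ a * y ^ (n + 1) := by
      rw [hev]
      calc B * ((1 + c) ^ (n + 1) * (1 + |y|) ^ n)
          ≤ B * ((1 + c) ^ (n + 1) * (2 ^ n * |y| ^ n)) := by gcongr
        _ = a * ((B * 2 ^ n / a * (1 + c) ^ (n + 1)) * |y| ^ n) := by field_simp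
        _ ≤ a * ((R * (1 + c) ^ (n + 1)) * |y| ^ n) := by
          gcongr
          rw [hR]; linarith
        _ ≤ a * (|y| * |y| ^ n) := by gcongr
        _ = _ := by ring
    have : 0 ≤ B * (2 * R) ^ n * (1 + c) ^ (n + 1 + (n + 1) * n) := by positivity
    linarith
  · push Not at hcase
    have h1 : 1 + |y| ≤ 2 * R * (1 + c) ^ (n + 1) := by nlinarith
    have h2 : 0 ≤ a * y ^ (n + 1) := by rw [hev]; positivity
    have h3 : B * ((1 + c) ^ (n + 1) * (1 + |y|) ^ n) ≤
        B * (2 * R) ^ n * (1 + c) ^ (n + 1 + (n + 1) * n) := by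
      calc B * ((1 + c) ^ (n + 1) * (1 + |y|) ^ n)
          ≤ B * ((1 + c) ^ (n + 1) * (2 * R * (1 + c) ^ (n + 1)) ^ n) := by gcongr
        _ = _ := by rw [mul_pow, ← pow_mul]; ring
    linarith

/-! ### Functions with moments of all orders -/

section AllLp

variable {α β 𝕜 : Type*} [MeasurableSpace α] [MeasurableSpace β] {μ : Measure α} {ν : Measure β}
  [RCLike 𝕜]

/-- The random variable `f` has moments of all orders. -/
def AllLp (f : α → 𝕜) (μ : Measure α) : Prop := ∀ p : ℝ≥0, MemLp f p μ

theorem AllLp.add {f g : α → 𝕜} (hf : AllLp f μ) (hg : AllLp g μ) :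
    AllLp (fun x => f x + g x) μ := fun p => (hf p).add (hg p)

theorem AllLp.sub {f g : α → 𝕜} (hf : AllLp f μ) (hg : AllLp g μ) :
    AllLp (fun x => f x - g x) μ := fun p => (hf p).sub (hg p)

theorem AllLp.mul {f g : α → 𝕜} (hf : AllLp f μ) (hg : AllLp g μ) :
    AllLp (fun x => f x * g x) μ := fun p => by
  have : ENNReal.HolderTriple ((2 * p : ℝ≥0) : ℝ≥0∞) ((2 * p : ℝ≥0) : ℝ≥0∞) p := ⟨by
    push_cast
    rw [ENNReal.mul_inv (by simp) (by simp), ← add_mul, ENNReal.inv_two_add_inv_two, one_mul]⟩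
  exact (hg (2 * p)).mul (hf (2 * p))

theorem allLp_const [IsFiniteMeasure μ] (c : 𝕜) : AllLp (fun _ => c) μ := fun _ => memLp_const c

theorem AllLp.sum {ι : Type*} (s : Finset ι) {f : ι → α → 𝕜} (hf : ∀ i ∈ s, AllLp (f i) μ) :
    AllLp (fun x => ∑ i ∈ s, f i x) μ := fun p => memLp_finsetSum s fun i hi => hf i hi p

theorem AllLp.prod [IsFiniteMeasure μ] {ι : Type*} (s : Finset ι) {f : ι → α → 𝕜}
    (hf : ∀ i ∈ s, AllLp (f i) μ) : AllLp (fun x => ∏ i ∈ s, f i x) μ := by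
  classical
  induction s using Finset.induction_on with
  | empty => simpa using allLp_const (1 : 𝕜)
  | insert a s ha ih =>
    simp only [Finset.prod_insert ha]
    exact (hf a (by simp)).mul (ih fun i hi => hf i (by simp [hi]))

theorem AllLp.pow [IsFiniteMeasure μ] {f : α → 𝕜} (hf : AllLp f μ) (n : ℕ) :
    AllLp (fun x => f x ^ n) μ := by
  simpa using AllLp.prod (Finset.range n) (f := fun _ => f) fun _ _ => hf

theorem AllLp.integrable {f : α → 𝕜} (hf : AllLp f μ) : Integrable f μ :=
  memLp_one_iff_integrable.1 (hf 1)

theorem AllLp.integrable_norm_pow [IsFiniteMeasure μ] {f : α → 𝕜} (hf : AllLp f μ) (n : ℕ) :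
    Integrable (fun x => ‖f x‖ ^ n) μ := MemLp.integrable_norm_pow' (hf n)

theorem AllLp.comp {f : β → 𝕜} (hf : AllLp f ν) {φ : α → β} (hφ : MeasurePreserving φ μ ν) :
    AllLp (fun x => f (φ x)) μ := fun p => (hf p).comp_measurePreserving hφ

theorem AllLp.ofReal {f : α → ℝ} (hf : AllLp f μ) : AllLp (fun x => (f x : 𝕜)) μ :=
  fun p => (hf p).ofReal

theorem AllLp.conj {f : α → ℂ} (hf : AllLp f μ) : AllLp (fun x => starRingEnd ℂ (f x)) μ :=
  fun p => (hf p).of_le (Complex.continuous_conj.comp_aestronglyMeasurable (hf p).1)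
    (ae_of_all _ fun x => by simp)

end AllLp

/-! ### The standard Gaussian on the line -/

/-- The standard Gaussian measure on the real line. -/
noncomputable abbrev stdNormal : Measure ℝ := gaussianReal 0 1

theorem allLp_id_stdNormal : AllLp (fun x : ℝ => x) stdNormal := fun p => memLp_id_gaussianReal p

theorem allLp_ofReal_stdNormal : AllLp (fun x : ℝ => (x : ℂ)) stdNormal :=
  allLp_id_stdNormal.ofReal

theorem allLp_polynomial (p : Polynomial ℂ) : AllLp (fun x : ℝ => p.eval (x : ℂ)) stdNormal := by
  simp only [Polynomial.eval_eq_sum_range]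
  exact AllLp.sum _ fun i _ => (allLp_const _).mul (allLp_ofReal_stdNormal.pow i)

/-- Gaussian integration by parts for polynomials. -/
theorem integral_mul_polynomial_stdNormal (p : Polynomial ℂ) :
    ∫ x : ℝ, (x : ℂ) * p.eval (x : ℂ) ∂stdNormal =
      ∫ x : ℝ, p.derivative.eval (x : ℂ) ∂stdNormal := by
  have hint : ∀ {f : ℝ → ℂ}, Integrable f stdNormal →
      Integrable (fun x => gaussianPDFReal 0 1 x • f x) := by
    intro f hf
    rw [stdNormal, gaussianReal_of_var_ne_zero 0 one_ne_zero] at hf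
    rw [integrable_withDensity_iff_integrable_smul' (measurable_gaussianPDF 0 1)
      (ae_of_all _ fun x => gaussianPDF_lt_top)] at hf
    simpa [toReal_gaussianPDF] using hf
  have hder : ∀ x : ℝ, HasDerivAt (gaussianPDFReal 0 1) (-x * gaussianPDFReal 0 1 x) x := by
    intro x
    rw [gaussianPDFReal_def]
    have h : HasDerivAt (fun x : ℝ => Real.exp (-(x - 0) ^ 2 / (2 * ((1 : ℝ≥0) : ℝ))))
        (Real.exp (-(x - 0) ^ 2 / (2 * ((1 : ℝ≥0) : ℝ))) * (-x)) x := by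
      refine HasDerivAt.exp ?_
      have h2 := ((hasDerivAt_id x).pow 2).neg.div_const 2
      simp only [NNReal.coe_one, mul_one, sub_zero]
      refine h2.congr_deriv ?_
      simp only [id_eq, Nat.cast_ofNat]
      ring
    refine (h.const_mul _).congr_deriv ?_
    ring
  rw [integral_gaussianReal_eq_integral_smul one_ne_zero,
    integral_gaussianReal_eq_integral_smul one_ne_zero]
  have hparts := integral_mul_deriv_eq_deriv_mul_of_integrable
    (u := fun x : ℝ => p.eval (x : ℂ)) (u' := fun x : ℝ => p.derivative.eval (x : ℂ))
    (v := fun x : ℝ => (gaussianPDFReal 0 1 x : ℂ))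
    (v' := fun x : ℝ => ((-x * gaussianPDFReal 0 1 x : ℝ) : ℂ))
    (fun x _ => (p.hasDerivAt (x : ℂ)).comp_ofReal) (fun x _ => (hder x).ofReal_comp) ?_ ?_ ?_
  · have e1 : ∀ x : ℝ, gaussianPDFReal 0 1 x • ((x : ℂ) * p.eval (x : ℂ)) =
        -(p.eval (x : ℂ) * ((-x * gaussianPDFReal 0 1 x : ℝ) : ℂ)) := by
      intro x
      rw [Complex.real_smul]
      push_cast; ring
    have e2 : ∀ x : ℝ, gaussianPDFReal 0 1 x • p.derivative.eval (x : ℂ) =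
        p.derivative.eval (x : ℂ) * (gaussianPDFReal 0 1 x : ℂ) := by
      intro x
      rw [Complex.real_smul, mul_comm]
    simp only [e1, e2]
    rw [integral_neg, hparts, neg_neg]
  · refine (hint (f := fun x => -((x : ℂ) * p.eval (x : ℂ))) ?_).congr (ae_of_all _ fun x => ?_)
    · exact (allLp_ofReal_stdNormal.mul (allLp_polynomial p)).integrable.neg
    · simp only [Complex.real_smul, Pi.mul_apply]; push_cast; ring
  · refine (hint (allLp_polynomial p.derivative).integrable).congr (ae_of_all _ fun x => ?_)
    simp only [Complex.real_smul, Pi.mul_apply]; ring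
  · refine (hint (allLp_polynomial p).integrable).congr (ae_of_all _ fun x => ?_)
    simp only [Complex.real_smul, Pi.mul_apply]; ring

open Polynomial in
/-- Wick powers are averages of ordinary powers over an imaginary Gaussian shift. -/
theorem wick_eq_integral {c : ℝ} (hc : 0 ≤ c) (n : ℕ) (x : ℝ) :
    (wick c n x : ℂ) = ∫ y : ℝ, ((x : ℂ) + Complex.I * √c * y) ^ n ∂stdNormal := by
  have hint : ∀ n, AllLp (fun y : ℝ => ((x : ℂ) + Complex.I * √c * y) ^ n) stdNormal := fun n =>
    ((allLp_const _).add ((allLp_const _).mul allLp_ofReal_stdNormal)).pow n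
  induction n using Nat.twoStepInduction with
  | zero => simp
  | one =>
    have h1 : ∫ y : ℝ, (y : ℂ) ∂stdNormal = 0 := by
      rw [integral_complex_ofReal, integral_id_gaussianReal]; simp
    simp only [pow_one, wick_one]
    rw [integral_add (allLp_const _).integrable
      ((allLp_const _).mul allLp_ofReal_stdNormal).integrable, integral_const_mul, h1]
    simp
  | more n h0 h1 =>
    have hst := integral_mul_polynomial_stdNormal ((C (x : ℂ) + C (Complex.I * √c) * X) ^ (n + 1))
    simp only [derivative_pow, derivative_add, derivative_C, derivative_mul, derivative_X,
      eval_mul, eval_add, eval_pow, eval_C, eval_X, zero_mul, mul_one, zero_add,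
      Nat.add_sub_cancel] at hst
    have e : ∀ y : ℝ, ((x : ℂ) + Complex.I * √c * y) ^ (n + 2) =
        x * ((x : ℂ) + Complex.I * √c * y) ^ (n + 1) +
          Complex.I * √c * (y * ((x : ℂ) + Complex.I * √c * y) ^ (n + 1)) := by
      intro y; ring
    simp only [e]
    rw [integral_add ((allLp_const _).mul (hint _)).integrable ((allLp_const _).mul
      (allLp_ofReal_stdNormal.mul (hint _))).integrable, integral_const_mul, integral_const_mul,
      hst, ← h1, integral_mul_const, integral_const_mul, ← h0, wick_succ_succ]
    have hs : ((√c : ℝ) : ℂ) * (√c : ℝ) = c := by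
      rw [← Complex.ofReal_mul, Real.mul_self_sqrt hc]
    push_cast
    linear_combination ((n : ℂ) + 1) * wick c n x * hs -
      ((n : ℂ) + 1) * wick c n x * (√c : ℝ) * (√c : ℝ) * Complex.I_mul_I

/-- The monomials in a complex Gaussian are orthogonal. -/
theorem integral_complex_monomial (a b : ℕ) :
    ∫ x : ℝ, ∫ y : ℝ, ((x : ℂ) + Complex.I * y) ^ a * ((x : ℂ) - Complex.I * y) ^ b
      ∂stdNormal ∂stdNormal = if a = b then (a.factorial : ℂ) * 2 ^ a else 0 := by
  set F : ℕ → ℕ → ℝ → ℝ → ℂ := fun a b x y =>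
    ((x : ℂ) + Complex.I * y) ^ a * ((x : ℂ) - Complex.I * y) ^ b with hF
  have hX : AllLp (fun p : ℝ × ℝ => (p.1 : ℂ)) (stdNormal.prod stdNormal) :=
    allLp_ofReal_stdNormal.comp measurePreserving_fst
  have hY : AllLp (fun p : ℝ × ℝ => (p.2 : ℂ)) (stdNormal.prod stdNormal) :=
    allLp_ofReal_stdNormal.comp measurePreserving_snd
  have hFa : ∀ a b, AllLp (fun p : ℝ × ℝ => F a b p.1 p.2) (stdNormal.prod stdNormal) := fun a b =>
    ((hX.add ((allLp_const _).mul hY)).pow a).mul ((hX.sub ((allLp_const _).mul hY)).pow b)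
  have hpr : ∀ {f : ℝ → ℝ → ℂ}, AllLp (fun p : ℝ × ℝ => f p.1 p.2) (stdNormal.prod stdNormal) →
      ∫ x, ∫ y, f x y ∂stdNormal ∂stdNormal = ∫ p, f p.1 p.2 ∂(stdNormal.prod stdNormal) :=
    fun h => (integral_prod (fun p : ℝ × ℝ => _) h.integrable).symm
  have hrec : ∀ a b, ∫ x, ∫ y, F a (b + 1) x y ∂stdNormal ∂stdNormal =
      2 * a * ∫ x, ∫ y, F (a - 1) b x y ∂stdNormal ∂stdNormal := by
    intro a b
    have e1 : ∫ x, ∫ y, (x : ℂ) * F a b x y ∂stdNormal ∂stdNormal =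
        ∫ x, ∫ y, (a * F (a - 1) b x y + b * F a (b - 1) x y) ∂stdNormal ∂stdNormal := by
      refine (integral_integral_swap (hX.mul (hFa a b)).integrable).trans (Eq.trans ?_
        (integral_integral_swap (((allLp_const _).mul (hFa (a - 1) b)).add
          ((allLp_const _).mul (hFa a (b - 1)))).integrable).symm)
      congr 1
      funext y
      have := integral_mul_polynomial_stdNormal
        ((Polynomial.X + Polynomial.C (Complex.I * y)) ^ a *
          (Polynomial.X - Polynomial.C (Complex.I * y)) ^ b)
      simp only [Polynomial.derivative_mul, Polynomial.derivative_pow, Polynomial.derivative_add,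
        Polynomial.derivative_sub, Polynomial.derivative_C, Polynomial.derivative_X,
        Polynomial.eval_mul, Polynomial.eval_add, Polynomial.eval_sub, Polynomial.eval_pow,
        Polynomial.eval_C, Polynomial.eval_X, add_zero, sub_zero, mul_one] at this
      rw [hF]
      simp only
      rw [this]
      congr 1
      funext x
      ring
    have e2 : ∫ x, ∫ y, (y : ℂ) * F a b x y ∂stdNormal ∂stdNormal =
        ∫ x, ∫ y, Complex.I * (a * F (a - 1) b x y - b * F a (b - 1) x y)
          ∂stdNormal ∂stdNormal := by
      congr 1
      funext x
      have := integral_mul_polynomial_stdNormal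
        ((Polynomial.C (x : ℂ) + Polynomial.C Complex.I * Polynomial.X) ^ a *
          (Polynomial.C (x : ℂ) - Polynomial.C Complex.I * Polynomial.X) ^ b)
      simp only [Polynomial.derivative_mul, Polynomial.derivative_pow, Polynomial.derivative_add,
        Polynomial.derivative_sub, Polynomial.derivative_C, Polynomial.derivative_X,
        Polynomial.eval_mul, Polynomial.eval_add, Polynomial.eval_sub, Polynomial.eval_pow,
        Polynomial.eval_C, Polynomial.eval_X, zero_add, zero_mul, mul_one, zero_sub, Polynomial.eval_neg] at this
      rw [hF]
      simp only
      rw [this]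
      congr 1
      funext y
      ring
    have hsum : AllLp (fun p : ℝ × ℝ => a * F (a - 1) b p.1 p.2 + b * F a (b - 1) p.1 p.2)
        (stdNormal.prod stdNormal) :=
      ((allLp_const _).mul (hFa (a - 1) b)).add ((allLp_const _).mul (hFa a (b - 1)))
    have hdiff : AllLp (fun p : ℝ × ℝ => Complex.I *
        (a * F (a - 1) b p.1 p.2 - b * F a (b - 1) p.1 p.2)) (stdNormal.prod stdNormal) :=
      (allLp_const _).mul
        (((allLp_const _).mul (hFa (a - 1) b)).sub ((allLp_const _).mul (hFa a (b - 1))))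
    rw [hpr (f := fun x y => (x : ℂ) * F a b x y) (hX.mul (hFa a b)),
      hpr (f := fun x y => a * F (a - 1) b x y + b * F a (b - 1) x y) hsum] at e1
    rw [hpr (f := fun x y => (y : ℂ) * F a b x y) (hY.mul (hFa a b)),
      hpr (f := fun x y => Complex.I * (a * F (a - 1) b x y - b * F a (b - 1) x y)) hdiff] at e2
    rw [hpr (hFa a (b + 1)), hpr (hFa (a - 1) b)]
    have e3 : ∀ p : ℝ × ℝ, F a (b + 1) p.1 p.2 =
        p.1 * F a b p.1 p.2 - Complex.I * (p.2 * F a b p.1 p.2) := by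
      intro p; simp only [hF]; ring
    simp only [e3]
    rw [integral_sub (hX.mul (hFa a b)).integrable
      ((allLp_const _).mul (hY.mul (hFa a b))).integrable, integral_const_mul, e1, e2,
      ← integral_const_mul, ← integral_sub hsum.integrable
      ((allLp_const _).mul hdiff).integrable, ← integral_const_mul]
    congr 1
    funext p
    linear_combination (-(a * F (a - 1) b p.1 p.2 - b * F a (b - 1) p.1 p.2)) * Complex.I_mul_I
  have hzero : ∀ b, ∫ x, ∫ y, F 0 (b + 1) x y ∂stdNormal ∂stdNormal = 0 := by
    intro b; rw [hrec]; simp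
  change ∫ x, ∫ y, F a b x y ∂stdNormal ∂stdNormal = _
  induction b generalizing a with
  | zero =>
    cases a with
    | zero => simp [hF]
    | succ a =>
      have e : ∀ p : ℝ × ℝ, F (a + 1) 0 p.1 p.2 = starRingEnd ℂ (F 0 (a + 1) p.1 p.2) := by
        intro p; simp [hF]
      rw [hpr (hFa _ _)]
      simp only [e]
      rw [integral_conj, ← hpr (hFa _ _), hzero]
      simp
  | succ b ih =>
    rw [hrec]
    cases a with
    | zero => simp
    | succ a =>
      rw [Nat.add_sub_cancel, ih]
      by_cases h : a = b
      · subst h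
        simp only [if_true, Nat.factorial_succ]
        push_cast; ring
      · simp [h]

/-! ### Holomorphic hypercontractivity -/

section Fock

variable {ι : Type*} [Fintype ι]

/-- Independent standard Gaussian coordinates indexed by a finite type. -/
noncomputable abbrev gaussPi (ι : Type*) [Fintype ι] : Measure (ι → ℝ) :=
  Measure.pi fun _ => stdNormal

/-- The complex Gaussian vector `g + i g'` built from two independent real ones. -/
noncomputable def complexNoise (p : (ι → ℝ) × (ι → ℝ)) (i : ι) : ℂ := (p.1 i : ℂ) + Complex.I * p.2 i

/-- The variance `α! * 2 ^ |α|` of the monomial `z ^ α` in a complex Gaussian vector. -/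
noncomputable def fockWeight (α : ι →₀ ℕ) : ℝ := ∏ i, ((α i).factorial : ℝ) * 2 ^ α i

theorem fockWeight_pos (α : ι →₀ ℕ) : 0 < fockWeight α :=
  Finset.prod_pos fun _ _ => by positivity

/-- The squared norm of a polynomial in the Segal-Bargmann space: its second absolute moment under
the complex Gaussian measure. -/
noncomputable def fockNormSq (F : MvPolynomial ι ℂ) : ℝ :=
  ∑ α ∈ F.support, ‖F.coeff α‖ ^ 2 * fockWeight α

theorem fockNormSq_nonneg (F : MvPolynomial ι ℂ) : 0 ≤ fockNormSq F :=
  Finset.sum_nonneg fun α _ => mul_nonneg (sq_nonneg _) (fockWeight_pos α).le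

theorem allLp_eval_gaussPi (i : ι) : AllLp (fun g : ι → ℝ => g i) (gaussPi ι) :=
  allLp_id_stdNormal.comp (measurePreserving_eval _ i)

theorem allLp_complexNoise (i : ι) :
    AllLp (fun p : (ι → ℝ) × (ι → ℝ) => complexNoise p i) ((gaussPi ι).prod (gaussPi ι)) := by
  have h1 : AllLp (fun p : (ι → ℝ) × (ι → ℝ) => (p.1 i : ℂ)) ((gaussPi ι).prod (gaussPi ι)) :=
    (allLp_eval_gaussPi i).ofReal.comp (f := fun g : ι → ℝ => (g i : ℂ)) measurePreserving_fst
  have h2 : AllLp (fun p : (ι → ℝ) × (ι → ℝ) => (p.2 i : ℂ)) ((gaussPi ι).prod (gaussPi ι)) :=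
    (allLp_eval_gaussPi i).ofReal.comp (f := fun g : ι → ℝ => (g i : ℂ)) measurePreserving_snd
  exact h1.add ((allLp_const _).mul h2)

theorem allLp_monomial (α : ι →₀ ℕ) :
    AllLp (fun p : (ι → ℝ) × (ι → ℝ) => ∏ i, complexNoise p i ^ α i)
      ((gaussPi ι).prod (gaussPi ι)) :=
  AllLp.prod _ fun i _ => (allLp_complexNoise i).pow _

theorem allLp_eval (F : MvPolynomial ι ℂ) :
    AllLp (fun p : (ι → ℝ) × (ι → ℝ) => MvPolynomial.eval (complexNoise p) F)
      ((gaussPi ι).prod (gaussPi ι)) := by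
  simp only [MvPolynomial.eval_eq']
  exact AllLp.sum _ fun α _ => (allLp_const _).mul (allLp_monomial α)

theorem integral_monomial_mul_conj (α β : ι →₀ ℕ) :
    ∫ p, (∏ i, complexNoise p i ^ α i) * starRingEnd ℂ (∏ i, complexNoise p i ^ β i)
      ∂((gaussPi ι).prod (gaussPi ι)) = if α = β then (fockWeight α : ℂ) else 0 := by
  rw [integral_prod _ ((allLp_monomial α).mul (allLp_monomial β).conj).integrable]
  have e : ∀ g g' : ι → ℝ, (∏ i, complexNoise (g, g') i ^ α i) *
      starRingEnd ℂ (∏ i, complexNoise (g, g') i ^ β i) =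
      ∏ i, ((g i : ℂ) + Complex.I * g' i) ^ α i * ((g i : ℂ) - Complex.I * g' i) ^ β i := by
    intro g g'
    simp [complexNoise, Finset.prod_mul_distrib, map_prod, sub_eq_add_neg]
  simp only [e]
  have e1 : ∀ g : ι → ℝ, ∫ g' : ι → ℝ, ∏ i, ((g i : ℂ) + Complex.I * g' i) ^ α i *
      ((g i : ℂ) - Complex.I * g' i) ^ β i ∂gaussPi ι =
      ∏ i, ∫ y : ℝ, ((g i : ℂ) + Complex.I * y) ^ α i * ((g i : ℂ) - Complex.I * y) ^ β i
        ∂stdNormal := fun g =>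
    integral_fintype_prod_eq_prod (f := fun i (y : ℝ) => ((g i : ℂ) + Complex.I * y) ^ α i *
      ((g i : ℂ) - Complex.I * y) ^ β i)
  simp only [e1]
  rw [integral_fintype_prod_eq_prod (f := fun i (x : ℝ) => ∫ y : ℝ, ((x : ℂ) + Complex.I * y) ^ α i *
      ((x : ℂ) - Complex.I * y) ^ β i ∂stdNormal)]
  simp only [integral_complex_monomial]
  split_ifs with h
  · subst h; simp [fockWeight]
  · obtain ⟨i, hi⟩ : ∃ i, α i ≠ β i := by
      by_contra hcon; push Not at hcon; exact h (Finsupp.ext hcon)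
    exact Finset.prod_eq_zero (Finset.mem_univ i) (if_neg hi)

/-- The Segal-Bargmann norm is the second moment under the complex Gaussian measure. -/
theorem integral_norm_sq_eval (F : MvPolynomial ι ℂ) :
    ∫ p, ‖MvPolynomial.eval (complexNoise p) F‖ ^ 2 ∂((gaussPi ι).prod (gaussPi ι)) =
      fockNormSq F := by
  have h : ((∫ p, ‖MvPolynomial.eval (complexNoise p) F‖ ^ 2
      ∂((gaussPi ι).prod (gaussPi ι)) : ℝ) : ℂ) = (fockNormSq F : ℂ) := by
    rw [← integral_complex_ofReal]
    have e : ∀ p, ((‖MvPolynomial.eval (complexNoise p) F‖ ^ 2 : ℝ) : ℂ) =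
        ∑ α ∈ F.support, ∑ β ∈ F.support, F.coeff α * starRingEnd ℂ (F.coeff β) *
          ((∏ i, complexNoise p i ^ α i) * starRingEnd ℂ (∏ i, complexNoise p i ^ β i)) := by
      intro p
      push_cast
      rw [← Complex.mul_conj', MvPolynomial.eval_eq', map_sum, Finset.sum_mul_sum]
      refine Finset.sum_congr rfl fun α _ => Finset.sum_congr rfl fun β _ => ?_
      rw [map_mul]; ring
    simp only [e]
    have hi : ∀ α β : ι →₀ ℕ, Integrable (fun p => F.coeff α * starRingEnd ℂ (F.coeff β) *
        ((∏ i, complexNoise p i ^ α i) * starRingEnd ℂ (∏ i, complexNoise p i ^ β i)))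
        ((gaussPi ι).prod (gaussPi ι)) := fun α β =>
      ((allLp_const _).mul ((allLp_monomial α).mul (allLp_monomial β).conj)).integrable
    rw [integral_finsetSum _ fun α _ => integrable_finsetSum _ fun β _ => hi α β]
    rw [fockNormSq]
    push_cast
    refine Finset.sum_congr rfl fun α hα => ?_
    rw [integral_finsetSum _ fun β _ => hi α β]
    simp only [integral_const_mul, integral_monomial_mul_conj, mul_ite, mul_zero]
    rw [Finset.sum_ite_eq, if_pos hα, Complex.mul_conj']
  exact_mod_cast h

/-- The multinomial Vandermonde identity at the level of weights. -/
theorem sum_antidiagonal_fockWeight [DecidableEq ι] (α : ι →₀ ℕ) :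
    ∑ p ∈ Finset.HasAntidiagonal.antidiagonal α, fockWeight α / (fockWeight p.1 * fockWeight p.2) =
      2 ^ α.degree := by
  have e : ∀ p ∈ Finset.HasAntidiagonal.antidiagonal α, fockWeight α / (fockWeight p.1 * fockWeight p.2) =
      ∏ i, ((α i).choose (p.1 i) : ℝ) := by
    intro p hp
    rw [Finset.HasAntidiagonal.mem_antidiagonal] at hp
    rw [fockWeight, fockWeight, fockWeight, ← Finset.prod_mul_distrib, ← Finset.prod_div_distrib]
    refine Finset.prod_congr rfl fun i _ => ?_
    have hi : α i = p.1 i + p.2 i := by rw [← hp]; rfl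
    rw [hi, Nat.cast_add_choose, pow_add]
    field_simp
  rw [Finset.sum_congr rfl e]
  have hbij : ∑ p ∈ Finset.HasAntidiagonal.antidiagonal α, ∏ i, ((α i).choose (p.1 i) : ℝ) =
      ∑ f ∈ Fintype.piFinset fun i => Finset.range (α i + 1), ∏ i, ((α i).choose (f i) : ℝ) := by
    refine Finset.sum_bij' (fun p _ => ⇑p.1)
      (fun f _ => (Finsupp.equivFunOnFinite.symm f, α - Finsupp.equivFunOnFinite.symm f))
      ?_ ?_ ?_ ?_ ?_
    · intro p hp
      rw [Finset.HasAntidiagonal.mem_antidiagonal] at hp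
      simp only [Fintype.mem_piFinset, Finset.mem_range]
      intro i
      rw [← hp, Finsupp.add_apply]; omega
    · intro f hf
      simp only [Fintype.mem_piFinset, Finset.mem_range] at hf
      rw [Finset.HasAntidiagonal.mem_antidiagonal]
      ext i
      have := hf i
      simp; omega
    · intro p hp
      rw [Finset.HasAntidiagonal.mem_antidiagonal] at hp
      ext i
      · simp
      · simp [← hp]
    · intro f _
      ext i; simp
    · intros; rfl
  rw [hbij, ← Finset.prod_univ_sum (fun i => Finset.range (α i + 1))
    (fun i k => ((α i).choose k : ℝ))]
  have : ∀ n : ℕ, ∑ k ∈ Finset.range (n + 1), (n.choose k : ℝ) = 2 ^ n := fun n => by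
    exact_mod_cast Nat.sum_range_choose n
  simp only [this]
  rw [Finset.prod_pow_eq_pow_sum, Finsupp.degree_eq_sum]

/-- Submultiplicativity of the Segal-Bargmann norm on polynomials of bounded degree. -/
theorem fockNormSq_mul_le (F G : MvPolynomial ι ℂ) {a b : ℕ} (hF : F.totalDegree ≤ a)
    (hG : G.totalDegree ≤ b) :
    fockNormSq (F * G) ≤ 2 ^ (a + b) * (fockNormSq F * fockNormSq G) := by
  classical
  set t : (ι →₀ ℕ) × (ι →₀ ℕ) → ℝ := fun p =>
    ‖F.coeff p.1‖ ^ 2 * fockWeight p.1 * (‖G.coeff p.2‖ ^ 2 * fockWeight p.2) with ht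
  have ht0 : ∀ p, 0 ≤ t p := fun p => by
    have h1 := (fockWeight_pos p.1).le
    have h2 := (fockWeight_pos p.2).le
    positivity
  have hcoef : ∀ α ∈ (F * G).support, ‖(F * G).coeff α‖ ^ 2 * fockWeight α ≤
      2 ^ (a + b) * ∑ p ∈ Finset.HasAntidiagonal.antidiagonal α, t p := by
    intro α hα
    have hdeg : α.degree ≤ a + b := by
      have h1 := MvPolynomial.le_totalDegree hα
      have h2 := MvPolynomial.totalDegree_mul F G
      rw [Finsupp.degree_eq_sum]
      rw [Finsupp.sum_fintype _ _ (fun _ => rfl)] at h1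
      omega
    have h1 : ‖(F * G).coeff α‖ ≤ ∑ p ∈ Finset.HasAntidiagonal.antidiagonal α, ‖F.coeff p.1‖ * ‖G.coeff p.2‖ := by
      rw [MvPolynomial.coeff_mul]
      exact (norm_sum_le _ _).trans_eq (by simp)
    have h2 := Finset.sum_mul_sq_le_sq_mul_sq (Finset.HasAntidiagonal.antidiagonal α)
      (fun p => √(fockWeight α / (fockWeight p.1 * fockWeight p.2)))
      (fun p => √(t p / fockWeight α))
    have hα0 := fockWeight_pos α
    have e1 : ∀ p, √(fockWeight α / (fockWeight p.1 * fockWeight p.2)) * √(t p / fockWeight α) =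
        ‖F.coeff p.1‖ * ‖G.coeff p.2‖ := by
      intro p
      have h1 := fockWeight_pos p.1
      have h2 := fockWeight_pos p.2
      rw [← Real.sqrt_mul (by positivity), ht]
      rw [show fockWeight α / (fockWeight p.1 * fockWeight p.2) *
        ((‖F.coeff p.1‖ ^ 2 * fockWeight p.1 * (‖G.coeff p.2‖ ^ 2 * fockWeight p.2)) /
          fockWeight α) = (‖F.coeff p.1‖ * ‖G.coeff p.2‖) ^ 2 by field_simp]
      exact Real.sqrt_sq (by positivity)
    have e2 : ∀ p : (ι →₀ ℕ) × (ι →₀ ℕ), √(fockWeight α / (fockWeight p.1 * fockWeight p.2)) ^ 2 =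
        fockWeight α / (fockWeight p.1 * fockWeight p.2) := by
      intro p
      have h1 := fockWeight_pos p.1
      have h2 := fockWeight_pos p.2
      exact Real.sq_sqrt (by positivity)
    have e3 : ∀ p, √(t p / fockWeight α) ^ 2 = t p / fockWeight α := fun p =>
      Real.sq_sqrt (div_nonneg (ht0 p) hα0.le)
    simp only [e1, e2, e3] at h2
    rw [sum_antidiagonal_fockWeight, ← Finset.sum_div] at h2
    calc ‖(F * G).coeff α‖ ^ 2 * fockWeight α
        ≤ (2 ^ α.degree * ((∑ p ∈ Finset.HasAntidiagonal.antidiagonal α, t p) / fockWeight α)) * fockWeight α := by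
          gcongr
          exact (pow_le_pow_left₀ (norm_nonneg _) h1 2).trans h2
      _ = 2 ^ α.degree * ∑ p ∈ Finset.HasAntidiagonal.antidiagonal α, t p := by field_simp
      _ ≤ _ := by
          have := Finset.sum_nonneg fun p (_ : p ∈ Finset.HasAntidiagonal.antidiagonal α) => ht0 p
          gcongr
          norm_num
  calc fockNormSq (F * G) ≤ ∑ α ∈ (F * G).support, 2 ^ (a + b) * ∑ p ∈ Finset.HasAntidiagonal.antidiagonal α, t p :=
        Finset.sum_le_sum hcoef
    _ = 2 ^ (a + b) * ∑ α ∈ (F * G).support, ∑ p ∈ Finset.HasAntidiagonal.antidiagonal α, t p := by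
        rw [Finset.mul_sum]
    _ ≤ 2 ^ (a + b) * ∑ p ∈ F.support ×ˢ G.support, t p := by
        gcongr
        rw [← Finset.sum_fiberwise_of_maps_to (s := F.support ×ˢ G.support)
          (t := (F.support ×ˢ G.support).image fun p => p.1 + p.2) (g := fun p => p.1 + p.2)
          (fun p hp => Finset.mem_image_of_mem _ hp)]
        have hsub : (F * G).support ⊆ (F.support ×ˢ G.support).image fun p => p.1 + p.2 := by
          intro α hα
          have h := MvPolynomial.support_mul F G hα
          obtain ⟨x, hx, y, hy, rfl⟩ := Finset.mem_add.1 h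
          exact Finset.mem_image.2 ⟨(x, y), Finset.mk_mem_product hx hy, rfl⟩
        refine (Finset.sum_le_sum fun α _ => ?_).trans
          (Finset.sum_le_sum_of_subset_of_nonneg hsub fun α _ _ =>
            Finset.sum_nonneg fun p _ => ht0 p)
        have hz : ∀ p ∈ Finset.HasAntidiagonal.antidiagonal α,
            p ∉ (F.support ×ˢ G.support).filter (fun p => p.1 + p.2 = α) → t p = 0 := by
          intro p hp hn
          rw [Finset.HasAntidiagonal.mem_antidiagonal] at hp
          simp only [Finset.mem_filter, Finset.mem_product, hp, and_true, not_and_or,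
            MvPolynomial.notMem_support_iff] at hn
          rcases hn with hn | hn <;> simp [ht, hn]
        refine (Finset.sum_subset ?_ hz).ge
        intro p hp
        rw [Finset.HasAntidiagonal.mem_antidiagonal]
        exact (Finset.mem_filter.1 hp).2
    _ = _ := by
        rw [fockNormSq, fockNormSq, Finset.sum_mul_sum, Finset.sum_product]

/-- Hypercontractivity on the Segal-Bargmann space, for exponents that are powers of two. -/
theorem fockNormSq_pow_le (F : MvPolynomial ι ℂ) {d : ℕ} (hF : F.totalDegree ≤ d) (r : ℕ) :
    fockNormSq (F ^ 2 ^ r) ≤ ((2 : ℝ) ^ r) ^ (d * 2 ^ r) * fockNormSq F ^ 2 ^ r := by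
  induction r with
  | zero => simp
  | succ r ih =>
    have hd : (F ^ 2 ^ r).totalDegree ≤ 2 ^ r * d :=
      (MvPolynomial.totalDegree_pow _ _).trans (Nat.mul_le_mul_left _ hF)
    have h := fockNormSq_mul_le _ _ hd hd
    rw [← sq, ← pow_mul, ← pow_succ] at h
    refine h.trans ?_
    have h0 := fockNormSq_nonneg (F ^ 2 ^ r)
    have h0F := fockNormSq_nonneg F
    calc _ ≤ 2 ^ (2 ^ r * d + 2 ^ r * d) * ((((2 : ℝ) ^ r) ^ (d * 2 ^ r) * fockNormSq F ^ 2 ^ r) *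
          (((2 : ℝ) ^ r) ^ (d * 2 ^ r) * fockNormSq F ^ 2 ^ r)) := by gcongr
      _ = _ := by
        rw [show (2 : ℝ) ^ (r + 1) = 2 * 2 ^ r by ring, mul_pow, show 2 ^ (r + 1) = 2 ^ r + 2 ^ r by ring]
        rw [mul_add, pow_add, pow_add, pow_add, mul_comm d]
        ring

/-- The moments of order `2 * 2 ^ r` of a polynomial of degree `d` in a complex Gaussian vector. -/
theorem integral_norm_pow_eval_le (F : MvPolynomial ι ℂ) {d : ℕ} (hF : F.totalDegree ≤ d) (r : ℕ) :
    ∫ p, ‖MvPolynomial.eval (complexNoise p) F‖ ^ (2 * 2 ^ r) ∂((gaussPi ι).prod (gaussPi ι)) ≤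
      ((2 : ℝ) ^ r) ^ (d * 2 ^ r) * fockNormSq F ^ 2 ^ r := by
  have h := fockNormSq_pow_le F hF r
  rw [← integral_norm_sq_eval] at h
  refine (le_of_eq ?_).trans h
  congr 1
  funext p
  rw [map_pow, norm_pow, ← pow_mul, mul_comm]

end Fock

/-! ### Wick ordered integrals of a Gaussian field -/

section Field

variable {ι : Type*} [Fintype ι]

/-- A linear combination of independent standard Gaussians is Gaussian. -/
theorem map_sum_mul_gaussPi (a : ι → ℝ) :
    (gaussPi ι).map (fun g => ∑ i, a i * g i) = gaussianReal 0 (∑ i, a i ^ 2).toNNReal := by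
  have hm : Measurable fun g : ι → ℝ => ∑ i, a i * g i := by fun_prop
  have := Measure.isProbabilityMeasure_map (μ := gaussPi ι) hm.aemeasurable
  refine Measure.ext_of_charFun (funext fun t => ?_)
  rw [charFun_apply_real, charFun_gaussianReal, integral_map hm.aemeasurable (by fun_prop)]
  have e : ∀ g : ι → ℝ, Complex.exp (t * ((∑ i, a i * g i : ℝ) : ℂ) * Complex.I) =
      ∏ i, Complex.exp (((t * a i : ℝ) : ℂ) * (g i : ℂ) * Complex.I) := by
    intro g
    rw [← Complex.exp_sum]
    congr 1
    push_cast
    rw [Finset.mul_sum, Finset.sum_mul]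
    exact Finset.sum_congr rfl fun i _ => by ring
  simp only [e]
  rw [integral_fintype_prod_eq_prod
    (f := fun i (x : ℝ) => Complex.exp (((t * a i : ℝ) : ℂ) * (x : ℂ) * Complex.I))]
  have e2 : ∀ i, ∫ x : ℝ, Complex.exp (((t * a i : ℝ) : ℂ) * (x : ℂ) * Complex.I) ∂stdNormal =
      Complex.exp (-((t * a i : ℝ) : ℂ) ^ 2 / 2) := by
    intro i
    rw [← charFun_apply_real, charFun_gaussianReal]
    congr 1
    simp
    ring
  simp only [e2]
  rw [← Complex.exp_sum]
  congr 1
  rw [Real.coe_toNNReal _ (Finset.sum_nonneg fun i _ => sq_nonneg _)]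
  push_cast
  rw [← Finset.sum_div, Finset.sum_neg_distrib, Finset.sum_mul]
  simp only [mul_zero, zero_sub, neg_div, mul_pow, mul_comm]

/-- The Wick power of a Gaussian sum is the average over the imaginary part of the power of the
complexified sum. -/
theorem wick_sum_eq_integral (a g : ι → ℝ) (n : ℕ) :
    (wick (∑ i, a i ^ 2) n (∑ i, a i * g i) : ℂ) =
      ∫ g', (∑ i, (a i : ℂ) * complexNoise (g, g') i) ^ n ∂gaussPi ι := by
  have h0 : 0 ≤ ∑ i, a i ^ 2 := Finset.sum_nonneg fun i _ => sq_nonneg _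
  rw [wick_eq_integral h0]
  have hm : Measurable fun g : ι → ℝ => ∑ i, a i * g i := by fun_prop
  have e1 : ∫ y : ℝ, (((∑ i, a i * g i : ℝ) : ℂ) + Complex.I * √(∑ i, a i ^ 2) * y) ^ n ∂stdNormal =
      ∫ y : ℝ, (((∑ i, a i * g i : ℝ) : ℂ) + Complex.I * y) ^ n
        ∂(gaussianReal 0 (∑ i, a i ^ 2).toNNReal) := by
    have h := gaussianReal_map_const_mul (μ := 0) (v := 1) (√(∑ i, a i ^ 2))
    have hv : NNReal.mk (√(∑ i, a i ^ 2) ^ 2) (sq_nonneg _) * 1 = (∑ i, a i ^ 2).toNNReal := by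
      ext
      simp [Real.sq_sqrt h0, Real.coe_toNNReal _ h0]
    rw [mul_zero, hv] at h
    rw [← h, integral_map (by fun_prop) (by fun_prop)]
    simp only [Complex.ofReal_mul, mul_assoc]
  rw [e1, ← map_sum_mul_gaussPi, integral_map hm.aemeasurable (by fun_prop)]
  congr 1
  funext g'
  congr 1
  simp only [complexNoise]
  push_cast
  rw [Finset.mul_sum, ← Finset.sum_add_distrib]
  exact Finset.sum_congr rfl fun i _ => by ring

theorem integral_monomial_right (g : ι → ℝ) (k : ι → ℕ) :
    ∫ g', ∏ i, complexNoise (g, g') i ^ k i ∂gaussPi ι = ∏ i, (wick 1 (k i) (g i) : ℂ) := by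
  have h := integral_fintype_prod_eq_prod (μ := fun _ : ι => stdNormal)
    (f := fun i (y : ℝ) => ((g i : ℂ) + Complex.I * y) ^ k i)
  refine h.trans (Finset.prod_congr rfl fun i _ => ?_)
  rw [wick_eq_integral zero_le_one]
  simp

theorem integrable_monomial_right (g : ι → ℝ) (k : ι → ℕ) :
    Integrable (fun g' => ∏ i, complexNoise (g, g') i ^ k i) (gaussPi ι) := by
  have h : ∀ i, AllLp (fun g' : ι → ℝ => (g' i : ℂ)) (gaussPi ι) := fun i =>
    (allLp_eval_gaussPi i).ofReal
  have h2 : ∀ i, AllLp (fun g' => complexNoise (g, g') i) (gaussPi ι) := fun i =>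
    (allLp_const (g i : ℂ)).add ((allLp_const Complex.I).mul (h i))
  exact (AllLp.prod _ fun i _ => (h2 i).pow (k i)).integrable

/-- The chaos expansion of the Wick power of a Gaussian sum. -/
theorem wick_sum_eq_sum (a g : ι → ℝ) (n : ℕ) [DecidableEq ι] :
    wick (∑ i, a i ^ 2) n (∑ i, a i * g i) =
      ∑ k ∈ Finset.piAntidiag Finset.univ n, (Nat.multinomial Finset.univ k : ℝ) *
        (∏ i, a i ^ k i) * ∏ i, wick 1 (k i) (g i) := by
  have h := wick_sum_eq_integral a g n
  simp only [Finset.sum_pow_eq_sum_piAntidiag, mul_pow, Finset.prod_mul_distrib, ← mul_assoc] at h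
  rw [integral_finsetSum _ fun k _ => (integrable_monomial_right g k).const_mul _] at h
  simp only [integral_const_mul, integral_monomial_right] at h
  exact_mod_cast h

theorem integrable_of_continuous {E : Type*} [NormedAddCommGroup E] {ν : Measure Torus}
    [IsFiniteMeasure ν] {f : Torus → E} (hf : Continuous f) : Integrable f ν :=
  hf.integrable_of_hasCompactSupport (HasCompactSupport.of_compactSpace f)

/-- The Wick ordered integral `∫ f :Φ ^ j: dν` of the Gaussian field `Φ = ∑ i, a i * g i`. -/
noncomputable def wickIntegral (ν : Measure Torus) (a : ι → Torus → ℝ) (f : Torus → ℝ) (j : ℕ)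
    (g : ι → ℝ) : ℝ :=
  ∫ x, f x * wick (∑ i, a i x ^ 2) j (∑ i, a i x * g i) ∂ν

/-- The coefficients of the polynomial of which `wickIntegral` is the Gaussian average. -/
noncomputable def chaosCoeff (ν : Measure Torus) (a : ι → Torus → ℝ) (f : Torus → ℝ)
    (k : ι → ℕ) : ℝ :=
  (Nat.multinomial Finset.univ k : ℝ) * ∫ x, f x * ∏ i, a i x ^ k i ∂ν

variable {ν : Measure Torus} [IsProbabilityMeasure ν] {a : ι → Torus → ℝ} {f : Torus → ℝ}

theorem wickIntegral_eq_sum [DecidableEq ι] (ha : ∀ i, Continuous (a i)) (hf : Continuous f)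
    (j : ℕ) (g : ι → ℝ) :
    wickIntegral ν a f j g = ∑ k ∈ Finset.piAntidiag Finset.univ j,
      chaosCoeff ν a f k * ∏ i, wick 1 (k i) (g i) := by
  rw [wickIntegral]
  simp only [wick_sum_eq_sum, Finset.mul_sum]
  rw [integral_finsetSum _ fun k _ => integrable_of_continuous (by fun_prop)]
  refine Finset.sum_congr rfl fun k _ => ?_
  rw [chaosCoeff, ← integral_const_mul, ← integral_mul_const]
  congr 1
  funext x
  ring

theorem allLp_wick_one (i : ι) (n : ℕ) : AllLp (fun g : ι → ℝ => wick 1 n (g i)) (gaussPi ι) := by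
  simp only [wick, Polynomial.eval_eq_sum_range]
  exact AllLp.sum _ fun k _ => (allLp_const _).mul ((allLp_eval_gaussPi i).pow k)

theorem continuous_wickIntegral (ha : ∀ i, Continuous (a i)) (hf : Continuous f) (j : ℕ) :
    Continuous (wickIntegral ν a f j) := by
  classical
  simp only [funext fun g => wickIntegral_eq_sum (ν := ν) ha hf j g]
  have := continuous_wick 1
  fun_prop

theorem allLp_wickIntegral (ha : ∀ i, Continuous (a i)) (hf : Continuous f) (j : ℕ) :
    AllLp (wickIntegral ν a f j) (gaussPi ι) := by
  classical
  simp only [funext fun g => wickIntegral_eq_sum (ν := ν) ha hf j g]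
  exact AllLp.sum _ fun k _ => (allLp_const _).mul (AllLp.prod _ fun i _ => allLp_wick_one i _)

/-- A homogeneous polynomial of degree `j` from its coefficients. -/
noncomputable def homPoly [DecidableEq ι] (j : ℕ) (c : (ι → ℕ) → ℝ) : MvPolynomial ι ℂ :=
  ∑ k ∈ Finset.piAntidiag Finset.univ j,
    MvPolynomial.monomial (Finsupp.equivFunOnFinite.symm k) (c k : ℂ)

theorem eval_homPoly [DecidableEq ι] (j : ℕ) (c : (ι → ℕ) → ℝ) (z : ι → ℂ) :
    MvPolynomial.eval z (homPoly j c) =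
      ∑ k ∈ Finset.piAntidiag Finset.univ j, (c k : ℂ) * ∏ i, z i ^ k i := by
  rw [homPoly, map_sum]
  refine Finset.sum_congr rfl fun k _ => ?_
  rw [MvPolynomial.eval_monomial, Finsupp.prod_fintype _ _ (by simp)]
  rfl

theorem totalDegree_homPoly_le [DecidableEq ι] (j : ℕ) (c : (ι → ℕ) → ℝ) :
    (homPoly j c).totalDegree ≤ j := by
  rw [homPoly]
  refine MvPolynomial.totalDegree_finsetSum_le fun k hk => ?_
  refine (MvPolynomial.totalDegree_monomial_le _ _).trans ?_
  rw [Finsupp.sum_fintype _ _ (by simp)]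
  rw [Finset.mem_piAntidiag] at hk
  exact hk.1.le

theorem coeff_homPoly [DecidableEq ι] (j : ℕ) (c : (ι → ℕ) → ℝ) (α : ι →₀ ℕ) :
    (homPoly j c).coeff α =
      if ⇑α ∈ Finset.piAntidiag Finset.univ j then (c α : ℂ) else 0 := by
  have : ∀ k : ι → ℕ, (MvPolynomial.monomial (Finsupp.equivFunOnFinite.symm k) (c k : ℂ)).coeff α =
      if k = ⇑α then (c k : ℂ) else 0 := by
    intro k
    rw [MvPolynomial.coeff_monomial]
    congr 1
    rw [Equiv.symm_apply_eq]
    rfl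
  rw [homPoly, MvPolynomial.coeff_sum]
  simp only [this]
  rw [Finset.sum_ite_eq']

theorem fockNormSq_homPoly [DecidableEq ι] (j : ℕ) (c : (ι → ℕ) → ℝ) :
    fockNormSq (homPoly j c) = ∑ k ∈ Finset.piAntidiag Finset.univ j,
      c k ^ 2 * ∏ i, ((k i).factorial : ℝ) * 2 ^ k i := by
  have hsub : (homPoly j c).support ⊆ (Finset.piAntidiag Finset.univ j).map
      Finsupp.equivFunOnFinite.symm.toEmbedding := by
    intro α hα
    rw [MvPolynomial.mem_support_iff, coeff_homPoly] at hα
    rw [Finset.mem_map_equiv]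
    by_contra hn
    exact hα (if_neg hn)
  rw [fockNormSq, Finset.sum_subset hsub fun α _ hn => by
    rw [MvPolynomial.notMem_support_iff.1 hn]; simp]
  rw [Finset.sum_map]
  refine Finset.sum_congr rfl fun k hk => ?_
  rw [Equiv.coe_toEmbedding, coeff_homPoly, Finsupp.coe_equivFunOnFinite_symm, if_pos hk,
    fockWeight, Complex.norm_real, Real.norm_eq_abs, sq_abs]
  rfl

/-- Averaging over the imaginary part turns powers into Wick powers. -/
theorem integral_eval_homPoly [DecidableEq ι] (j : ℕ) (c : (ι → ℕ) → ℝ) (g : ι → ℝ) :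
    ∫ g', MvPolynomial.eval (complexNoise (g, g')) (homPoly j c) ∂gaussPi ι =
      ((∑ k ∈ Finset.piAntidiag Finset.univ j, c k * ∏ i, wick 1 (k i) (g i) : ℝ) : ℂ) := by
  simp only [eval_homPoly]
  rw [integral_finsetSum _ fun k _ => (integrable_monomial_right g k).const_mul _]
  simp only [integral_const_mul, integral_monomial_right]
  push_cast
  rfl

/-- Second moment of a chaos, where `κ` selects a subset of the monomials. -/
theorem fockNormSq_chaos [DecidableEq ι] (ha : ∀ i, Continuous (a i)) (hf : Continuous f) (j : ℕ)
    (κ : (ι → ℕ) → ℝ) (hκ : ∀ k, κ k ^ 2 = κ k) :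
    fockNormSq (homPoly j fun k => κ k * chaosCoeff ν a f k) = (j.factorial : ℝ) * 2 ^ j *
      ∫ x, ∫ y, f x * f y * ∑ k ∈ Finset.piAntidiag Finset.univ j,
        κ k * ((Nat.multinomial Finset.univ k : ℝ) * ∏ i, (a i x * a i y) ^ k i) ∂ν ∂ν := by
  rw [fockNormSq_homPoly]
  have e : ∀ x y, f x * f y * ∑ k ∈ Finset.piAntidiag Finset.univ j,
        κ k * ((Nat.multinomial Finset.univ k : ℝ) * ∏ i, (a i x * a i y) ^ k i) =
      ∑ k ∈ Finset.piAntidiag Finset.univ j, κ k * (Nat.multinomial Finset.univ k : ℝ) *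
        ((f x * ∏ i, a i x ^ k i) * (f y * ∏ i, a i y ^ k i)) := by
    intro x y
    rw [Finset.mul_sum]
    refine Finset.sum_congr rfl fun k _ => ?_
    simp only [mul_pow, Finset.prod_mul_distrib]
    ring
  have e2 : ∀ x, ∫ y, ∑ k ∈ Finset.piAntidiag Finset.univ j,
      κ k * (Nat.multinomial Finset.univ k : ℝ) *
        ((f x * ∏ i, a i x ^ k i) * (f y * ∏ i, a i y ^ k i)) ∂ν =
      ∑ k ∈ Finset.piAntidiag Finset.univ j, κ k * (Nat.multinomial Finset.univ k : ℝ) *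
        ((f x * ∏ i, a i x ^ k i) * ∫ y, (f y * ∏ i, a i y ^ k i) ∂ν) := by
    intro x
    rw [integral_finsetSum _ fun k _ => integrable_of_continuous (by fun_prop)]
    simp only [integral_const_mul]
  simp only [e, e2]
  rw [integral_finsetSum _ fun k _ => integrable_of_continuous (by fun_prop), Finset.mul_sum]
  refine Finset.sum_congr rfl fun k hk => ?_
  rw [integral_const_mul, integral_mul_const, mul_pow, hκ, chaosCoeff]
  rw [Finset.mem_piAntidiag] at hk
  have hfac : (∏ i, ((k i).factorial : ℝ)) * (Nat.multinomial Finset.univ k : ℝ) =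
      (j.factorial : ℝ) := by
    rw [← hk.1]; exact_mod_cast Nat.multinomial_spec Finset.univ k
  have h2 : ∏ i, (2 : ℝ) ^ k i = 2 ^ j := by
    rw [Finset.prod_pow_eq_pow_sum, hk.1]
  rw [Finset.prod_mul_distrib, h2, ← hfac]
  ring

end Field

section Moments

variable {ι : Type*} [Fintype ι]

/-- Moments of a real random variable that is the average of a polynomial in the complex noise over
its imaginary part. -/
theorem integral_abs_pow_le_of_average (F : MvPolynomial ι ℂ) {d : ℕ} (hF : F.totalDegree ≤ d)
    {W : (ι → ℝ) → ℝ} (hW : ∀ g, (W g : ℂ) =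
      ∫ g', MvPolynomial.eval (complexNoise (g, g')) F ∂gaussPi ι) (r : ℕ) :
    ∫ g, |W g| ^ (2 * 2 ^ r) ∂gaussPi ι ≤ ((2 : ℝ) ^ r) ^ (d * 2 ^ r) * fockNormSq F ^ 2 ^ r := by
  refine le_trans ?_ (integral_norm_pow_eval_le F hF r)
  have hint := (allLp_eval F).integrable_norm_pow (2 * 2 ^ r)
  rw [integral_prod _ hint]
  refine integral_mono_of_nonneg (ae_of_all _ fun g => by positivity) hint.integral_prod_left ?_
  filter_upwards [hint.prod_right_ae, (allLp_eval F).integrable.prod_right_ae] with g hg hg1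
  have h1 : |W g| ≤ ∫ g', ‖MvPolynomial.eval (complexNoise (g, g')) F‖ ∂gaussPi ι := by
    rw [← Real.norm_eq_abs, ← Complex.norm_real, hW]
    exact norm_integral_le_integral_norm _
  refine (pow_le_pow_left₀ (abs_nonneg _) h1 _).trans ?_
  exact (convexOn_pow (2 * 2 ^ r)).map_integral_le (continuous_pow _).continuousOn isClosed_Ici
    (ae_of_all _ fun g' => norm_nonneg _) hg1.norm hg

/-- The squared norm of a sum of polynomials. -/
theorem fockNormSq_sum_le {κ : Type*} (s : Finset κ) (F : κ → MvPolynomial ι ℂ) :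
    fockNormSq (∑ j ∈ s, F j) ≤ s.card * ∑ j ∈ s, fockNormSq (F j) := by
  simp only [← integral_norm_sq_eval]
  rw [← integral_finsetSum _ fun j _ => (allLp_eval (F j)).integrable_norm_pow 2,
    ← integral_const_mul]
  refine integral_mono ((allLp_eval _).integrable_norm_pow 2)
    ((integrable_finsetSum _ fun j _ => (allLp_eval (F j)).integrable_norm_pow 2).const_mul _)
    fun p => ?_
  simp only [map_sum]
  refine (pow_le_pow_left₀ (norm_nonneg _) (norm_sum_le _ _) 2).trans ?_
  exact sq_sum_le_card_mul_sum_sq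

variable {ν : Measure Torus} [IsProbabilityMeasure ν] {a : ι → Torus → ℝ}

theorem abs_integral_integral_le {f : Torus → ℝ} {B : ℝ} (hB : ∀ x, |f x| ≤ B)
    {G : Torus → Torus → ℝ} (hG : Continuous (fun p : Torus × Torus => G p.1 p.2)) :
    |∫ x, ∫ y, f x * f y * G x y ∂ν ∂ν| ≤ B ^ 2 * ∫ x, ∫ y, |G x y| ∂ν ∂ν := by
  have hB0 : 0 ≤ B := (abs_nonneg _).trans (hB 0)
  have hGa : Continuous (fun p : Torus × Torus => |G p.1 p.2|) := hG.abs
  have hint : Integrable (fun p : Torus × Torus => |G p.1 p.2|) (ν.prod ν) :=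
    hGa.integrable_of_hasCompactSupport (HasCompactSupport.of_compactSpace _)
  have hGx : ∀ x, Continuous (fun y => G x y) := fun x =>
    hG.comp (Continuous.prodMk continuous_const continuous_id)
  rw [← integral_const_mul, ← Real.norm_eq_abs]
  refine norm_integral_le_of_norm_le (hint.integral_prod_left.const_mul _) (ae_of_all _ fun x => ?_)
  rw [← integral_const_mul]
  refine norm_integral_le_of_norm_le ((integrable_of_continuous (hGx x)).abs.const_mul _)
    (ae_of_all _ fun y => ?_)
  rw [Real.norm_eq_abs, abs_mul, abs_mul, sq]
  have h1 := hB x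
  have h2 := hB y
  gcongr

/-- Fluctuation bound for the difference between Wick ordered integrals of a field and of its
truncation, where `θ` is the indicator function of the retained coefficients. -/
theorem integral_wickIntegral_sub_pow_le (ha : ∀ i, Continuous (a i)) {f : ℕ → Torus → ℝ}
    (hf : ∀ j, Continuous (f j)) {B : ℝ} (hB : ∀ j x, |f j x| ≤ B) (θ : ι → ℝ)
    (hθ : ∀ i, θ i ^ 2 = θ i) (d r : ℕ) :
    ∫ g, |∑ j ∈ Finset.range (d + 1), (wickIntegral ν a (f j) j g -
        wickIntegral ν (fun i x => θ i * a i x) (f j) j g)| ^ (2 * 2 ^ r) ∂gaussPi ι ≤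
      ((2 : ℝ) ^ r) ^ (d * 2 ^ r) * ((d + 1) * ∑ j ∈ Finset.range (d + 1),
        (j.factorial : ℝ) * 2 ^ j * (B ^ 2 * ∫ x, ∫ y, |(∑ i, a i x * a i y) ^ j -
          (∑ i, θ i * (a i x * a i y)) ^ j| ∂ν ∂ν)) ^ 2 ^ r := by
  classical
  set κ : (ι → ℕ) → ℝ := fun k => 1 - ∏ i, θ i ^ k i with hκdef
  have hκ : ∀ k, κ k ^ 2 = κ k := by
    intro k
    have : (∏ i, θ i ^ k i) ^ 2 = ∏ i, θ i ^ k i := by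
      rw [← Finset.prod_pow]
      refine Finset.prod_congr rfl fun i _ => ?_
      rw [← pow_mul, mul_comm, pow_mul, hθ]
    rw [hκdef]
    simp only
    linear_combination this
  set F : ℕ → MvPolynomial ι ℂ := fun j => homPoly j fun k => κ k * chaosCoeff ν a (f j) k with hF
  have hcoef : ∀ j k, chaosCoeff ν (fun i x => θ i * a i x) (f j) k =
      (∏ i, θ i ^ k i) * chaosCoeff ν a (f j) k := by
    intro j k
    rw [chaosCoeff, chaosCoeff, mul_left_comm (∏ i, θ i ^ k i),
      ← integral_const_mul (∏ i, θ i ^ k i)]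
    congr 2
    funext x
    simp only [mul_pow, Finset.prod_mul_distrib]
    ring
  have hθa : ∀ i, Continuous (fun x => θ i * a i x) := fun i => continuous_const.mul (ha i)
  have hW : ∀ g, ((∑ j ∈ Finset.range (d + 1), (wickIntegral ν a (f j) j g -
        wickIntegral ν (fun i x => θ i * a i x) (f j) j g) : ℝ) : ℂ) =
      ∫ g', MvPolynomial.eval (complexNoise (g, g')) (∑ j ∈ Finset.range (d + 1), F j)
        ∂gaussPi ι := by
    intro g
    simp only [map_sum]
    rw [integral_finsetSum _ fun j _ => by
      simp only [hF, eval_homPoly]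
      exact integrable_finsetSum _ fun k _ => (integrable_monomial_right g k).const_mul _]
    push_cast
    refine Finset.sum_congr rfl fun j _ => ?_
    rw [hF]
    simp only
    rw [integral_eval_homPoly, ← Complex.ofReal_sub, wickIntegral_eq_sum ha (hf j),
      wickIntegral_eq_sum hθa (hf j), ← Finset.sum_sub_distrib]
    congr 1
    refine Finset.sum_congr rfl fun k _ => ?_
    rw [hcoef, hκdef]
    ring
  have hdeg : (∑ j ∈ Finset.range (d + 1), F j).totalDegree ≤ d :=
    MvPolynomial.totalDegree_finsetSum_le fun j hj =>
      (totalDegree_homPoly_le _ _).trans (by have := Finset.mem_range.1 hj; omega)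
  refine (integral_abs_pow_le_of_average _ hdeg hW r).trans ?_
  have hnorm : fockNormSq (∑ j ∈ Finset.range (d + 1), F j) ≤
      (d + 1) * ∑ j ∈ Finset.range (d + 1),
        (j.factorial : ℝ) * 2 ^ j * (B ^ 2 * ∫ x, ∫ y, |(∑ i, a i x * a i y) ^ j -
          (∑ i, θ i * (a i x * a i y)) ^ j| ∂ν ∂ν) := by
    refine (fockNormSq_sum_le _ _).trans ?_
    rw [Finset.card_range]
    push_cast
    gcongr with j hj
    rw [hF]
    simp only
    rw [fockNormSq_chaos ha (hf j) j κ hκ]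
    have e : ∀ x y, ∑ k ∈ Finset.piAntidiag Finset.univ j,
        κ k * ((Nat.multinomial Finset.univ k : ℝ) * ∏ i, (a i x * a i y) ^ k i) =
        (∑ i, a i x * a i y) ^ j - (∑ i, θ i * (a i x * a i y)) ^ j := by
      intro x y
      rw [Finset.sum_pow_eq_sum_piAntidiag, Finset.sum_pow_eq_sum_piAntidiag,
        ← Finset.sum_sub_distrib]
      refine Finset.sum_congr rfl fun k _ => ?_
      rw [hκdef]
      simp only [mul_pow, Finset.prod_mul_distrib]
      ring
    simp only [e]
    gcongr
    exact (le_abs_self _).trans (abs_integral_integral_le (hB j) (by fun_prop))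
  have h0 := fockNormSq_nonneg (∑ j ∈ Finset.range (d + 1), F j)
  gcongr

/-- Second moment of a Wick ordered integral. -/
theorem integral_wickIntegral_sq_le (ha : ∀ i, Continuous (a i)) {f : Torus → ℝ}
    (hf : Continuous f) {B : ℝ} (hB : ∀ x, |f x| ≤ B) (j : ℕ) :
    ∫ g, wickIntegral ν a f j g ^ 2 ∂gaussPi ι ≤
      (j.factorial : ℝ) * 2 ^ j * (B ^ 2 * ∫ x, ∫ y, |(∑ i, a i x * a i y) ^ j| ∂ν ∂ν) := by
  classical
  have hW : ∀ g, (wickIntegral ν a f j g : ℂ) =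
      ∫ g', MvPolynomial.eval (complexNoise (g, g'))
        (homPoly j fun k => 1 * chaosCoeff ν a f k) ∂gaussPi ι := by
    intro g
    rw [integral_eval_homPoly, wickIntegral_eq_sum ha hf]
    simp
  have h := integral_abs_pow_le_of_average _ (totalDegree_homPoly_le _ _) hW 0
  simp only [pow_zero, mul_one, sq_abs, one_pow, pow_one, one_mul] at h
  refine h.trans ?_
  have h2 := fockNormSq_chaos (ν := ν) ha hf j (fun _ => 1) (by simp)
  simp only [one_mul, ← Finset.sum_pow_eq_sum_piAntidiag] at h2
  rw [h2]
  gcongr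
  exact (le_abs_self _).trans (abs_integral_integral_le hB (by fun_prop))

end Moments

/-! ### Moments of the covariance -/

/-- Frequencies `n`, standing for the wave vectors `2 * π * n`. -/
abbrev Freq := Fin 2 → ℤ

/-- The Japanese bracket of a frequency. -/
noncomputable def bracket (n : Freq) : ℝ := 1 + ‖n‖

theorem one_le_bracket (n : Freq) : 1 ≤ bracket n := by
  have := norm_nonneg n
  rw [bracket]; linarith

theorem bracket_pos (n : Freq) : 0 < bracket n := zero_lt_one.trans_le (one_le_bracket n)

theorem summable_bracket_rpow {k : ℝ} (hk : 2 < k) : Summable fun n : Freq => bracket n ^ (-k) := by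
  have h := EisensteinSeries.summable_one_div_norm_rpow hk
  have h1 : Summable fun n : Freq => ‖n‖ ^ (-k) + if n = 0 then 1 else 0 :=
    h.add (summable_of_hasFiniteSupport (Set.Finite.subset (Set.finite_singleton 0) (by
      intro n hn
      by_contra h0
      simp only [Set.mem_singleton_iff] at h0
      simp [h0] at hn)))
  refine Summable.of_nonneg_of_le (fun n => Real.rpow_nonneg (bracket_pos n).le _) (fun n => ?_) h1
  by_cases hn : n = 0
  · subst hn
    simp only [if_true, bracket, norm_zero, add_zero, Real.one_rpow]
    have := Real.rpow_nonneg (le_refl (0 : ℝ)) (-k)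
    linarith
  · rw [if_neg hn, add_zero]
    exact Real.rpow_le_rpow_of_nonpos (norm_pos_iff.2 hn) (by rw [bracket]; linarith) (by linarith)

theorem mem_freqBox {K : ℕ} {n : Freq} : n ∈ freqBox K ↔ ‖n‖ ≤ K := by
  rw [freqBox, Fintype.mem_piFinset, pi_norm_le_iff_of_nonneg (Nat.cast_nonneg K)]
  refine forall_congr' fun i => ?_
  rw [Finset.mem_Icc, Int.norm_eq_abs, ← abs_le]
  exact_mod_cast Iff.rfl

open UnitAddTorus in
/-- The probability measure `ν` on the torus behaves like the Haar measure for frequencies that are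
not multiples of `L`: it is either the Haar measure or the uniform measure on the lattice with mesh
`1 / L`. The set `A` carries `ν`. -/
structure Sampling (ν : Measure Torus) (A : Set Torus) (L : ℕ) : Prop where
  ae_mem : ∀ᵐ x ∂ν, x ∈ A
  integral_mFourier : ∀ k : Freq, (∃ i, ¬ (L : ℤ) ∣ k i) → ∫ x, mFourier k x ∂ν = 0

/-- At points of `A`, the covariance `∑ b n * cas (n x) * cas (n y)` equals
`∑ b n * exp (2 π i n (x - y))`. -/
def SymmCov (A : Set Torus) (T : Finset Freq) (b : Freq → ℝ) : Prop :=
  ∀ x ∈ A, ∀ y ∈ A, ((∑ n ∈ T, b n * (hartley n x * hartley n y) : ℝ) : ℂ) =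
    ∑ n ∈ T, (b n : ℂ) * (UnitAddTorus.mFourier n x * UnitAddTorus.mFourier (-n) y)

/-- An interval of length `2 * L` contains at most three elements of a residue class modulo `L`. -/
theorem card_filter_dvd_le {L : ℕ} (hL : 0 < L) (k : ℤ) :
    ((Finset.Icc (-(L : ℤ)) L).filter fun j => (L : ℤ) ∣ j + k).card ≤ 3 := by
  have hL' : (0 : ℤ) < L := by exact_mod_cast hL
  set a := (k - L) / L with ha
  have hsub : (Finset.Icc (-(L : ℤ)) L).filter (fun j => (L : ℤ) ∣ j + k) ⊆
      (Finset.Icc a (a + 2)).image fun t => L * t - k := by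
    intro j hj
    rw [Finset.mem_filter, Finset.mem_Icc] at hj
    obtain ⟨⟨h1, h2⟩, t, ht⟩ := hj
    refine Finset.mem_image.2 ⟨t, Finset.mem_Icc.2 ⟨?_, ?_⟩, by omega⟩
    · rw [ha]
      have : (k - L) / L < t + 1 := by
        rw [Int.ediv_lt_iff_lt_mul hL']
        nlinarith
      omega
    · have h3 : t - 2 ≤ (k - L) / L := by
        rw [Int.le_ediv_iff_mul_le hL']
        nlinarith
      omega
  refine (Finset.card_le_card hsub).trans (Finset.card_image_le.trans ?_)
  rw [Int.card_Icc]
  omega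

/-- At most nine frequencies of the box of size `L` lie in a given residue class modulo `L`. -/
theorem sum_le_nine {L : ℕ} (hL : 0 < L) {T : Finset Freq} (hT : T ⊆ freqBox L) {κ : Freq → ℝ}
    (hκ1 : ∀ k, κ k ≤ 1) (hκ : ∀ k, (∃ i, ¬ (L : ℤ) ∣ k i) → κ k = 0) (k : Freq) :
    ∑ n ∈ T, κ (n + k) ≤ 9 := by
  classical
  set U : Finset Freq := Fintype.piFinset fun i =>
    (Finset.Icc (-(L : ℤ)) L).filter fun j => (L : ℤ) ∣ j + k i with hU
  have hcard : U.card ≤ 9 := by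
    rw [hU, Fintype.card_piFinset, Fin.prod_univ_two]
    have h0 := card_filter_dvd_le hL (k 0)
    have h1 := card_filter_dvd_le hL (k 1)
    nlinarith
  have h1 : ∀ n ∈ T, κ (n + k) ≤ if n ∈ U then 1 else 0 := by
    intro n hn
    split_ifs with h
    · exact hκ1 _
    · refine (hκ _ ?_).le
      by_contra hcon
      push Not at hcon
      refine h (Fintype.mem_piFinset.2 fun i => Finset.mem_filter.2 ⟨?_, hcon i⟩)
      exact Fintype.mem_piFinset.1 (hT hn) i
  refine (Finset.sum_le_sum h1).trans ?_
  rw [Finset.sum_ite_mem, Finset.sum_const, nsmul_eq_mul, mul_one]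
  exact_mod_cast (Finset.card_le_card Finset.inter_subset_right).trans hcard

/-- A multilinear estimate in the spirit of the Hausdorff-Young inequality. It follows from the
inequality of arithmetic and geometric means applied to the `R + 1` products that omit one
factor: once one variable is omitted, the others are unconstrained. -/
theorem sum_tuples_le {T : Finset Freq} {b : Freq → ℝ} (hb : ∀ n, 0 ≤ b n)
    {κ : Freq → ℝ} (hκ0 : ∀ k, 0 ≤ κ k) {D : ℝ} (hκ : ∀ k, ∑ n ∈ T, κ (n + k) ≤ D)
    (R : ℕ) (hR : 0 < R) :
    ∑ p : Fin (R + 1) → T, (∏ l, b (p l)) * κ (∑ l, (p l : Freq)) ≤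
      D * (∑ n ∈ T, b n ^ (((R : ℝ) + 1) / R)) ^ R := by
  have hR' : (0 : ℝ) < R := by exact_mod_cast hR
  set u : Freq → ℝ := fun n => b n ^ (((R : ℝ) + 1) / R) with hu
  have hu0 : ∀ n, 0 ≤ u n := fun n => Real.rpow_nonneg (hb n) _
  have hamgm : ∀ p : Fin (R + 1) → T, ∏ l, b (p l) ≤
      ∑ l : Fin (R + 1), (1 / ((R : ℝ) + 1)) * ∏ m, u (p (l.succAbove m)) := by
    intro p
    have hprod : ∀ l : Fin (R + 1), (0 : ℝ) ≤ ∏ m, u (p (l.succAbove m)) := fun l =>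
      Finset.prod_nonneg fun m _ => hu0 _
    refine le_trans (le_of_eq ?_) (Real.geom_mean_le_arith_mean_weighted Finset.univ
      (fun _ => 1 / ((R : ℝ) + 1)) (fun l : Fin (R + 1) => ∏ m, u (p (l.succAbove m)))
      (fun _ _ => by positivity) ?_ (fun l _ => hprod l))
    · rw [Real.finsetProd_rpow _ _ fun l _ => hprod l]
      have h1 : (∏ l : Fin (R + 1), ∏ m, u (p (l.succAbove m))) = (∏ l, u (p l)) ^ R := by
        have h2 : ∀ l : Fin (R + 1), ∏ m, u (p (l.succAbove m)) =
            ∏ m, if m = l then 1 else u (p m) := by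
          intro l
          rw [Fin.prod_univ_succAbove _ l]
          simp
        simp only [h2]
        rw [Finset.prod_comm, ← Finset.prod_pow]
        refine Finset.prod_congr rfl fun m _ => ?_
        rw [Fin.prod_univ_succAbove _ m]
        simp [(Fin.succAbove_ne _ _).symm]
      rw [h1, ← Real.rpow_natCast, ← Real.rpow_mul (Finset.prod_nonneg fun l _ => hu0 _),
        ← Real.finsetProd_rpow _ _ fun l _ => hu0 _]
      refine Finset.prod_congr rfl fun l _ => ?_
      rw [hu]
      simp only
      rw [← Real.rpow_mul (hb _)]
      have : ((R : ℝ) + 1) / R * (R * (1 / (R + 1))) = 1 := by field_simp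
      rw [this, Real.rpow_one]
    · simp [mul_inv_cancel₀ (by positivity : (R : ℝ) + 1 ≠ 0)]
  have hl : ∀ l : Fin (R + 1), ∑ p : Fin (R + 1) → T,
      (∏ m, u (p (l.succAbove m))) * κ (∑ l, (p l : Freq)) ≤ D * (∑ n ∈ T, u n) ^ R := by
    intro l
    rw [← (Fin.insertNthEquiv (fun _ => T) l).sum_comp, Fintype.sum_prod_type_right]
    have e : ∀ (q : Fin R → T) (n : T), (∏ m, u (Fin.insertNthEquiv (fun _ => T) l (n, q)
        (l.succAbove m))) * κ (∑ i, (Fin.insertNthEquiv (fun _ => T) l (n, q) i : Freq)) =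
        (∏ m, u (q m)) * κ (n + ∑ i, (q i : Freq)) := by
      intro q n
      rw [Fin.sum_univ_succAbove _ l]
      simp [Fin.insertNthEquiv]
    simp only [e, ← Finset.mul_sum]
    calc ∑ q : Fin R → T, (∏ m, u (q m)) * ∑ n : T, κ (n + ∑ i, (q i : Freq))
        ≤ ∑ q : Fin R → T, (∏ m, u (q m)) * D := by
          refine Finset.sum_le_sum fun q _ => ?_
          refine mul_le_mul_of_nonneg_left ?_ (Finset.prod_nonneg fun m _ => hu0 _)
          rw [Finset.sum_coe_sort T fun n => κ (n + ∑ i, (q i : Freq))]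
          exact hκ _
      _ = _ := by
          rw [← Finset.sum_mul, mul_comm, ← Finset.sum_coe_sort T u, Fintype.sum_pow]
  calc ∑ p : Fin (R + 1) → T, (∏ l, b (p l)) * κ (∑ l, (p l : Freq))
      ≤ ∑ p : Fin (R + 1) → T, (∑ l : Fin (R + 1), (1 / ((R : ℝ) + 1)) * ∏ m, u (p (l.succAbove m))) *
          κ (∑ l, (p l : Freq)) := by
        refine Finset.sum_le_sum fun p _ => ?_
        exact mul_le_mul_of_nonneg_right (hamgm p) (hκ0 _)
    _ = ∑ l : Fin (R + 1), (1 / ((R : ℝ) + 1)) * ∑ p : Fin (R + 1) → T, (∏ m, u (p (l.succAbove m))) *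
          κ (∑ l, (p l : Freq)) := by
        simp only [Finset.sum_mul, Finset.mul_sum, mul_assoc]
        rw [Finset.sum_comm]
    _ ≤ ∑ l : Fin (R + 1), (1 / ((R : ℝ) + 1)) * (D * (∑ n ∈ T, u n) ^ R) := by
        gcongr with l
        exact hl l
    _ = _ := by
        rw [Finset.sum_const, Finset.card_univ, Fintype.card_fin, nsmul_eq_mul]
        push_cast
        field_simp

open UnitAddTorus in
/-- Moments of a covariance with nonnegative Fourier coefficients. -/
theorem integral_cov_pow_le {ν : Measure Torus} [IsProbabilityMeasure ν] {A : Set Torus} {L : ℕ}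
    (hL : 0 < L) (hν : Sampling ν A L) {T : Finset Freq} (hT : T ⊆ freqBox L) {b : Freq → ℝ}
    (hb : ∀ n, 0 ≤ b n) (hsym : SymmCov A T b) (R : ℕ) (hR : 0 < R) :
    ∫ x, ∫ y, (∑ n ∈ T, b n * (hartley n x * hartley n y)) ^ (R + 1) ∂ν ∂ν ≤
      9 * (∑ n ∈ T, b n ^ (((R : ℝ) + 1) / R)) ^ R := by
  set κ : Freq → ℝ := fun k => ‖∫ x, mFourier k x ∂ν‖ ^ 2 with hκ
  have hκ0 : ∀ k, 0 ≤ κ k := fun k => sq_nonneg _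
  have hκ1 : ∀ k, κ k ≤ 1 := by
    intro k
    have : ‖∫ x, mFourier k x ∂ν‖ ≤ 1 := by
      refine (norm_integral_le_of_norm_le_const (C := 1) (ae_of_all _ fun x => ?_)).trans (by simp)
      exact ((mFourier k).norm_coe_le_norm x).trans_eq mFourier_norm
    exact pow_le_one₀ (norm_nonneg _) this
  have hκz : ∀ k, (∃ i, ¬ (L : ℤ) ∣ k i) → κ k = 0 := by
    intro k hk
    simp [hκ, hν.integral_mFourier k hk]
  have hexp : ∀ (r : ℕ) (p : Fin r → T) (x : Torus),
      ∏ l, mFourier (p l : Freq) x = mFourier (∑ l, (p l : Freq)) x := by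
    intro r p x
    induction r with
    | zero => simp [mFourier_zero]
    | succ r ih => rw [Fin.prod_univ_succ, Fin.sum_univ_succ, mFourier_add, ih fun l => p l.succ]
  have hexpn : ∀ (r : ℕ) (p : Fin r → T) (x : Torus),
      ∏ l, mFourier (-(p l : Freq)) x = mFourier (-(∑ l, (p l : Freq))) x := by
    intro r p x
    simp only [mFourier_neg, ← map_prod, hexp]
  have hkap : ∀ k, (∫ x, mFourier k x ∂ν) * ∫ y, mFourier (-k) y ∂ν = (κ k : ℂ) := by
    intro k
    simp only [mFourier_neg]
    rw [integral_conj, Complex.mul_conj', hκ]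
    push_cast; rfl
  have key : ((∫ x, ∫ y, (∑ n ∈ T, b n * (hartley n x * hartley n y)) ^ (R + 1) ∂ν ∂ν : ℝ) : ℂ) =
      ((∑ p : Fin (R + 1) → T, (∏ l, b (p l)) * κ (∑ l, (p l : Freq)) : ℝ) : ℂ) := by
    rw [← integral_complex_ofReal]
    have e : ∀ᵐ x ∂ν, ((∫ y, (∑ n ∈ T, b n * (hartley n x * hartley n y)) ^ (R + 1) ∂ν : ℝ) : ℂ) =
        ∑ p : Fin (R + 1) → T, (∏ l, (b (p l) : ℂ)) * (mFourier (∑ l, (p l : Freq)) x *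
          ∫ y, mFourier (-(∑ l, (p l : Freq))) y ∂ν) := by
      filter_upwards [hν.ae_mem] with x hx
      rw [← integral_complex_ofReal]
      have e1 : ∀ᵐ y ∂ν, (((∑ n ∈ T, b n * (hartley n x * hartley n y)) ^ (R + 1) : ℝ) : ℂ) =
          ∑ p : Fin (R + 1) → T, (∏ l, (b (p l) : ℂ)) * (mFourier (∑ l, (p l : Freq)) x *
            mFourier (-(∑ l, (p l : Freq))) y) := by
        filter_upwards [hν.ae_mem] with y hy
        rw [Complex.ofReal_pow, hsym x hx y hy, ← Finset.sum_coe_sort T, Fintype.sum_pow]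
        refine Finset.sum_congr rfl fun p _ => ?_
        rw [Finset.prod_mul_distrib, Finset.prod_mul_distrib, hexp, hexpn]
      rw [integral_congr_ae e1, integral_finsetSum _ fun p _ =>
        integrable_of_continuous (by fun_prop)]
      simp only [integral_const_mul]
    rw [integral_congr_ae e, integral_finsetSum _ fun p _ =>
      integrable_of_continuous (by fun_prop)]
    push_cast
    refine Finset.sum_congr rfl fun p _ => ?_
    rw [integral_const_mul, integral_mul_const, hkap]
  rw [Complex.ofReal_inj] at key
  rw [key]
  exact sum_tuples_le hb hκ0 (sum_le_nine hL hT hκ1 hκz) R hR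

/-- The covariance `∑ b n * cas (n x) * cas (n y)`. -/
noncomputable def covKernel (b : Freq → ℝ) (T : Finset Freq) (x y : Torus) : ℝ :=
  ∑ n ∈ T, b n * (hartley n x * hartley n y)

@[fun_prop] theorem continuous_hartley (n : Freq) : Continuous (hartley n) := by
  unfold hartley
  fun_prop

theorem continuous_covKernel (b : Freq → ℝ) (T : Finset Freq) :
    Continuous fun p : Torus × Torus => covKernel b T p.1 p.2 := by
  unfold covKernel
  fun_prop

theorem integrable_prod_of_continuous {ν : Measure Torus} [IsProbabilityMeasure ν]
    {G : Torus → Torus → ℝ} (hG : Continuous fun p : Torus × Torus => G p.1 p.2) :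
    Integrable (fun p : Torus × Torus => G p.1 p.2) (ν.prod ν) :=
  hG.integrable_of_hasCompactSupport (HasCompactSupport.of_compactSpace _)

theorem integral_integral_eq {ν : Measure Torus} [IsProbabilityMeasure ν]
    {G : Torus → Torus → ℝ} (hG : Continuous fun p : Torus × Torus => G p.1 p.2) :
    ∫ x, ∫ y, G x y ∂ν ∂ν = ∫ p, G p.1 p.2 ∂(ν.prod ν) :=
  (integral_prod _ (integrable_prod_of_continuous hG)).symm

theorem SymmCov.sub {A : Set Torus} {S T : Finset Freq} {b : Freq → ℝ} (hTS : T ⊆ S)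
    [DecidableEq Freq] (hS : SymmCov A S b) (hT : SymmCov A T b) : SymmCov A (S \ T) b := by
  intro x hx y hy
  have h1 := hS x hx y hy
  have h2 := hT x hx y hy
  rw [← Finset.sum_sdiff hTS, ← Finset.sum_sdiff hTS, Complex.ofReal_add, h2] at h1
  exact add_right_cancel h1

/-- Uniform bounds on the even moments of the covariance. -/
theorem exists_integral_covKernel_pow_le (B : ℝ) (hB : 0 ≤ B) (q : ℕ) :
    ∃ C, 0 ≤ C ∧ ∀ (ν : Measure Torus) [IsProbabilityMeasure ν] (A : Set Torus) (L : ℕ)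
      (T : Finset Freq) (b : Freq → ℝ), 0 < L → Sampling ν A L → T ⊆ freqBox L →
      (∀ n, 0 ≤ b n) → (∀ n, b n ≤ B * bracket n ^ (-2 : ℝ)) → SymmCov A T b →
      ∫ x, ∫ y, covKernel b T x y ^ (2 * q) ∂ν ∂ν ≤ C := by
  rcases Nat.eq_zero_or_pos q with rfl | hq
  · exact ⟨1, zero_le_one, fun ν _ A L T b _ _ _ _ _ _ => by simp⟩
  obtain ⟨R, hR⟩ : ∃ R, 2 * q = R + 1 := ⟨2 * q - 1, by omega⟩
  have hR0 : 0 < R := by omega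
  have hR' : (0 : ℝ) < R := by exact_mod_cast hR0
  set s : ℝ := ((R : ℝ) + 1) / R with hs
  have hs1 : 1 < s := by rw [hs, lt_div_iff₀ hR']; linarith
  have hsum := summable_bracket_rpow (k := 2 * s) (by linarith)
  refine ⟨9 * (B ^ s * ∑' n : Freq, bracket n ^ (-(2 * s))) ^ R, ?_, ?_⟩
  · have : 0 ≤ ∑' n : Freq, bracket n ^ (-(2 * s)) :=
      tsum_nonneg fun n => Real.rpow_nonneg (bracket_pos n).le _
    have := Real.rpow_nonneg hB s
    positivity
  · intro ν _ A L T b hL hν hT hb0 hb hsym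
    rw [hR]
    refine (integral_cov_pow_le hL hν hT hb0 hsym R hR0).trans ?_
    have h0 : 0 ≤ ∑ n ∈ T, b n ^ s := Finset.sum_nonneg fun n _ => Real.rpow_nonneg (hb0 n) _
    gcongr
    calc ∑ n ∈ T, b n ^ s ≤ ∑ n ∈ T, B ^ s * bracket n ^ (-(2 * s)) := by
          refine Finset.sum_le_sum fun n _ => ?_
          have h1 : b n ^ s ≤ (B * bracket n ^ (-2 : ℝ)) ^ s :=
            Real.rpow_le_rpow (hb0 n) (hb n) (by linarith)
          rw [Real.mul_rpow hB (Real.rpow_nonneg (bracket_pos n).le _),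
            ← Real.rpow_mul (bracket_pos n).le] at h1
          rwa [show (-2 : ℝ) * s = -(2 * s) by ring] at h1
      _ = B ^ s * ∑ n ∈ T, bracket n ^ (-(2 * s)) := by rw [Finset.mul_sum]
      _ ≤ _ := by
          have := Real.rpow_nonneg hB s
          gcongr
          exact hsum.sum_le_tsum _ fun n _ => Real.rpow_nonneg (bracket_pos n).le _

theorem exists_integral_abs_covKernel_pow_le (B : ℝ) (hB : 0 ≤ B) (j : ℕ) :
    ∃ C, 0 ≤ C ∧ ∀ (ν : Measure Torus) [IsProbabilityMeasure ν] (A : Set Torus) (L : ℕ)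
      (T : Finset Freq) (b : Freq → ℝ), 0 < L → Sampling ν A L → T ⊆ freqBox L →
      (∀ n, 0 ≤ b n) → (∀ n, b n ≤ B * bracket n ^ (-2 : ℝ)) → SymmCov A T b →
      ∫ x, ∫ y, |covKernel b T x y ^ j| ∂ν ∂ν ≤ C := by
  obtain ⟨C, hC0, hC⟩ := exists_integral_covKernel_pow_le B hB j
  refine ⟨1 + C, by positivity, fun ν _ A L T b hL hν hT hb0 hb hsym => ?_⟩
  have h := hC ν A L T b hL hν hT hb0 hb hsym
  have hc := continuous_covKernel b T
  rw [integral_integral_eq (by fun_prop)] at h ⊢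
  calc ∫ p, |covKernel b T p.1 p.2 ^ j| ∂(ν.prod ν)
      ≤ ∫ p, (1 + covKernel b T p.1 p.2 ^ (2 * j)) ∂(ν.prod ν) := by
        refine integral_mono (integrable_prod_of_continuous (G := fun x y => |covKernel b T x y ^ j|)
          (by fun_prop)) (integrable_prod_of_continuous (G := fun x y => 1 + covKernel b T x y ^ (2 * j))
            (by fun_prop)) fun p => ?_
        simp only
        rw [mul_comm 2 j, pow_mul]
        generalize covKernel b T p.1 p.2 ^ j = u
        rcases abs_cases u with ⟨h, _⟩ | ⟨h, _⟩ <;> rw [h] <;> nlinarith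
    _ = 1 + ∫ p, covKernel b T p.1 p.2 ^ (2 * j) ∂(ν.prod ν) := by
        rw [integral_add (integrable_const _) (integrable_prod_of_continuous
          (G := fun x y => covKernel b T x y ^ (2 * j)) (by fun_prop))]
        simp
    _ ≤ 1 + C := by linarith

/-- The tail of the covariance is small in mean square. -/
theorem exists_integral_covKernel_sdiff_sq_le (B : ℝ) :
    ∃ C, 0 ≤ C ∧ ∀ (ν : Measure Torus) [IsProbabilityMeasure ν] (A : Set Torus) (L : ℕ)
      (S : Finset Freq) (b : Freq → ℝ) (K : ℕ), 0 < L → Sampling ν A L → S ⊆ freqBox L →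
      (∀ n, 0 ≤ b n) → (∀ n, b n ≤ B * bracket n ^ (-2 : ℝ)) → 0 < K →
      SymmCov A S b → SymmCov A (S ∩ freqBox K) b →
      ∫ x, ∫ y, (covKernel b S x y - covKernel b (S ∩ freqBox K) x y) ^ 2 ∂ν ∂ν ≤ C / K := by
  have hsum := summable_bracket_rpow (k := 3) (by norm_num)
  refine ⟨9 * (B ^ 2 * ∑' n : Freq, bracket n ^ (-3 : ℝ)), ?_, ?_⟩
  · have : 0 ≤ ∑' n : Freq, bracket n ^ (-3 : ℝ) :=
      tsum_nonneg fun n => Real.rpow_nonneg (bracket_pos n).le _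
    positivity
  · intro ν _ A L S b K hL hν hS hb0 hb hK h1 h2
    have hK' : (0 : ℝ) < K := by exact_mod_cast hK
    have hsub : S ∩ freqBox K ⊆ S := Finset.inter_subset_left
    have h := integral_cov_pow_le hL hν (Finset.sdiff_subset.trans hS) hb0 (h1.sub hsub h2) 1
      one_pos
    have e : ∀ x y, covKernel b S x y - covKernel b (S ∩ freqBox K) x y =
        ∑ n ∈ S \ (S ∩ freqBox K), b n * (hartley n x * hartley n y) := by
      intro x y
      rw [covKernel, covKernel, ← Finset.sum_sdiff hsub, add_sub_cancel_right]
    simp only [e]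
    refine h.trans ?_
    rw [pow_one, mul_div_assoc]
    gcongr
    calc ∑ n ∈ S \ (S ∩ freqBox K), b n ^ ((((1 : ℕ) : ℝ) + 1) / (1 : ℕ))
        ≤ ∑ n ∈ S \ (S ∩ freqBox K), B ^ 2 / K * bracket n ^ (-3 : ℝ) := by
          refine Finset.sum_le_sum fun n hn => ?_
          rw [Finset.sdiff_inter_self_left, Finset.mem_sdiff, mem_freqBox, not_le] at hn
          have hw : (K : ℝ) ≤ bracket n := by rw [bracket]; linarith [hn.2]
          have hbp := bracket_pos n
          rw [show (((1 : ℕ) : ℝ) + 1) / (1 : ℕ) = ((2 : ℕ) : ℝ) by norm_num, Real.rpow_natCast]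
          calc b n ^ 2 ≤ (B * bracket n ^ (-2 : ℝ)) ^ 2 := by
                have := hb0 n; gcongr; exact hb n
            _ = B ^ 2 * (bracket n ^ (-3 : ℝ) * (1 / bracket n)) := by
                rw [mul_pow, ← Real.rpow_natCast (bracket n ^ (-2 : ℝ)), ← Real.rpow_mul hbp.le,
                  one_div, ← Real.rpow_neg_one, ← Real.rpow_add hbp]
                norm_num
            _ ≤ B ^ 2 * (bracket n ^ (-3 : ℝ) * (1 / K)) := by
                have := Real.rpow_nonneg hbp.le (-3)
                gcongr
            _ = _ := by ring
      _ = B ^ 2 / K * ∑ n ∈ S \ (S ∩ freqBox K), bracket n ^ (-3 : ℝ) := by rw [Finset.mul_sum]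
      _ ≤ B ^ 2 / K * ∑' n : Freq, bracket n ^ (-3 : ℝ) := by
          gcongr
          exact hsum.sum_le_tsum _ fun n _ => Real.rpow_nonneg (bracket_pos n).le _
      _ = _ := by ring

/-- The weight `l` is free, to be chosen large when `x - y` is small. -/
theorem abs_pow_sub_pow_le_weighted (x y l : ℝ) (hl : 0 < l) (j : ℕ) :
    |x ^ (j + 1) - y ^ (j + 1)| ≤
      l * ((j + 1) ^ 2 * (x - y) ^ 2) + (x ^ (2 * j) + y ^ (2 * j)) / l := by
  have h1 := abs_pow_sub_pow_le x y (j + 1)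
  rw [Nat.add_sub_cancel] at h1
  set M := max |x| |y| with hM
  have hM2 : (M ^ j) ^ 2 ≤ x ^ (2 * j) + y ^ (2 * j) := by
    have hx : x ^ (2 * j) = |x| ^ (2 * j) := by rw [pow_mul, pow_mul, sq_abs]
    have hy : y ^ (2 * j) = |y| ^ (2 * j) := by rw [pow_mul, pow_mul, sq_abs]
    rw [hx, hy, ← pow_mul, mul_comm j 2]
    rcases max_choice |x| |y| with h | h <;> rw [hM, h]
    · linarith [pow_nonneg (abs_nonneg y) (2 * j)]
    · linarith [pow_nonneg (abs_nonneg x) (2 * j)]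
  refine h1.trans ?_
  have h2 : |x - y| * ((j + 1 : ℕ) : ℝ) * M ^ j ≤
      l * ((j + 1) ^ 2 * (x - y) ^ 2) + (M ^ j) ^ 2 / l := by
    rw [← sq_abs (x - y)]
    push_cast
    have hs := Real.sq_sqrt hl.le
    have hs0 : 0 < √l := Real.sqrt_pos.2 hl
    have e : l * (((j : ℝ) + 1) ^ 2 * |x - y| ^ 2) + (M ^ j) ^ 2 / l =
        (√l * (((j : ℝ) + 1) * |x - y|)) ^ 2 + (M ^ j / √l) ^ 2 := by
      rw [mul_pow, div_pow, hs, mul_pow]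
    have e2 : |x - y| * ((j : ℝ) + 1) * M ^ j =
        (√l * (((j : ℝ) + 1) * |x - y|)) * (M ^ j / √l) := by
      field_simp
    rw [e, e2]
    have hm : 0 ≤ M ^ j := pow_nonneg ((abs_nonneg x).trans (le_max_left _ _)) _
    have := abs_nonneg (x - y)
    have hp : 0 ≤ (√l * (((j : ℝ) + 1) * |x - y|)) * (M ^ j / √l) := by positivity
    nlinarith [sq_nonneg (√l * (((j : ℝ) + 1) * |x - y|) - M ^ j / √l)]
  refine h2.trans ?_
  gcongr

/-- The powers of the covariance and of its truncation are close in the mean, uniformly. -/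
theorem exists_integral_covKernel_pow_sub_le (B : ℝ) (hB : 0 ≤ B) (j : ℕ) :
    ∃ C, 0 ≤ C ∧ ∀ (ν : Measure Torus) [IsProbabilityMeasure ν] (A : Set Torus) (L : ℕ)
      (S : Finset Freq) (b : Freq → ℝ) (K : ℕ), 0 < L → Sampling ν A L → S ⊆ freqBox L →
      (∀ n, 0 ≤ b n) → (∀ n, b n ≤ B * bracket n ^ (-2 : ℝ)) → 0 < K →
      SymmCov A S b → SymmCov A (S ∩ freqBox K) b →
      ∫ x, ∫ y, |covKernel b S x y ^ j - covKernel b (S ∩ freqBox K) x y ^ j| ∂ν ∂ν ≤ C / √K := by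
  cases j with
  | zero =>
    refine ⟨0, le_rfl, fun ν _ A L S b K _ _ _ _ _ _ _ _ => by simp⟩
  | succ j =>
    obtain ⟨C1, h10, hC1⟩ := exists_integral_covKernel_sdiff_sq_le B
    obtain ⟨C2, h20, hC2⟩ := exists_integral_covKernel_pow_le B hB j
    refine ⟨(j + 1) ^ 2 * C1 + 2 * C2, by positivity, ?_⟩
    intro ν _ A L S b K hL hν hS hb0 hb hK h1 h2
    have hK' : (0 : ℝ) < K := by exact_mod_cast hK
    have hsK : 0 < √(K : ℝ) := Real.sqrt_pos.2 hK'
    have e1 := hC1 ν A L S b K hL hν hS hb0 hb hK h1 h2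
    have e2 := hC2 ν A L S b hL hν hS hb0 hb h1
    have e3 := hC2 ν A L (S ∩ freqBox K) b hL hν (Finset.inter_subset_left.trans hS) hb0 hb h2
    have hcS := continuous_covKernel b S
    have hcK := continuous_covKernel b (S ∩ freqBox K)
    rw [integral_integral_eq (by fun_prop)] at e1 e2 e3 ⊢
    have i1 := integrable_prod_of_continuous (ν := ν)
      (G := fun x y => (covKernel b S x y - covKernel b (S ∩ freqBox K) x y) ^ 2) (by fun_prop)
    have i2 := integrable_prod_of_continuous (ν := ν)
      (G := fun x y => covKernel b S x y ^ (2 * j)) (by fun_prop)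
    have i3 := integrable_prod_of_continuous (ν := ν)
      (G := fun x y => covKernel b (S ∩ freqBox K) x y ^ (2 * j)) (by fun_prop)
    calc ∫ p, |covKernel b S p.1 p.2 ^ (j + 1) - covKernel b (S ∩ freqBox K) p.1 p.2 ^ (j + 1)|
          ∂(ν.prod ν)
        ≤ ∫ p, (√(K : ℝ) * ((j + 1) ^ 2 * (covKernel b S p.1 p.2 -
            covKernel b (S ∩ freqBox K) p.1 p.2) ^ 2) + (covKernel b S p.1 p.2 ^ (2 * j) +
            covKernel b (S ∩ freqBox K) p.1 p.2 ^ (2 * j)) / √(K : ℝ)) ∂(ν.prod ν) := by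
          refine integral_mono (integrable_prod_of_continuous (G := fun x y =>
            |covKernel b S x y ^ (j + 1) - covKernel b (S ∩ freqBox K) x y ^ (j + 1)|)
            (by fun_prop)) (((i1.const_mul _).const_mul _).add ((i2.add i3).div_const _)) fun p => ?_
          exact abs_pow_sub_pow_le_weighted _ _ _ hsK j
      _ = √(K : ℝ) * ((j + 1) ^ 2 * ∫ p, (covKernel b S p.1 p.2 -
            covKernel b (S ∩ freqBox K) p.1 p.2) ^ 2 ∂(ν.prod ν)) +
          (∫ p, covKernel b S p.1 p.2 ^ (2 * j) ∂(ν.prod ν) +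
            ∫ p, covKernel b (S ∩ freqBox K) p.1 p.2 ^ (2 * j) ∂(ν.prod ν)) / √(K : ℝ) := by
          rw [← integral_add i2 i3, ← integral_div, ← integral_const_mul,
            ← integral_const_mul]
          exact integral_add ((i1.const_mul _).const_mul _) ((i2.add i3).div_const _)
      _ ≤ √(K : ℝ) * ((j + 1) ^ 2 * (C1 / K)) + (C2 + C2) / √(K : ℝ) := by gcongr
      _ = _ := by
          have : √(K : ℝ) / K = 1 / √(K : ℝ) := by
            rw [Real.sqrt_div_self']
          rw [show √(K : ℝ) * (((j : ℝ) + 1) ^ 2 * (C1 / K)) =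
            ((j : ℝ) + 1) ^ 2 * C1 * (√(K : ℝ) / K) by ring, this]
          ring

/-! ### Nelson's estimate -/

/-- A random variable is exponentially integrable if it is well approximated by random variables
with slowly deteriorating lower bounds. The constant depends on `C` and `D` only. -/
theorem exists_lintegral_exp_neg_le {C : ℝ} (hC : 0 ≤ C) (D : ℝ) : ∃ M : ℝ, 0 ≤ M ∧
    ∀ {Ω : Type} [MeasurableSpace Ω] (μ : Measure Ω) [IsProbabilityMeasure μ] (V : Ω → ℝ)
      (W : ℕ → Ω → ℝ), (∀ i ω, -(D * √2 ^ i) ≤ W i ω) →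
      (∀ i, Integrable (fun ω => |V ω - W i ω| ^ (2 * 2 ^ i)) μ) →
      (∀ i, ∫ ω, |V ω - W i ω| ^ (2 * 2 ^ i) ∂μ ≤ (C / 2 ^ i) ^ 2 ^ i) →
      ∫⁻ ω, ENNReal.ofReal (Real.exp (-V ω)) ∂μ ≤ ENNReal.ofReal M := by
  set D' := max D 1 with hD'
  have hD1 : 1 ≤ D' := le_max_right _ _
  have h2 : 1 < √2 := by
    rw [Real.lt_sqrt] <;> norm_num
  have hr0 : 0 < √(2 : ℝ) := by linarith
  set t : ℕ → ℝ := fun i => Real.exp (D' * √2 ^ (i + 1) + 1) * (C / 2 ^ i) ^ 2 ^ i with ht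
  have ht0 : ∀ i, 0 ≤ t i := fun i => by positivity
  have hsum : Summable t := by
    have hlim : Tendsto (fun i : ℕ => C / (2 : ℝ) ^ i) atTop (𝓝 0) :=
      tendsto_const_nhds.div_atTop (tendsto_pow_atTop_atTop_of_one_lt one_lt_two)
    have hev : ∀ᶠ i : ℕ in atTop, C / (2 : ℝ) ^ i < Real.exp (-(D' * √2 + 2)) :=
      hlim.eventually_lt_const (Real.exp_pos _)
    refine Summable.of_norm_bounded_eventually_nat (g := fun i : ℕ => Real.exp (-(i : ℝ)))
      Real.summable_exp_neg_nat ?_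
    filter_upwards [hev] with i hi
    rw [Real.norm_of_nonneg (ht0 i), ht]
    calc Real.exp (D' * √2 ^ (i + 1) + 1) * (C / 2 ^ i) ^ 2 ^ i
        ≤ Real.exp (D' * √2 ^ (i + 1) + 1) * Real.exp (-(D' * √2 + 2)) ^ 2 ^ i := by gcongr
      _ = Real.exp (D' * √2 ^ (i + 1) + 1 + (2 ^ i : ℕ) * (-(D' * √2 + 2))) := by
          rw [← Real.exp_nat_mul, ← Real.exp_add]
      _ ≤ _ := by
          rw [Real.exp_le_exp]
          push_cast
          have h3 : √2 ^ i ≤ (2 : ℝ) ^ i := by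
            gcongr
            rw [Real.sqrt_le_left] <;> norm_num
          have h4 : (i : ℝ) + 1 ≤ 2 ^ i := by
            exact_mod_cast Nat.succ_le_of_lt (Nat.lt_two_pow_self (n := i))
          have h5 : D' * √2 * √2 ^ i ≤ D' * √2 * 2 ^ i := by gcongr
          rw [pow_succ]
          nlinarith
  refine ⟨Real.exp (D' + 1) + ∑' i, t i, add_nonneg (Real.exp_pos _).le (tsum_nonneg ht0), ?_⟩
  intro Ω _ μ _ V W hW hint hmom
  set X : ℕ → Ω → ℝ≥0∞ := fun i ω => ENNReal.ofReal (Real.exp (D' * √2 ^ (i + 1) + 1)) *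
    ENNReal.ofReal (|V ω - W i ω| ^ (2 * 2 ^ i)) with hX
  have hpt : ∀ ω, ENNReal.ofReal (Real.exp (-V ω)) ≤
      ENNReal.ofReal (Real.exp (D' + 1)) + ∑' i, X i ω := by
    intro ω
    have hex : ∃ i : ℕ, -V ω ≤ D' * √2 ^ i + 1 := by
      have : Tendsto (fun i : ℕ => D' * √2 ^ i + 1) atTop atTop :=
        tendsto_atTop_add_const_right _ _
          ((tendsto_pow_atTop_atTop_of_one_lt h2).const_mul_atTop (by linarith))
      exact (this.eventually_ge_atTop _).exists
    classical
    rcases hn : Nat.find hex with _ | i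
    · have h := Nat.find_spec hex
      rw [hn] at h
      refine le_trans (ENNReal.ofReal_le_ofReal ?_) le_self_add
      rw [Real.exp_le_exp]
      simpa using h
    · have h := Nat.find_spec hex
      rw [hn] at h
      have hi := Nat.find_min hex (m := i) (by omega)
      push Not at hi
      refine le_trans ?_ ((ENNReal.le_tsum i).trans le_add_self)
      have hb : 1 ≤ |V ω - W i ω| := by
        have h1 := hW i ω
        have h6 : D * √2 ^ i ≤ D' * √2 ^ i := by
          gcongr; exact le_max_left _ _
        rw [abs_sub_comm]
        refine le_trans ?_ (le_abs_self _)
        linarith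
      rw [hX]
      simp only
      rw [← ENNReal.ofReal_mul (Real.exp_pos _).le]
      refine ENNReal.ofReal_le_ofReal ?_
      refine (Real.exp_le_exp.2 h).trans ?_
      exact le_mul_of_one_le_right (Real.exp_pos _).le (one_le_pow₀ hb)
  have hXm : ∀ i, AEMeasurable (X i) μ := fun i => (hint i).1.aemeasurable.ennreal_ofReal.const_mul _
  calc ∫⁻ ω, ENNReal.ofReal (Real.exp (-V ω)) ∂μ
      ≤ ∫⁻ ω, (ENNReal.ofReal (Real.exp (D' + 1)) + ∑' i, X i ω) ∂μ := lintegral_mono hpt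
    _ = ENNReal.ofReal (Real.exp (D' + 1)) + ∑' i, ∫⁻ ω, X i ω ∂μ := by
        rw [lintegral_add_left measurable_const, lintegral_tsum hXm]
        simp
    _ ≤ ENNReal.ofReal (Real.exp (D' + 1)) + ∑' i, ENNReal.ofReal (t i) := by
        gcongr with i
        rw [hX]
        simp only
        rw [lintegral_const_mul'' _ (hint i).1.aemeasurable.ennreal_ofReal,
          ← ofReal_integral_eq_lintegral_ofReal (hint i) (ae_of_all _ fun ω => by positivity),
          ← ENNReal.ofReal_mul (Real.exp_pos _).le]
        refine ENNReal.ofReal_le_ofReal ?_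
        rw [ht]
        simp only
        gcongr
        exact hmom i
    _ = _ := by
        rw [← ENNReal.ofReal_tsum_of_nonneg ht0 hsum,
          ← ENNReal.ofReal_add (Real.exp_pos _).le (tsum_nonneg ht0)]

/-! ### Interactions of finite Gaussian fields -/

instance : IsProbabilityMeasure noiseLaw := by
  unfold noiseLaw
  infer_instance

/-- The Gaussian field with the finitely many coefficients `s n`, `n ∈ S`. -/
noncomputable def finField (S : Finset Freq) (s : Freq → ℝ) (g : Noise) (x : Torus) : ℝ :=
  ∑ n ∈ S, s n * g n * hartley n x

/-- The Wick ordered interaction `∑ j ≤ d, ∫ f j :Φ ^ j: dν` of the finite field `Φ`. -/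
noncomputable def wickSum (ν : Measure Torus) (d : ℕ) (f : ℕ → Torus → ℝ) (S : Finset Freq)
    (s : Freq → ℝ) (g : Noise) : ℝ :=
  ∑ j ∈ Finset.range (d + 1),
    ∫ x, f j x * wick (∑ n ∈ S, s n ^ 2) j (finField S s g x) ∂ν

/-- The data of a finite Gaussian field on the torus (`ν` the Haar measure) or on a lattice in it
(`ν` the uniform measure), with covariance multipliers bounded by those of a massive free field. -/
structure FieldData (B : ℝ) (ν : Measure Torus) (A : Set Torus) (L : ℕ) (S : Finset Freq)
    (s : Freq → ℝ) : Prop where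
  pos : 0 < L
  sampling : Sampling ν A L
  subset : S ⊆ freqBox L
  le : ∀ n, s n ^ 2 ≤ B * bracket n ^ (-2 : ℝ)
  symm : ∀ K, SymmCov A (S ∩ freqBox K) fun n => s n ^ 2

theorem freqBox_mono {K L : ℕ} (h : K ≤ L) : freqBox K ⊆ freqBox L := fun n hn =>
  mem_freqBox.2 ((mem_freqBox.1 hn).trans (by exact_mod_cast h))

section FieldData

variable {B : ℝ} {ν : Measure Torus} [IsProbabilityMeasure ν] {A : Set Torus} {L : ℕ}
  {S : Finset Freq} {s : Freq → ℝ}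

theorem FieldData.symm' (h : FieldData B ν A L S s) : SymmCov A S fun n => s n ^ 2 := by
  have := h.symm L
  rwa [Finset.inter_eq_left.2 h.subset] at this

theorem FieldData.inter (h : FieldData B ν A L S s) (K : ℕ) :
    FieldData B ν A L (S ∩ freqBox K) s where
  pos := h.pos
  sampling := h.sampling
  subset := Finset.inter_subset_left.trans h.subset
  le := h.le
  symm K' := by
    rw [Finset.inter_assoc]
    rcases le_total K K' with hK | hK
    · rw [Finset.inter_eq_left.2 (freqBox_mono hK)]; exact h.symm K
    · rw [Finset.inter_eq_right.2 (freqBox_mono hK)]; exact h.symm K'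

open UnitAddTorus in
theorem SymmCov.diag {T : Finset Freq} {b : Freq → ℝ} (h : SymmCov A T b) {x : Torus}
    (hx : x ∈ A) : ∑ n ∈ T, b n * (hartley n x * hartley n x) = ∑ n ∈ T, b n := by
  have h1 := h x hx x hx
  have e : ∀ n : Freq, mFourier n x * mFourier (-n) x = 1 := by
    intro n
    rw [← mFourier_add, add_neg_cancel, mFourier_zero]
    rfl
  simp only [e, mul_one] at h1
  exact_mod_cast h1

/-- The noise coordinates in a finite set. -/
def restrictNoise (S : Finset Freq) (g : Noise) (n : S) : ℝ := g n

theorem measurePreserving_restrictNoise (S : Finset Freq) :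
    MeasurePreserving (restrictNoise S) noiseLaw (gaussPi S) :=
  ⟨by unfold restrictNoise; fun_prop,
    Measure.infinitePi_map_restrict (μ := fun _ : Freq => gaussianReal 0 1) (I := S)⟩

/-- The interaction of a finite field as a Wick ordered integral in finitely many Gaussian
coordinates. -/
theorem wickSum_eq (h : FieldData B ν A L S s) (d : ℕ) (f : ℕ → Torus → ℝ) (g : Noise) :
    wickSum ν d f S s g = ∑ j ∈ Finset.range (d + 1),
      wickIntegral ν (fun (i : S) x => s i * hartley i x) (f j) j (restrictNoise S g) := by
  refine Finset.sum_congr rfl fun j _ => ?_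
  refine integral_congr_ae ?_
  filter_upwards [h.sampling.ae_mem] with x hx
  have e1 : ∑ n ∈ S, s n ^ 2 = ∑ i : S, (s i * hartley i x) ^ 2 := by
    rw [← h.symm'.diag hx, ← Finset.sum_coe_sort S]
    exact Finset.sum_congr rfl fun n _ => by ring
  have e2 : finField S s g x = ∑ i : S, s i * hartley i x * restrictNoise S g i := by
    rw [finField, ← Finset.sum_coe_sort S]
    exact Finset.sum_congr rfl fun n _ => by rw [restrictNoise]; ring
  rw [e1, e2]

/-- The truncated interaction in terms of the same coordinates, with coefficients cut off by an
indicator function. -/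
theorem wickSum_inter_eq (h : FieldData B ν A L S s) (d : ℕ) (f : ℕ → Torus → ℝ) (K : ℕ)
    (g : Noise) :
    wickSum ν d f (S ∩ freqBox K) s g = ∑ j ∈ Finset.range (d + 1),
      wickIntegral ν (fun (i : S) x => (if (i : Freq) ∈ freqBox K then 1 else 0) *
        (s i * hartley i x)) (f j) j (restrictNoise S g) := by
  refine Finset.sum_congr rfl fun j _ => ?_
  refine integral_congr_ae ?_
  filter_upwards [h.sampling.ae_mem] with x hx
  have e1 : ∑ n ∈ S ∩ freqBox K, s n ^ 2 =
      ∑ i : S, ((if (i : Freq) ∈ freqBox K then 1 else 0) * (s i * hartley i x)) ^ 2 := by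
    rw [← (h.symm K).diag hx, ← Finset.sum_ite_mem, ← Finset.sum_coe_sort S]
    refine Finset.sum_congr rfl fun n _ => ?_
    split_ifs <;> ring
  have e2 : finField (S ∩ freqBox K) s g x = ∑ i : S, (if (i : Freq) ∈ freqBox K then 1 else 0) *
      (s i * hartley i x) * restrictNoise S g i := by
    rw [finField, ← Finset.sum_ite_mem, ← Finset.sum_coe_sort S]
    refine Finset.sum_congr rfl fun n _ => ?_
    rw [restrictNoise]
    split_ifs <;> ring
  rw [e1, e2]

theorem allLp_wickSum (h : FieldData B ν A L S s) (d : ℕ) {f : ℕ → Torus → ℝ}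
    (hf : ∀ j, Continuous (f j)) : AllLp (wickSum ν d f S s) noiseLaw := by
  rw [funext (wickSum_eq h d f)]
  exact AllLp.sum _ fun j _ => (allLp_wickIntegral (fun i => by fun_prop) (hf j) j).comp
    (measurePreserving_restrictNoise S)

end FieldData

/-- Moments of the difference between an interaction and its truncation. -/
theorem exists_integral_wickSum_sub_pow_le {B : ℝ} (hB : 0 ≤ B) (G : ℝ) (d : ℕ) : ∃ C, 0 ≤ C ∧
    ∀ (ν : Measure Torus) [IsProbabilityMeasure ν] (A : Set Torus) (L : ℕ) (S : Finset Freq)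
      (s : Freq → ℝ) (f : ℕ → Torus → ℝ) (K r : ℕ), FieldData B ν A L S s →
      (∀ j, Continuous (f j)) → (∀ j x, |f j x| ≤ G) → 0 < K →
      ∫ g, |wickSum ν d f S s g - wickSum ν d f (S ∩ freqBox K) s g| ^ (2 * 2 ^ r) ∂noiseLaw ≤
        ((2 : ℝ) ^ r) ^ (d * 2 ^ r) * (C / √K) ^ 2 ^ r := by
  choose C hC0 hC using exists_integral_covKernel_pow_sub_le B hB
  refine ⟨(d + 1) * ∑ j ∈ Finset.range (d + 1), (j.factorial : ℝ) * 2 ^ j * (G ^ 2 * C j), ?_, ?_⟩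
  · refine mul_nonneg (by positivity) (Finset.sum_nonneg fun j _ => ?_)
    have := hC0 j
    positivity
  intro ν _ A L S s f K r h hf hG hK
  have ha : ∀ i : S, Continuous fun x => s i * hartley i x := fun i => by fun_prop
  have hmain := integral_wickIntegral_sub_pow_le (ν := ν) ha hf hG
    (fun i : S => if (i : Freq) ∈ freqBox K then 1 else 0) (by intro i; split_ifs <;> norm_num) d r
  rw [← (measurePreserving_restrictNoise S).map_eq, integral_map
    (measurePreserving_restrictNoise S).aemeasurable] at hmain
  · have e : ∀ g, wickSum ν d f S s g - wickSum ν d f (S ∩ freqBox K) s g =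
        ∑ j ∈ Finset.range (d + 1),
        (wickIntegral ν (fun (i : S) x => s i * hartley i x) (f j) j (restrictNoise S g) -
        wickIntegral ν (fun (i : S) x => (if (i : Freq) ∈ freqBox K then 1 else 0) *
        (s i * hartley i x)) (f j) j (restrictNoise S g)) := by
      intro g
      rw [wickSum_eq h, wickSum_inter_eq h, Finset.sum_sub_distrib]
    simp only [e]
    refine hmain.trans ?_
    rw [mul_div_assoc, Finset.sum_div]
    have hterm : ∀ j, ∫ x, ∫ y, |(∑ i : S, s i * hartley i x * (s i * hartley i y)) ^ j -
        (∑ i : S, (if (i : Freq) ∈ freqBox K then 1 else 0) *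
          (s i * hartley i x * (s i * hartley i y))) ^ j| ∂ν ∂ν ≤ C j / √K := by
      intro j
      refine le_trans (le_of_eq ?_) (hC j ν A L S (fun n => s n ^ 2) K h.pos h.sampling h.subset
        (fun n => sq_nonneg _) h.le hK h.symm' (h.symm K))
      congr 1; funext x; congr 1; funext y
      congr 2
      · congr 1
        rw [covKernel, ← Finset.sum_coe_sort S]
        exact Finset.sum_congr rfl fun n _ => by ring
      · congr 1
        rw [covKernel, ← Finset.sum_ite_mem, ← Finset.sum_coe_sort S]
        refine Finset.sum_congr rfl fun n _ => ?_
        split_ifs <;> ring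
    refine mul_le_mul_of_nonneg_left (pow_le_pow_left₀ ?_ ?_ _) (by positivity)
    · refine mul_nonneg (by positivity) (Finset.sum_nonneg fun j _ => ?_)
      exact mul_nonneg (by positivity) (mul_nonneg (sq_nonneg _)
        (integral_nonneg fun x => integral_nonneg fun y => abs_nonneg _))
    · refine mul_le_mul_of_nonneg_left (Finset.sum_le_sum fun j _ => ?_) (by positivity)
      rw [mul_div_assoc, mul_div_assoc]
      gcongr
      exact hterm j
  · have hc : ∀ j, Continuous (wickIntegral ν (fun (i : S) x => s i * hartley i x) (f j) j) :=
      fun j => continuous_wickIntegral ha (hf j) j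
    have hc2 : ∀ j, Continuous (wickIntegral ν (fun (i : S) x =>
        (if (i : Freq) ∈ freqBox K then 1 else 0) * (s i * hartley i x)) (f j) j) :=
      fun j => continuous_wickIntegral (fun i => by fun_prop) (hf j) j
    exact Continuous.aestronglyMeasurable (by fun_prop)

/-- The variance of a field truncated to frequencies of size `K` grows slower than any power. -/
theorem exists_sum_sq_le (B : ℝ) {δ : ℝ} (hδ : 0 < δ) : ∃ C, 0 ≤ C ∧
    ∀ (s : Freq → ℝ) (S : Finset Freq) (K : ℕ), (∀ n, s n ^ 2 ≤ B * bracket n ^ (-2 : ℝ)) →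
      ∑ n ∈ S ∩ freqBox K, s n ^ 2 ≤ C * (1 + K : ℝ) ^ δ := by
  have hsum := summable_bracket_rpow (k := 2 + δ) (by linarith)
  have hB : ∀ s : Freq → ℝ, (∀ n, s n ^ 2 ≤ B * bracket n ^ (-2 : ℝ)) → 0 ≤ B := by
    intro s hs
    have := (sq_nonneg _).trans (hs 0)
    simpa [bracket] using this
  refine ⟨max B 0 * ∑' n : Freq, bracket n ^ (-(2 + δ)), ?_, ?_⟩
  · have : 0 ≤ ∑' n : Freq, bracket n ^ (-(2 + δ)) :=
      tsum_nonneg fun n => Real.rpow_nonneg (bracket_pos n).le _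
    positivity
  intro s S K hs
  have hB0 := hB s hs
  rw [max_eq_left hB0]
  calc ∑ n ∈ S ∩ freqBox K, s n ^ 2
      ≤ ∑ n ∈ S ∩ freqBox K, B * (1 + K : ℝ) ^ δ * bracket n ^ (-(2 + δ)) := by
        refine Finset.sum_le_sum fun n hn => (hs n).trans ?_
        have hn : bracket n ≤ 1 + K := by
          have := mem_freqBox.1 (Finset.mem_inter.1 hn).2
          rw [bracket]; linarith
        have hbp := bracket_pos n
        rw [show (-2 : ℝ) = δ + -(2 + δ) by ring, Real.rpow_add hbp, mul_assoc]
        have h1 := Real.rpow_nonneg hbp.le (-(2 + δ))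
        gcongr
    _ = B * (1 + K : ℝ) ^ δ * ∑ n ∈ S ∩ freqBox K, bracket n ^ (-(2 + δ)) := by
        rw [Finset.mul_sum]
    _ ≤ B * (1 + K : ℝ) ^ δ * ∑' n : Freq, bracket n ^ (-(2 + δ)) := by
        gcongr
        exact hsum.sum_le_tsum _ fun n _ => Real.rpow_nonneg (bracket_pos n).le _
    _ = _ := by ring

/-- Nelson's estimate, uniformly over all finite fields with comparable covariance multipliers. -/
theorem exists_lintegral_exp_wickSum_le {B : ℝ} (hB : 0 ≤ B) (G : ℝ) (d : ℕ) (D : ℝ) (hD : 0 ≤ D)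
    (E : ℕ) : ∃ M : ℝ, 0 ≤ M ∧
    ∀ (ν : Measure Torus) [IsProbabilityMeasure ν] (A : Set Torus) (L : ℕ) (S : Finset Freq)
      (s : Freq → ℝ) (f : ℕ → Torus → ℝ), FieldData B ν A L S s →
      (∀ j, Continuous (f j)) → (∀ j x, |f j x| ≤ G) →
      (∀ x ∈ A, ∀ c y : ℝ, 0 ≤ c →
        -(D * (1 + c) ^ E) ≤ ∑ j ∈ Finset.range (d + 1), f j x * wick c j y) →
      ∫⁻ g, ENNReal.ofReal (Real.exp (-wickSum ν d f S s g)) ∂noiseLaw ≤ ENNReal.ofReal M := by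
  obtain ⟨C, hC0, hC⟩ := exists_integral_wickSum_sub_pow_le hB G d
  -- the truncation scale at step `i` is `2 ^ (i * a)`: with `a = 2 * d + 2` its square root beats the
  -- hypercontractive loss `2 ^ (i * d)` by a factor `2 ^ i`, and with this `δ` the lower bound
  -- deteriorates like `√2 ^ i` only
  set a : ℕ := 2 * d + 2 with ha
  set δ : ℝ := 1 / (2 * a * (E + 1)) with hδ
  have ha0 : (0 : ℝ) < a := by rw [ha]; positivity
  have hδ0 : 0 < δ := by positivity
  obtain ⟨C1, hC10, hC1⟩ := exists_sum_sq_le B hδ0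
  obtain ⟨M, hM0, hM⟩ := exists_lintegral_exp_neg_le hC0 (D * ((1 + C1) ^ E * 2))
  refine ⟨M, hM0, ?_⟩
  intro ν _ A L S s f h hf hG hlow
  refine hM noiseLaw (wickSum ν d f S s)
    (fun i => wickSum ν d f (S ∩ freqBox (2 ^ (i * a))) s) ?_ ?_ ?_
  · intro i g
    set K : ℕ := 2 ^ (i * a) with hK
    set c := ∑ n ∈ S ∩ freqBox K, s n ^ 2 with hc
    have hc0 : 0 ≤ c := Finset.sum_nonneg fun n _ => sq_nonneg _
    have hcK : (1 + c) ^ E ≤ (1 + C1) ^ E * 2 * √2 ^ i := by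
      have hK1 : (1 : ℝ) ≤ K := by exact_mod_cast Nat.one_le_two_pow
      have h1 : c ≤ C1 * (1 + K : ℝ) ^ δ := hC1 s S K h.le
      have h2 : 1 ≤ (1 + K : ℝ) ^ δ := Real.one_le_rpow (by linarith) hδ0.le
      have h3 : 1 + c ≤ (1 + C1) * (1 + K : ℝ) ^ δ := by nlinarith
      have h4 : (1 + K : ℝ) ^ δ ≤ (2 ^ (i * a + 1) : ℝ) ^ δ := by
        gcongr
        rw [hK] at hK1 ⊢
        push_cast at hK1 ⊢
        rw [pow_succ]; linarith
      have h5 : ((2 ^ (i * a + 1) : ℝ) ^ δ) ^ E ≤ 2 * √2 ^ i := by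
        rw [← Real.rpow_natCast, ← Real.rpow_mul (by positivity), ← Real.rpow_natCast 2,
          ← Real.rpow_mul (by norm_num), Real.sqrt_eq_rpow, ← Real.rpow_natCast (2 ^ (1 / 2 : ℝ)),
          ← Real.rpow_mul (by norm_num)]
        nth_rewrite 2 [← Real.rpow_one 2]
        rw [← Real.rpow_add (by norm_num)]
        refine Real.rpow_le_rpow_of_exponent_le (by norm_num) ?_
        have hE : δ * E ≤ 1 / (2 * a) := by
          rw [hδ, div_mul_eq_mul_div, one_mul, div_le_div_iff₀ (by positivity) (by positivity)]
          nlinarith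
        have ha1 : (2 : ℝ) ≤ a := by rw [ha]; push_cast; linarith [(Nat.cast_nonneg d : (0:ℝ) ≤ d)]
        push_cast
        calc ((i : ℝ) * a + 1) * (δ * E) ≤ (i * a + 1) * (1 / (2 * a)) := by gcongr
          _ = 1 / (2 * a) + 1 / 2 * i := by field_simp; ring
          _ ≤ _ := by
            gcongr
            rw [div_le_one (by positivity)]; linarith
      calc (1 + c) ^ E ≤ ((1 + C1) * (2 ^ (i * a + 1) : ℝ) ^ δ) ^ E := by
            gcongr
            exact h3.trans (by gcongr)
        _ = (1 + C1) ^ E * ((2 ^ (i * a + 1) : ℝ) ^ δ) ^ E := by rw [mul_pow]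
        _ ≤ (1 + C1) ^ E * (2 * √2 ^ i) := by gcongr
        _ = _ := by ring
    have hpt : ∀ x ∈ A, -(D * (1 + c) ^ E) ≤ ∑ j ∈ Finset.range (d + 1),
        f j x * wick c j (finField (S ∩ freqBox K) s g x) := fun x hx => hlow x hx c _ hc0
    have hcont : ∀ j, Continuous fun x =>
        f j x * wick c j (finField (S ∩ freqBox K) s g x) := by
      intro j
      have h1 := continuous_wick c j
      have h2 := hf j
      unfold finField
      fun_prop
    have hint : ∫ _x, -(D * (1 + c) ^ E) ∂ν ≤ wickSum ν d f (S ∩ freqBox K) s g := by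
      rw [wickSum, ← integral_finsetSum _ fun j _ => integrable_of_continuous (hcont j)]
      refine integral_mono_ae (integrable_const _)
        (integrable_finsetSum _ fun j _ => integrable_of_continuous (hcont j)) ?_
      filter_upwards [h.sampling.ae_mem] with x hx using hpt x hx
    simp only [integral_const, probReal_univ, one_smul] at hint
    refine le_trans ?_ hint
    rw [neg_le_neg_iff, mul_assoc D]
    gcongr
  · intro i
    simpa only [Real.norm_eq_abs] using ((allLp_wickSum h d hf).sub
      (allLp_wickSum (h.inter _) d hf)).integrable_norm_pow (2 * 2 ^ i)
  · intro i
    refine (hC ν A L S s f (2 ^ (i * a)) i h hf hG (by positivity)).trans (le_of_eq ?_)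
    have hsq : √((2 ^ (i * a) : ℕ) : ℝ) = (2 ^ i) ^ (d + 1) := by
      rw [Real.sqrt_eq_iff_mul_self_eq (by positivity) (by positivity), ha]
      push_cast
      rw [← pow_mul, ← pow_add]
      congr 1; ring
    rw [hsq, pow_mul, ← mul_pow]
    congr 1
    rw [pow_succ]
    field_simp

/-! ### Fourier modes on the torus -/

instance : IsProbabilityMeasure (volume : Measure UnitAddCircle) := ⟨by simp⟩

open UnitAddTorus in
theorem integral_mFourier_eq_zero {k : Freq} (hk : k ≠ 0) : ∫ x : Torus, mFourier k x = 0 := by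
  obtain ⟨i, hi⟩ := Function.ne_iff.mp hk
  simp only [mFourier, ContinuousMap.coe_mk]
  rw [integral_fintype_prod_volume_eq_prod]
  refine Finset.prod_eq_zero (Finset.mem_univ i) ?_
  have h := (orthonormal_iff_ite.mp (orthonormal_fourier (T := 1))) 0 (k i)
  rw [if_neg (by simpa using Ne.symm hi), ContinuousMap.inner_toLp] at h
  have hv : (volume : Measure UnitAddCircle) = AddCircle.haarAddCircle := by
    rw [AddCircle.volume_eq_smul_haarAddCircle]; simp
  rw [← hv] at h
  simpa using h

theorem sampling_volume (L : ℕ) : Sampling (volume : Measure Torus) Set.univ L where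
  ae_mem := by simp
  integral_mFourier k hk := by
    refine integral_mFourier_eq_zero ?_
    rintro rfl
    obtain ⟨i, hi⟩ := hk
    simp at hi

/-- A covariance is symmetric as soon as its multipliers are invariant under an involution of the
frequencies acting as `n ↦ -n` at the points of `A`. -/
theorem symmCov_of_involution {A : Set Torus} {T : Finset Freq} {b : Freq → ℝ} (r : Freq → Freq)
    (hr : ∀ n ∈ T, r n ∈ T) (hrr : ∀ n ∈ T, r (r n) = n) (hb : ∀ n ∈ T, b (r n) = b n)
    (hA : ∀ x ∈ A, ∀ n ∈ T, UnitAddTorus.mFourier (r n) x = UnitAddTorus.mFourier (-n) x) :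
    SymmCov A T b := by
  intro x hx y hy
  have hswap : ∀ F : Freq → ℝ, ∑ n ∈ T, F (r n) = ∑ n ∈ T, F n := fun F =>
    Finset.sum_nbij' r r hr hr hrr hrr fun n _ => rfl
  have hre : ∀ x ∈ A, ∀ n ∈ T, (UnitAddTorus.mFourier (r n) x).re =
      (UnitAddTorus.mFourier n x).re := by
    intro x hx n hn
    rw [hA x hx n hn, UnitAddTorus.mFourier_neg, Complex.conj_re]
  have him : ∀ x ∈ A, ∀ n ∈ T, (UnitAddTorus.mFourier (r n) x).im =
      -(UnitAddTorus.mFourier n x).im := by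
    intro x hx n hn
    rw [hA x hx n hn, UnitAddTorus.mFourier_neg, Complex.conj_im]
  -- the sum of a function which is odd under the involution vanishes
  have hodd : ∀ F : Freq → ℝ, (∀ n ∈ T, F (r n) = -F n) → ∑ n ∈ T, F n = 0 := by
    intro F hF
    have h1 := hswap F
    rw [Finset.sum_congr rfl hF, Finset.sum_neg_distrib] at h1
    linarith
  have h1 := hodd (fun n => b n * ((UnitAddTorus.mFourier n x).re * (UnitAddTorus.mFourier n y).im))
    (fun n hn => by rw [hb n hn, hre x hx n hn, him y hy n hn]; ring)
  have h2 := hodd (fun n => b n * ((UnitAddTorus.mFourier n x).im * (UnitAddTorus.mFourier n y).re))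
    (fun n hn => by rw [hb n hn, hre y hy n hn, him x hx n hn]; ring)
  apply Complex.ext
  · rw [Complex.ofReal_re, Complex.re_sum, ← sub_eq_zero, ← Finset.sum_sub_distrib]
    rw [← add_zero (0 : ℝ)]
    nth_rewrite 1 [← h1]
    rw [← h2, ← Finset.sum_add_distrib]
    refine Finset.sum_congr rfl fun n _ => ?_
    rw [UnitAddTorus.mFourier_neg]
    simp only [hartley, Complex.mul_re, Complex.mul_im, Complex.conj_re, Complex.conj_im,
      Complex.ofReal_re, Complex.ofReal_im]
    ring
  · rw [Complex.ofReal_im, Complex.im_sum, ← sub_zero (0 : ℝ)]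
    nth_rewrite 1 [← h2]
    rw [← h1, ← Finset.sum_sub_distrib]
    refine Finset.sum_congr rfl fun n _ => ?_
    rw [UnitAddTorus.mFourier_neg]
    simp only [Complex.mul_re, Complex.mul_im, Complex.conj_re, Complex.conj_im,
      Complex.ofReal_re, Complex.ofReal_im]
    ring

/-! ### Continuum interactions -/

theorem sum_sq_le_norm_sq (n : Freq) : ‖n‖ ^ 2 ≤ ∑ i, (n i : ℝ) ^ 2 := by
  have h0 : 0 ≤ ∑ i, (n i : ℝ) ^ 2 := Finset.sum_nonneg fun i _ => sq_nonneg _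
  rw [← Real.le_sqrt (norm_nonneg _) h0, pi_norm_le_iff_of_nonneg (Real.sqrt_nonneg _)]
  intro i
  rw [Real.le_sqrt (norm_nonneg _) h0, Int.norm_eq_abs, sq_abs]
  exact Finset.single_le_sum (f := fun i => (n i : ℝ) ^ 2) (fun i _ => sq_nonneg _)
    (Finset.mem_univ i)

theorem inv_add_le_bracket {M : ℝ} (hM : 0 < M) {q : ℝ} (n : Freq) (hq : ‖n‖ ^ 2 ≤ q) :
    1 / (q + M) ≤ (2 / M + 2) * bracket n ^ (-2 : ℝ) := by
  have hb := bracket_pos n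
  have hn := norm_nonneg n
  have h0 : 0 ≤ q := (sq_nonneg _).trans hq
  rw [Real.rpow_neg hb.le, ← div_eq_mul_inv, show (2 : ℝ) = (2 : ℕ) by norm_num,
    Real.rpow_natCast, div_le_div_iff₀ (by positivity) (by positivity), one_mul]
  push_cast
  have h1 : bracket n ^ 2 ≤ 2 + 2 * q := by
    rw [bracket]; nlinarith [sq_nonneg (1 - ‖n‖)]
  have h2 : (2 / M + 2) * (q + M) = 2 + 2 * q + (2 / M * q + 2 * M) := by
    field_simp; ring
  have h3 : 0 ≤ 2 / M * q + 2 * M := by positivity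
  linarith

theorem covMultiplier_pos {M : ℝ} (hM : 0 < M) (n : Freq) : 0 < covMultiplier M n := by
  have h0 : 0 ≤ ∑ i, (n i : ℝ) ^ 2 := Finset.sum_nonneg fun i _ => sq_nonneg _
  rw [covMultiplier]
  positivity

theorem covMultiplier_anti {M M' : ℝ} (hM : 0 < M) (h : M ≤ M') (n : Freq) :
    covMultiplier M' n ≤ covMultiplier M n := by
  have h0 : 0 ≤ ∑ i, (n i : ℝ) ^ 2 := Finset.sum_nonneg fun i _ => sq_nonneg _
  rw [covMultiplier, covMultiplier]
  gcongr

theorem covMultiplier_le {M : ℝ} (hM : 0 < M) (n : Freq) :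
    covMultiplier M n ≤ (2 / M + 2) * bracket n ^ (-2 : ℝ) := by
  refine inv_add_le_bracket hM n ?_
  have h0 := sum_sq_le_norm_sq n
  have h1 := Real.pi_gt_three
  have h2 : 0 ≤ ∑ i, (n i : ℝ) ^ 2 := Finset.sum_nonneg fun i _ => sq_nonneg _
  exact h0.trans (le_mul_of_one_le_left h2 (by nlinarith))

theorem neg_mem_freqBox {K : ℕ} {n : Freq} (h : n ∈ freqBox K) : -n ∈ freqBox K := by
  rw [mem_freqBox] at h ⊢
  rwa [norm_neg]

theorem FieldData.of_volume {B : ℝ} {s : Freq → ℝ} (hs : ∀ n, s n ^ 2 ≤ B * bracket n ^ (-2 : ℝ))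
    (hneg : ∀ n, s (-n) = s n) (K : ℕ) :
    FieldData B volume Set.univ (K + 1) (freqBox K) s where
  pos := K.succ_pos
  sampling := sampling_volume _
  subset := freqBox_mono K.le_succ
  le := hs
  symm K' := symmCov_of_involution (fun n => -n)
    (fun n hn => by
      rw [Finset.mem_inter] at hn ⊢
      exact ⟨neg_mem_freqBox hn.1, neg_mem_freqBox hn.2⟩)
    (fun n _ => neg_neg n) (fun n _ => by simp only [hneg]) (fun x _ n _ => rfl)

theorem wickSum_sub {ν : Measure Torus} [IsFiniteMeasure ν] (d : ℕ) {f f' : ℕ → Torus → ℝ}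
    (hf : ∀ j, Continuous (f j)) (hf' : ∀ j, Continuous (f' j)) (S : Finset Freq) (s : Freq → ℝ)
    (g : Noise) : wickSum ν d f S s g - wickSum ν d f' S s g =
      wickSum ν d (fun j x => f j x - f' j x) S s g := by
  have hint : ∀ f : Torus → ℝ, Continuous f → ∀ j, Integrable
      (fun x => f x * wick (∑ n ∈ S, s n ^ 2) j (finField S s g x)) ν := by
    intro f hf j
    refine integrable_of_continuous ?_
    have h1 := continuous_wick (∑ n ∈ S, s n ^ 2) j
    unfold finField
    fun_prop
  rw [wickSum, wickSum, wickSum, ← Finset.sum_sub_distrib]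
  refine Finset.sum_congr rfl fun j _ => ?_
  rw [← integral_sub (hint _ (hf j) j) (hint _ (hf' j) j)]
  exact integral_congr_ae (ae_of_all _ fun x => (sub_mul _ _ _).symm)

/-- Second moment of an interaction, in terms of the size of its coefficients. -/
theorem exists_integral_wickSum_sq_le {B : ℝ} (hB : 0 ≤ B) (d : ℕ) : ∃ C, 0 ≤ C ∧
    ∀ (ν : Measure Torus) [IsProbabilityMeasure ν] (A : Set Torus) (L : ℕ) (S : Finset Freq)
      (s : Freq → ℝ) (f : ℕ → Torus → ℝ) (G : ℝ), FieldData B ν A L S s →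
      (∀ j, Continuous (f j)) → (∀ j ≤ d, ∀ x, |f j x| ≤ G) →
      ∫ g, wickSum ν d f S s g ^ 2 ∂noiseLaw ≤ C * G ^ 2 := by
  choose C hC0 hC using exists_integral_abs_covKernel_pow_le B hB
  refine ⟨(d + 1) * ∑ j ∈ Finset.range (d + 1), (j.factorial : ℝ) * 2 ^ j * C j, ?_, ?_⟩
  · refine mul_nonneg (by positivity) (Finset.sum_nonneg fun j _ => ?_)
    have := hC0 j
    positivity
  intro ν _ A L S s f G h hf hG
  have ha : ∀ i : S, Continuous fun x => s i * hartley i x := fun i => by fun_prop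
  have hterm : ∀ j ∈ Finset.range (d + 1), ∫ g, wickIntegral ν (fun (i : S) x => s i * hartley i x)
      (f j) j g ^ 2 ∂gaussPi S ≤ (j.factorial : ℝ) * 2 ^ j * C j * G ^ 2 := by
    intro j hj
    refine (integral_wickIntegral_sq_le (ν := ν) ha (hf j)
      (hG j (Nat.lt_succ_iff.1 (Finset.mem_range.1 hj))) j).trans ?_
    rw [mul_assoc _ (C j), mul_comm (C j)]
    gcongr
    refine le_trans (le_of_eq ?_) (hC j ν A L S (fun n => s n ^ 2) h.pos h.sampling h.subset
        (fun n => sq_nonneg _) h.le h.symm')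
    congr 1; funext x; congr 1; funext y
    congr 2
    rw [covKernel, ← Finset.sum_coe_sort S]
    exact Finset.sum_congr rfl fun n _ => by ring
  have hL : ∀ j, AllLp (wickIntegral ν (fun (i : S) x => s i * hartley i x) (f j) j) (gaussPi S) :=
    fun j => allLp_wickIntegral ha (hf j) j
  have hcont : ∀ j, Continuous (wickIntegral ν (fun (i : S) x => s i * hartley i x) (f j) j) :=
    fun j => continuous_wickIntegral ha (hf j) j
  have hm := measurePreserving_restrictNoise S
  calc ∫ g, wickSum ν d f S s g ^ 2 ∂noiseLaw
      = ∫ g, (∑ j ∈ Finset.range (d + 1),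
          wickIntegral ν (fun (i : S) x => s i * hartley i x) (f j) j g) ^ 2 ∂gaussPi S := by
        rw [← hm.map_eq, integral_map hm.aemeasurable
          (Continuous.aestronglyMeasurable (by fun_prop))]
        simp only [wickSum_eq h]
    _ ≤ ∫ g, (d + 1) * ∑ j ∈ Finset.range (d + 1),
          wickIntegral ν (fun (i : S) x => s i * hartley i x) (f j) j g ^ 2 ∂gaussPi S := by
        refine integral_mono_of_nonneg (ae_of_all _ fun g => sq_nonneg _) ?_ (ae_of_all _ fun g => ?_)
        · exact ((integrable_finsetSum _ fun j _ => ((hL j).pow 2).integrable)).const_mul _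
        · have := sq_sum_le_card_mul_sum_sq (s := Finset.range (d + 1))
            (f := fun j => wickIntegral ν (fun (i : S) x => s i * hartley i x) (f j) j g)
          simpa using this
    _ ≤ (d + 1) * ∑ j ∈ Finset.range (d + 1), (j.factorial : ℝ) * 2 ^ j * C j * G ^ 2 := by
        rw [integral_const_mul, integral_finsetSum _ fun j _ => ((hL j).pow 2).integrable]
        gcongr with j hj
        exact hterm j hj
    _ = _ := by rw [← Finset.sum_mul]; ring

theorem eLpNorm_two_le {α : Type*} {mα : MeasurableSpace α} {μ : Measure α} {f : α → ℝ}
    (hf : MemLp f 2 μ) {c : ℝ} (h : ∫ x, f x ^ 2 ∂μ ≤ c) :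
    eLpNorm f 2 μ ≤ ENNReal.ofReal √c := by
  rw [hf.eLpNorm_eq_integral_rpow_norm (by norm_num) (by norm_num)]
  refine ENNReal.ofReal_le_ofReal ?_
  rw [Real.sqrt_eq_rpow, show (1 / 2 : ℝ) = (ENNReal.toReal 2)⁻¹ by norm_num]
  refine Real.rpow_le_rpow (integral_nonneg fun x => by positivity) (le_trans (le_of_eq ?_) h)
    (by norm_num)
  simp

theorem AllLp.memLp_two {α : Type*} {mα : MeasurableSpace α} {μ : Measure α} {f : α → ℝ}
    (hf : AllLp f μ) : MemLp f 2 μ := by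
  exact_mod_cast hf 2

theorem exists_forall_abs_le {f : ℕ → Torus → ℝ} (hf : ∀ j, Continuous (f j)) (d : ℕ) :
    ∃ G, 0 ≤ G ∧ ∀ j ≤ d, ∀ x, |f j x| ≤ G := by
  have h : ∀ j, ∃ G, ∀ x, |f j x| ≤ G := by
    intro j
    obtain ⟨G, hG⟩ := (isCompact_range (hf j).abs).bddAbove
    exact ⟨G, fun x => hG ⟨x, rfl⟩⟩
  choose G hG using h
  refine ⟨∑ j ∈ Finset.range (d + 1), |G j|, Finset.sum_nonneg fun j _ => abs_nonneg _, ?_⟩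
  intro j hj x
  exact ((hG j x).trans (le_abs_self _)).trans (Finset.single_le_sum (f := fun j => |G j|)
    (fun j _ => abs_nonneg _) (Finset.mem_range.2 (by omega)))

/-- The interactions `∑ j, ∫ f j :Φ ^ j: dx` of the truncations of a Gaussian field converge in
`L²`; the limit does not change when the coefficients `f j` are approximated uniformly. -/
theorem exists_wickSum_limit {B : ℝ} {s : Freq → ℝ}
    (hs : ∀ n, s n ^ 2 ≤ B * bracket n ^ (-2 : ℝ)) (hneg : ∀ n, s (-n) = s n) (d : ℕ)
    {f : ℕ → Torus → ℝ} (hf : ∀ j, Continuous (f j)) (hf0 : ∀ j, d < j → ∀ x, f j x = 0) :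
    ∃ W : Noise → ℝ, MemLp W 2 noiseLaw ∧ ∀ (K : ℕ → ℕ) (F : ℕ → ℕ → Torus → ℝ),
      Tendsto K atTop atTop → (∀ i j, Continuous (F i j)) →
      (∀ j, TendstoUniformly (fun i => F i j) (f j) atTop) →
      Tendsto (fun i => eLpNorm (fun g => wickSum volume d (F i) (freqBox (K i)) s g - W g) 2
        noiseLaw) atTop (𝓝 0) := by
  have hB : 0 ≤ B := by
    have := (sq_nonneg _).trans (hs 0)
    simpa [bracket] using this
  obtain ⟨G, hG0, hG⟩ := exists_forall_abs_le hf d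
  have hG' : ∀ j x, |f j x| ≤ G := by
    intro j x
    rcases le_or_gt j d with h | h
    · exact hG j h x
    · rw [hf0 j h, abs_zero]; exact hG0
  have hD := FieldData.of_volume hs hneg
  have hM : ∀ K, MemLp (wickSum volume d f (freqBox K) s) 2 noiseLaw := fun K =>
    (allLp_wickSum (hD K) d hf).memLp_two
  obtain ⟨C, hC0, hC⟩ := exists_integral_wickSum_sub_pow_le hB G d
  have hdist : ∀ K L : ℕ, K ≤ L → 0 < K → eLpNorm (wickSum volume d f (freqBox L) s -
      wickSum volume d f (freqBox K) s) 2 noiseLaw ≤ ENNReal.ofReal √(C / √K) := by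
    intro K L hKL hK
    refine eLpNorm_two_le ((hM L).sub (hM K)) ?_
    have h := hC volume Set.univ (L + 1) (freqBox L) s f K 0 (hD L) hf hG' hK
    rw [Finset.inter_eq_right.2 (freqBox_mono hKL)] at h
    simpa using h
  have hb : Tendsto (fun K : ℕ => √(C / √((K + 1 : ℕ) : ℝ))) atTop (𝓝 0) := by
    have h1 : Tendsto (fun K : ℕ => √((K + 1 : ℕ) : ℝ)) atTop atTop :=
      (Real.tendsto_sqrt_atTop.comp tendsto_natCast_atTop_atTop).comp (tendsto_add_atTop_nat 1)
    have h2 := (h1.const_div_atTop C).sqrt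
    rwa [Real.sqrt_zero] at h2
  set u : ℕ → Lp ℝ 2 noiseLaw := fun K => (hM (K + 1)).toLp with hu
  have hcau : CauchySeq u := by
    refine cauchySeq_of_le_tendsto_0' _ (fun n m hnm => ?_) hb
    rw [dist_comm, ← ENNReal.ofReal_le_ofReal_iff (Real.sqrt_nonneg _), ← edist_dist, hu,
      Lp.edist_toLp_toLp]
    exact hdist (n + 1) (m + 1) (by omega) (by omega)
  obtain ⟨W, hW⟩ := cauchySeq_tendsto_of_complete hcau
  have hWm : MemLp W 2 noiseLaw := Lp.memLp W
  have hconv : Tendsto (fun K => eLpNorm (wickSum volume d f (freqBox K) s - ⇑W) 2 noiseLaw)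
      atTop (𝓝 0) := by
    rw [← tendsto_add_atTop_iff_nat 1]
    have h1 := tendsto_iff_edist_tendsto_0.1 hW
    refine h1.congr fun K => ?_
    rw [Lp.edist_def]
    exact eLpNorm_congr_ae ((hM (K + 1)).coeFn_toLp.sub (EventuallyEq.refl _ _))
  refine ⟨W, hWm, ?_⟩
  intro K F hK hF hFf
  obtain ⟨C', hC'0, hC'⟩ := exists_integral_wickSum_sq_le hB d
  refine ENNReal.tendsto_nhds_zero.2 fun ε hε => ?_
  obtain ⟨ε', hε'0, hε'⟩ : ∃ ε' : ℝ, 0 < ε' ∧ ENNReal.ofReal √(C' * ε' ^ 2) ≤ ε / 2 := by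
    rcases eq_or_ne ε ⊤ with rfl | hεt
    · exact ⟨1, one_pos, by rw [ENNReal.top_div_of_ne_top (by norm_num)]; exact le_top⟩
    have he : 0 < ε.toReal := ENNReal.toReal_pos hε.ne' hεt
    refine ⟨ε.toReal / 2 / (√C' + 1), by positivity, ?_⟩
    rw [Real.sqrt_mul hC'0, Real.sqrt_sq (by positivity)]
    refine ENNReal.ofReal_le_of_le_toReal ?_
    rw [ENNReal.toReal_div, ENNReal.toReal_ofNat]
    have h1 := Real.sqrt_nonneg C'
    rw [mul_div_assoc', div_le_iff₀ (by positivity)]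
    nlinarith
  have h1 : ∀ᶠ i in atTop, ∀ j ≤ d, ∀ x, |F i j x - f j x| ≤ ε' := by
    have : ∀ j ∈ Finset.range (d + 1), ∀ᶠ i in atTop, ∀ x, |F i j x - f j x| ≤ ε' := by
      intro j _
      filter_upwards [Metric.tendstoUniformly_iff.1 (hFf j) ε' hε'0] with i hi x
      have := (hi x).le
      rwa [dist_comm, Real.dist_eq] at this
    filter_upwards [(Finset.eventually_all _).2 this] with i hi j hj x
    exact hi j (Finset.mem_range.2 (by omega)) x
  have h2 := (ENNReal.tendsto_nhds_zero.1 (hconv.comp hK)) (ε / 2) (ENNReal.half_pos hε.ne')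
  filter_upwards [h1, h2] with i hi1 hi2
  have hFm : ∀ j, Continuous fun x => F i j x - f j x := fun j => (hF i j).sub (hf j)
  have e : (fun g => wickSum volume d (F i) (freqBox (K i)) s g - W g) =
      wickSum volume d (fun j x => F i j x - f j x) (freqBox (K i)) s +
      (wickSum volume d f (freqBox (K i)) s - ⇑W) := by
    funext g
    rw [Pi.add_apply, Pi.sub_apply, ← wickSum_sub d (hF i) hf]
    ring
  rw [e]
  refine (eLpNorm_add_le (allLp_wickSum (hD _) d hFm).memLp_two.1 ((hM _).sub hWm).1
    (by norm_num)).trans ?_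
  rw [← ENNReal.add_halves ε]
  refine add_le_add (le_trans ?_ hε') hi2
  exact eLpNorm_two_le (allLp_wickSum (hD _) d hFm).memLp_two
    (hC' volume Set.univ _ _ s _ ε' (hD (K i)) hFm hi1)

/-- If `exp ∘ (-V)` has bounded integral along a sequence converging to `V` in `L²`, then it is
integrable in the limit. -/
theorem integrable_exp_neg_of_tendsto {α : Type*} {mα : MeasurableSpace α} {μ : Measure α}
    {u : ℕ → α → ℝ} {V : α → ℝ} (hu : ∀ i, AEStronglyMeasurable (u i) μ)
    (hV : AEStronglyMeasurable V μ) (h : Tendsto (fun i => eLpNorm (fun g => u i g - V g) 2 μ)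
      atTop (𝓝 0)) {M : ℝ}
    (hM : ∀ i, ∫⁻ g, ENNReal.ofReal (Real.exp (-u i g)) ∂μ ≤ ENNReal.ofReal M) :
    Integrable (fun g => Real.exp (-V g)) μ := by
  obtain ⟨ns, -, hns⟩ :=
    (tendstoInMeasure_of_tendsto_eLpNorm (by norm_num) hu hV h).exists_seq_tendsto_ae
  refine ⟨Real.continuous_exp.comp_aestronglyMeasurable hV.neg, ?_⟩
  rw [hasFiniteIntegral_iff_ofReal (ae_of_all _ fun g => (Real.exp_pos _).le)]
  have hcont : Continuous fun v : ℝ => ENNReal.ofReal (Real.exp (-v)) :=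
    ENNReal.continuous_ofReal.comp (by fun_prop)
  calc ∫⁻ g, ENNReal.ofReal (Real.exp (-V g)) ∂μ
      ≤ ∫⁻ g, liminf (fun i => ENNReal.ofReal (Real.exp (-u (ns i) g))) atTop ∂μ := by
        refine lintegral_mono_ae ?_
        filter_upwards [hns] with g hg
        exact (((hcont.tendsto _).comp hg).liminf_eq).ge
    _ ≤ liminf (fun i => ∫⁻ g, ENNReal.ofReal (Real.exp (-u (ns i) g)) ∂μ) atTop :=
        lintegral_liminf_le' fun i =>
          hcont.measurable.comp_aemeasurable (hu _).aemeasurable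
    _ ≤ ENNReal.ofReal M := by
        refine liminf_le_of_frequently_le' (Frequently.of_forall fun i => hM _)
    _ < ⊤ := ENNReal.ofReal_lt_top

/-! ### The shifted interaction -/

/-- The coefficients of the Wick powers of `y` in the Wick ordered polynomial of `φ + y`, where `c`
is the difference of the variances used for the Wick ordering. -/
noncomputable def shiftCoeff (P : Polynomial ℝ) (c : ℝ) (φ : Torus → ℝ) (j : ℕ) (x : Torus) : ℝ :=
  ∑ k ∈ Finset.range (P.natDegree + 1), P.coeff k * ((k.choose j : ℝ) * wick c (k - j) (φ x))

theorem continuous_shiftCoeff (P : Polynomial ℝ) (c : ℝ) {φ : Torus → ℝ} (hφ : Continuous φ)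
    (j : ℕ) : Continuous (shiftCoeff P c φ j) := by
  unfold shiftCoeff
  have := continuous_wick c
  fun_prop

theorem shiftCoeff_eq_zero (P : Polynomial ℝ) (c : ℝ) (φ : Torus → ℝ) {j : ℕ}
    (hj : P.natDegree < j) (x : Torus) : shiftCoeff P c φ j x = 0 := by
  refine Finset.sum_eq_zero fun k hk => ?_
  rw [Nat.choose_eq_zero_of_lt (by rw [Finset.mem_range] at hk; omega)]
  simp

theorem sum_coeff_wick_add (P : Polynomial ℝ) (c c' : ℝ) (φ : Torus → ℝ) (x : Torus) (y : ℝ) :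
    ∑ k ∈ Finset.range (P.natDegree + 1), P.coeff k * wick (c + c') k (φ x + y) =
      ∑ j ∈ Finset.range (P.natDegree + 1), shiftCoeff P c φ j x * wick c' j y := by
  simp only [shiftCoeff, Finset.sum_mul]
  rw [Finset.sum_comm]
  refine Finset.sum_congr rfl fun k hk => ?_
  rw [wick_add, Finset.mul_sum]
  rw [Finset.mem_range] at hk
  rw [← Finset.sum_subset (Finset.range_mono (show k + 1 ≤ P.natDegree + 1 by omega))]
  · exact Finset.sum_congr rfl fun j _ => by ring
  · intro j _ hj
    rw [Nat.choose_eq_zero_of_lt (by rw [Finset.mem_range] at hj; omega)]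
    simp

/-- The coefficients depend continuously on the variance and the shift. -/
theorem tendstoUniformly_shiftCoeff (P : Polynomial ℝ) {c : ℕ → ℝ} {c₀ : ℝ}
    (hc : Tendsto c atTop (𝓝 c₀)) {φ : ℕ → Torus → ℝ} {φ₀ : Torus → ℝ} (hφ₀ : Continuous φ₀)
    (hφ : TendstoUniformly φ φ₀ atTop) (j : ℕ) :
    TendstoUniformly (fun i => shiftCoeff P (c i) (φ i) j) (shiftCoeff P c₀ φ₀ j) atTop := by
  obtain ⟨R, hR⟩ := (isCompact_range hφ₀).isBounded.exists_norm_le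
  -- near the limit, everything takes values in a compact set
  set Q : Set (ℝ × ℝ) := Metric.closedBall c₀ 1 ×ˢ Metric.closedBall 0 (R + 1) with hQ
  have hQc : IsCompact Q := (isCompact_closedBall _ _).prod (isCompact_closedBall _ _)
  have hcont : Continuous fun p : ℝ × ℝ => ∑ k ∈ Finset.range (P.natDegree + 1),
      P.coeff k * ((k.choose j : ℝ) * wick p.1 (k - j) p.2) := by
    have := continuous_wick_uncurry
    fun_prop
  have hu := hQc.uniformContinuousOn_of_continuous hcont.continuousOn
  rw [Metric.uniformContinuousOn_iff] at hu
  rw [Metric.tendstoUniformly_iff]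
  intro ε hε
  obtain ⟨δ, hδ, hu⟩ := hu ε hε
  filter_upwards [Metric.tendstoUniformly_iff.1 hφ (min δ 1) (by positivity),
    (Metric.tendsto_nhds.1 hc) (min δ 1) (by positivity)] with i hi1 hi2 x
  have h1 : ‖φ₀ x‖ ≤ R := hR _ ⟨x, rfl⟩
  have h2 := hi1 x
  refine hu (c₀, φ₀ x) ?_ (c i, φ i x) ?_ ?_
  · refine ⟨Metric.mem_closedBall_self zero_le_one, ?_⟩
    rw [mem_closedBall_zero_iff]; linarith
  · refine ⟨(hi2.trans_le (min_le_right _ _)).le, ?_⟩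
    rw [mem_closedBall_zero_iff]
    have h3 : ‖φ i x‖ ≤ ‖φ₀ x‖ + ‖φ₀ x - φ i x‖ := by
      have := norm_sub_le (φ₀ x) (φ₀ x - φ i x)
      simpa using this
    rw [dist_eq_norm] at h2
    have := h2.trans_le (min_le_right δ 1)
    linarith
  · rw [Prod.dist_eq, max_lt_iff]
    exact ⟨by rw [dist_comm]; exact hi2.trans_le (min_le_left _ _), h2.trans_le (min_le_left _ _)⟩

/-- The lower bound for the shifted Wick polynomial. -/
theorem shiftCoeff_lower_bound {P : Polynomial ℝ} {D : ℝ} (hD0 : 0 ≤ D) {E : ℕ}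
    (hD : ∀ c y : ℝ, 0 ≤ c → -(D * (1 + c) ^ E) ≤
      ∑ k ∈ Finset.range (P.natDegree + 1), P.coeff k * wick c k y) {c₀ c₁ : ℝ} (hc₀ : 0 ≤ c₀)
    (hc₁ : c₀ ≤ c₁) (φ : Torus → ℝ) (x : Torus) (c y : ℝ) (hc : 0 ≤ c) :
    -(D * (1 + c₁) ^ E * (1 + c) ^ E) ≤
      ∑ j ∈ Finset.range (P.natDegree + 1), shiftCoeff P c₀ φ j x * wick c j y := by
  rw [← sum_coeff_wick_add]
  refine le_trans ?_ (hD (c₀ + c) (φ x + y) (by positivity))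
  rw [neg_le_neg_iff, mul_assoc, ← mul_pow]
  have : 1 + (c₀ + c) ≤ (1 + c₁) * (1 + c) := by nlinarith [mul_nonneg (hc₀.trans hc₁) hc]
  gcongr

/-! ### Existence and integrability of the continuum interaction -/

/-- The square roots of the multipliers of `(-Δ + M)⁻¹`. -/
noncomputable def covRoot (M : ℝ) (n : Freq) : ℝ := √(covMultiplier M n)

theorem covRoot_sq {M : ℝ} (hM : 0 < M) (n : Freq) : covRoot M n ^ 2 = covMultiplier M n :=
  Real.sq_sqrt (covMultiplier_pos hM n).le

theorem covMultiplier_neg (M : ℝ) (n : Freq) : covMultiplier M (-n) = covMultiplier M n := by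
  simp [covMultiplier]

theorem covRoot_neg (M : ℝ) (n : Freq) : covRoot M (-n) = covRoot M n := by
  rw [covRoot, covRoot, covMultiplier_neg]

theorem covRoot_sq_le {M : ℝ} (hM : 0 < M) (n : Freq) :
    covRoot M n ^ 2 ≤ (2 / M + 2) * bracket n ^ (-2 : ℝ) := by
  rw [covRoot_sq hM]
  exact covMultiplier_le hM n

/-- The difference of the variances of the truncated fields with masses squared `m ^ 2` and `M`. -/
noncomputable def varDiff (m M : ℝ) (K : ℕ) : ℝ :=
  ∑ n ∈ freqBox K, (covMultiplier (m ^ 2) n - covMultiplier M n)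

theorem abs_covMultiplier_sub_le {M M' : ℝ} (hM : 0 < M) (hM' : 0 < M') (n : Freq) :
    |covMultiplier M n - covMultiplier M' n| ≤
      |M' - M| * ((2 / M + 2) * (2 / M' + 2)) * bracket n ^ (-4 : ℝ) := by
  have h1 := covMultiplier_le hM n
  have h2 := covMultiplier_le hM' n
  have h1' := covMultiplier_pos hM n
  have h2' := covMultiplier_pos hM' n
  have e : covMultiplier M n - covMultiplier M' n =
      (M' - M) * (covMultiplier M n * covMultiplier M' n) := by
    have h0 : 0 ≤ ∑ i, (n i : ℝ) ^ 2 := Finset.sum_nonneg fun i _ => sq_nonneg _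
    rw [covMultiplier, covMultiplier]
    field_simp
    ring
  rw [e, abs_mul, abs_of_pos (mul_pos h1' h2'), mul_assoc]
  refine mul_le_mul_of_nonneg_left ?_ (abs_nonneg _)
  refine (mul_le_mul h1 h2 h2'.le (h1'.le.trans h1)).trans (le_of_eq ?_)
  rw [show (-4 : ℝ) = -2 + -2 by norm_num, Real.rpow_add (bracket_pos n)]
  ring

theorem tendsto_freqBox : Tendsto freqBox atTop atTop := by
  refine tendsto_atTop_finset_of_monotone (fun K L h => freqBox_mono h) fun n => ?_
  obtain ⟨K, hK⟩ := exists_nat_ge ‖n‖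
  exact ⟨K, mem_freqBox.2 hK⟩

theorem exists_tendsto_varDiff {m M : ℝ} (hm : 0 < m) (hM : m ^ 2 ≤ M) :
    ∃ c, Tendsto (varDiff m M) atTop (𝓝 c) ∧ ∀ K, 0 ≤ varDiff m M K ∧ varDiff m M K ≤ c := by
  have hm2 : 0 < m ^ 2 := by positivity
  have hs : Summable fun n => covMultiplier (m ^ 2) n - covMultiplier M n := by
    exact Summable.of_norm_bounded
      ((summable_bracket_rpow (k := 4) (by norm_num)).mul_left _)
      (abs_covMultiplier_sub_le hm2 (hm2.trans_le hM))
  have h0 : ∀ n, 0 ≤ covMultiplier (m ^ 2) n - covMultiplier M n := fun n =>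
    sub_nonneg.2 (covMultiplier_anti hm2 hM n)
  exact ⟨_, hs.hasSum.comp tendsto_freqBox, fun K => ⟨Finset.sum_nonneg fun n _ => h0 n,
    hs.sum_le_tsum _ fun n _ => h0 n⟩⟩

theorem truncVariance_pos {m : ℝ} (hm : 0 < m) (K : ℕ) : 0 < truncVariance m K :=
  Finset.sum_pos (fun n _ => covMultiplier_pos (by positivity) n) ⟨0, mem_freqBox.2 (by simp)⟩

/-- A Wick ordered polynomial of `φ + Φ`, ordered with respect to the variance `c + Var Φ`. -/
theorem integral_wickPoly_eq_wickSum {ν : Measure Torus} [IsFiniteMeasure ν] (P : Polynomial ℝ)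
    {c c' : ℝ} {S : Finset Freq} {s : Freq → ℝ} (hc : c' + ∑ n ∈ S, s n ^ 2 = c) (hc0 : 0 < c)
    {φ : Torus → ℝ} (hφ : Continuous φ) (g : Noise) :
    ∫ x, wickPoly P c (φ x + finField S s g x) ∂ν =
      wickSum ν P.natDegree (shiftCoeff P c' φ) S s g := by
  have h1 := continuous_wick (∑ n ∈ S, s n ^ 2)
  have h2 := continuous_shiftCoeff P c' hφ
  rw [wickSum, ← integral_finsetSum]
  · congr 1
    funext x
    simp only [wickPoly, wickPow_eq_wick hc0]
    rw [← sum_coeff_wick_add, hc]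
  · intro j _
    refine integrable_of_continuous ?_
    unfold finField
    fun_prop

theorem truncInteraction_eq_wickSum {m M : ℝ} (hm : 0 < m) (hM : 0 < M) (P : Polynomial ℝ)
    (φ : C(Torus, ℝ)) (K : ℕ) (g : Noise) :
    truncInteraction m P M φ K g =
      wickSum volume P.natDegree (shiftCoeff P (varDiff m M K) φ) (freqBox K) (covRoot M) g := by
  refine integral_wickPoly_eq_wickSum (s := covRoot M) P ?_ (truncVariance_pos hm K) φ.continuous g
  simp only [covRoot_sq hM, varDiff, truncVariance, Finset.sum_sub_distrib]
  ring

/-- The limiting shift coefficients characterise the continuum interaction. -/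
theorem exists_isInteraction {m M : ℝ} (hm : 0 < m) (hM : m ^ 2 ≤ M) (P : Polynomial ℝ)
    {c : ℝ} (hc : Tendsto (varDiff m M) atTop (𝓝 c)) (φ : C(Torus, ℝ)) :
    ∃ V, IsInteraction m P M φ V ∧ ∀ (K : ℕ → ℕ) (F : ℕ → ℕ → Torus → ℝ),
      Tendsto K atTop atTop → (∀ i j, Continuous (F i j)) →
      (∀ j, TendstoUniformly (fun i => F i j) (shiftCoeff P c φ j) atTop) →
      Tendsto (fun i => eLpNorm (fun g => wickSum volume P.natDegree (F i) (freqBox (K i))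
        (covRoot M) g - V g) 2 noiseLaw) atTop (𝓝 0) := by
  have hM0 : 0 < M := (by positivity : 0 < m ^ 2).trans_le hM
  obtain ⟨W, hW, hlim⟩ := exists_wickSum_limit (covRoot_sq_le hM0) (covRoot_neg M) P.natDegree
    (continuous_shiftCoeff P c φ.continuous) (fun j hj => shiftCoeff_eq_zero P c φ hj)
  refine ⟨W, ⟨hW, ?_⟩, hlim⟩
  have := hlim (fun K => K) (fun K => shiftCoeff P (varDiff m M K) φ) tendsto_id
    (fun i => continuous_shiftCoeff P _ φ.continuous)
    (tendstoUniformly_shiftCoeff P hc φ.continuous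
      (Metric.tendstoUniformly_iff.2 fun ε hε => Eventually.of_forall fun i x => by simpa))
  refine this.congr fun K => ?_
  simp only [truncInteraction_eq_wickSum hm hM0]

theorem isInteraction_interaction {m M : ℝ} (hm : 0 < m) (hM : m ^ 2 ≤ M) (P : Polynomial ℝ)
    (φ : C(Torus, ℝ)) : IsInteraction m P M φ (interaction m P M φ) := by
  obtain ⟨c, hc, -⟩ := exists_tendsto_varDiff hm hM
  obtain ⟨V, hV, -⟩ := exists_isInteraction hm hM P hc φ
  exact Classical.epsilon_spec ⟨V, hV⟩

theorem ae_eq_of_tendsto_eLpNorm {α : Type*} {mα : MeasurableSpace α} {μ : Measure α}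
    {u : ℕ → α → ℝ} {V V' : α → ℝ} (hu : ∀ i, AEStronglyMeasurable (u i) μ)
    (hV : AEStronglyMeasurable V μ) (hV' : AEStronglyMeasurable V' μ)
    (h : Tendsto (fun i => eLpNorm (fun g => u i g - V g) 2 μ) atTop (𝓝 0))
    (h' : Tendsto (fun i => eLpNorm (fun g => u i g - V' g) 2 μ) atTop (𝓝 0)) : V =ᵐ[μ] V' :=
  tendstoInMeasure_ae_unique (tendstoInMeasure_of_tendsto_eLpNorm (by norm_num) hu hV h)
    (tendstoInMeasure_of_tendsto_eLpNorm (by norm_num) hu hV' h')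

theorem integrable_exp_neg_interaction {m M : ℝ} (hm : 0 < m) (hM : m ^ 2 ≤ M) (P : Polynomial ℝ)
    (hdeg : Even P.natDegree) (hpos : 0 < P.natDegree) (hlead : 0 < P.leadingCoeff)
    (φ : C(Torus, ℝ)) : Integrable (fun g => Real.exp (-interaction m P M φ g)) noiseLaw := by
  have hM0 : 0 < M := (by positivity : 0 < m ^ 2).trans_le hM
  obtain ⟨c, hc, hc1⟩ := exists_tendsto_varDiff hm hM
  have hc0 : 0 ≤ c := (hc1 0).1.trans (hc1 0).2
  obtain ⟨V, hV, hlim⟩ := exists_isInteraction hm hM P hc φ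
  have hI := isInteraction_interaction hm hM P φ
  have hB : 0 ≤ 2 / M + 2 := by positivity
  have hD := FieldData.of_volume (covRoot_sq_le hM0) (covRoot_neg M)
  have hcont := continuous_shiftCoeff P c φ.continuous
  obtain ⟨G, hG0, hG⟩ := exists_forall_abs_le hcont P.natDegree
  obtain ⟨D, E, hD0, hlow⟩ := exists_wick_lower_bound P hdeg hpos hlead
  obtain ⟨C, hC0, hC⟩ := exists_lintegral_exp_wickSum_le hB G P.natDegree (D * (1 + c) ^ E)
    (by positivity) E
  have hm1 : ∀ K, AEStronglyMeasurable (truncInteraction m P M φ K) noiseLaw := by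
    intro K
    rw [funext (truncInteraction_eq_wickSum hm hM0 P φ K)]
    exact (allLp_wickSum (hD K) _ (continuous_shiftCoeff P _ φ.continuous)).memLp_two.1
  have hae : interaction m P M φ =ᵐ[noiseLaw] V :=
    ae_eq_of_tendsto_eLpNorm hm1 hI.1.1 hV.1.1 hI.2 hV.2
  have hint : Integrable (fun g => Real.exp (-V g)) noiseLaw := by
    refine integrable_exp_neg_of_tendsto (u := fun K => wickSum volume P.natDegree
      (shiftCoeff P c φ) (freqBox K) (covRoot M)) (M := C)
      (fun K => (allLp_wickSum (hD K) _ hcont).memLp_two.1) hV.1.1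
      (hlim (fun K => K) (fun _ => shiftCoeff P c φ) tendsto_id (fun _ => hcont) fun j =>
        Metric.tendstoUniformly_iff.2 fun ε hε => Eventually.of_forall fun i x => by simpa) ?_
    intro K
    refine hC volume Set.univ _ _ _ _ (hD K) hcont ?_ ?_
    · intro j x
      rcases le_or_gt j P.natDegree with h | h
      · exact hG j h x
      · rw [shiftCoeff_eq_zero P c φ h, abs_zero]; exact hG0
    · intro x _ c' y hc'
      exact shiftCoeff_lower_bound hD0 hlow hc0 le_rfl φ x c' y hc'
  refine hint.congr ?_
  filter_upwards [hae] with g hg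
  rw [hg]

/-! ### Sup norms of random trigonometric polynomials -/

section Nikolskii

open UnitAddTorus

theorem integral_mFourier (k : Freq) : ∫ x : Torus, mFourier k x = if k = 0 then 1 else 0 := by
  split_ifs with h
  · subst h
    simp [mFourier_zero]
  · exact integral_mFourier_eq_zero h

/-- The trigonometric polynomials with frequencies in the box of size `L`, characterised by their
Fourier expansion. -/
def TrigPoly (L : ℕ) (h : Torus → ℂ) : Prop :=
  Continuous h ∧ ∀ x, h x = ∑ l ∈ freqBox L, mFourier l x * ∫ y, h y * mFourier (-l) y

theorem TrigPoly.mFourier {L : ℕ} {k : Freq} (hk : k ∈ freqBox L) :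
    TrigPoly L (UnitAddTorus.mFourier k) := by
  refine ⟨by fun_prop, fun x => ?_⟩
  simp only [← mFourier_add, integral_mFourier, ← sub_eq_add_neg, sub_eq_zero]
  simp [hk]

theorem TrigPoly.smul {L : ℕ} {h : Torus → ℂ} (hh : TrigPoly L h) (c : ℂ) :
    TrigPoly L fun x => c * h x := by
  refine ⟨hh.1.const_mul c, fun x => ?_⟩
  dsimp only
  rw [hh.2 x, Finset.mul_sum]
  refine Finset.sum_congr rfl fun l _ => ?_
  simp only [mul_assoc, integral_const_mul]
  ring

theorem TrigPoly.sum {L : ℕ} {ι : Type*} (S : Finset ι) {h : ι → Torus → ℂ}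
    (hh : ∀ i ∈ S, TrigPoly L (h i)) : TrigPoly L fun x => ∑ i ∈ S, h i x := by
  refine ⟨continuous_finsetSum _ fun i hi => (hh i hi).1, fun x => ?_⟩
  dsimp only
  rw [Finset.sum_congr rfl fun i hi => (hh i hi).2 x, Finset.sum_comm]
  refine Finset.sum_congr rfl fun l _ => ?_
  rw [← Finset.mul_sum, ← integral_finsetSum]
  · simp only [Finset.sum_mul]
  · intro i hi
    have := (hh i hi).1
    exact integrable_of_continuous (by fun_prop)

theorem card_freqBox (L : ℕ) : (freqBox L).card = (2 * L + 1) ^ 2 := by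
  rw [freqBox, Fintype.card_piFinset]
  simp only [Int.card_Icc, Finset.prod_const, Finset.card_univ, Fintype.card_fin]
  congr 1
  omega

/-- The sup norm of a trigonometric polynomial is controlled by its `L²` norm. -/
theorem TrigPoly.norm_sq_le {L : ℕ} {h : Torus → ℂ} (hh : TrigPoly L h) (x : Torus) :
    ‖h x‖ ^ 2 ≤ (2 * L + 1) ^ 2 * ∫ y, ‖h y‖ ^ 2 := by
  set c : Freq → ℂ := fun l => ∫ y, h y * UnitAddTorus.mFourier (-l) y with hc
  have hcont := hh.1
  have h1 : ‖h x‖ ^ 2 ≤ (2 * L + 1) ^ 2 * ∑ l ∈ freqBox L, ‖c l‖ ^ 2 := by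
    have h2 : ‖h x‖ ≤ ∑ l ∈ freqBox L, ‖c l‖ := by
      rw [hh.2 x]
      refine (norm_sum_le _ _).trans (Finset.sum_le_sum fun l _ => ?_)
      rw [norm_mul]
      refine mul_le_of_le_one_left (norm_nonneg _) ?_
      exact ((UnitAddTorus.mFourier l).norm_coe_le_norm x).trans mFourier_norm.le
    have h3 := sq_sum_le_card_mul_sum_sq (s := freqBox L) (f := fun l => ‖c l‖)
    rw [card_freqBox] at h3
    push_cast at h3
    exact (pow_le_pow_left₀ (norm_nonneg _) h2 2).trans h3
  have h2 : ((∑ l ∈ freqBox L, ‖c l‖ ^ 2 : ℝ) : ℂ) = ((∫ y, ‖h y‖ ^ 2 : ℝ) : ℂ) := by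
    have e : ∀ y, ((‖h y‖ ^ 2 : ℝ) : ℂ) =
        ∑ l ∈ freqBox L, c l * starRingEnd ℂ (h y * UnitAddTorus.mFourier (-l) y) := by
      intro y
      rw [← Complex.normSq_eq_norm_sq, Complex.normSq_eq_conj_mul_self]
      nth_rewrite 2 [hh.2 y]
      rw [Finset.mul_sum]
      refine Finset.sum_congr rfl fun l _ => ?_
      rw [map_mul, mFourier_neg, Complex.conj_conj]
      ring
    rw [← integral_complex_ofReal]
    simp only [e]
    rw [integral_finsetSum _ fun l _ => integrable_of_continuous (by fun_prop)]
    push_cast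
    refine Finset.sum_congr rfl fun l _ => ?_
    rw [integral_const_mul, integral_conj, Complex.mul_conj, Complex.normSq_eq_norm_sq]
    push_cast; rfl
  rw [← Complex.ofReal_inj.1 h2]
  exact h1

theorem hartley_eq (n : Freq) (x : Torus) : (hartley n x : ℂ) =
    (1 - Complex.I) / 2 * mFourier n x + (1 + Complex.I) / 2 * mFourier (-n) x := by
  rw [mFourier_neg, hartley]
  apply Complex.ext <;> simp <;> ring

theorem trigPoly_hartley_mul {K : ℕ} {n k : Freq} (hn : n ∈ freqBox K) (hk : k ∈ freqBox K) :
    TrigPoly (2 * K) fun x => ((hartley n x * hartley k x : ℝ) : ℂ) := by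
  have hmem : ∀ a ∈ freqBox K, ∀ b ∈ freqBox K, a + b ∈ freqBox (2 * K) := by
    intro a ha b hb
    rw [mem_freqBox] at ha hb ⊢
    push_cast
    linarith [norm_add_le a b]
  have e : (fun x => ((hartley n x * hartley k x : ℝ) : ℂ)) = fun x =>
      ∑ i : Fin 2 × Fin 2, ((if i.1 = 0 then (1 - Complex.I) / 2 else (1 + Complex.I) / 2) *
        (if i.2 = 0 then (1 - Complex.I) / 2 else (1 + Complex.I) / 2)) *
        UnitAddTorus.mFourier ((if i.1 = 0 then n else -n) + (if i.2 = 0 then k else -k)) x := by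
    funext x
    push_cast
    rw [hartley_eq, hartley_eq, Fintype.sum_prod_type]
    simp only [Fin.sum_univ_two, mFourier_add]
    simp
    ring
  rw [e]
  refine TrigPoly.sum _ fun i _ => (TrigPoly.mFourier (hmem _ ?_ _ ?_)).smul _
  · split_ifs
    exacts [hn, neg_mem_freqBox hn]
  · split_ifs
    exacts [hk, neg_mem_freqBox hk]

/-- Nikolskii's inequality in `L⁴`, obtained from the `L²` inequality for the square. -/
theorem finField_pow_four_le {K : ℕ} {S : Finset Freq} (hS : S ⊆ freqBox K) (s : Freq → ℝ)
    (g : Noise) (x : Torus) :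
    finField S s g x ^ 4 ≤ (4 * K + 1) ^ 2 * ∫ y, finField S s g y ^ 4 := by
  have e : ∀ x, ((finField S s g x ^ 2 : ℝ) : ℂ) = ∑ p ∈ S ×ˢ S,
      ((s p.1 * g p.1 * (s p.2 * g p.2) : ℝ) : ℂ) * ((hartley p.1 x * hartley p.2 x : ℝ) : ℂ) := by
    intro x
    rw [finField, sq, Finset.sum_mul_sum, ← Finset.sum_product']
    push_cast
    exact Finset.sum_congr rfl fun p _ => by ring
  have ht : TrigPoly (2 * K) fun x => ((finField S s g x ^ 2 : ℝ) : ℂ) := by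
    simp only [e]
    refine TrigPoly.sum _ fun p hp => ?_
    rw [Finset.mem_product] at hp
    exact (trigPoly_hartley_mul (hS hp.1) (hS hp.2)).smul _
  have h := ht.norm_sq_le x
  simp only [Complex.norm_real, Real.norm_eq_abs, sq_abs, ← pow_mul] at h
  push_cast at h
  convert h using 3
  ring

end Nikolskii

theorem abs_hartley_le (n : Freq) (x : Torus) : |hartley n x| ≤ 2 := by
  have h := ((UnitAddTorus.mFourier n).norm_coe_le_norm x).trans UnitAddTorus.mFourier_norm.le
  have h1 := (Complex.abs_re_le_norm (UnitAddTorus.mFourier n x)).trans h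
  have h2 := (Complex.abs_im_le_norm (UnitAddTorus.mFourier n x)).trans h
  rw [hartley]
  exact (abs_add_le _ _).trans (by linarith)

/-- The fourth moment of the standard normal distribution. -/
noncomputable def fourthMoment : ℝ := ∫ y, y ^ 4 ∂stdNormal

theorem fourthMoment_nonneg : 0 ≤ fourthMoment := integral_nonneg fun y => by positivity

theorem allLp_finField (S : Finset Freq) (s : Freq → ℝ) (x : Torus) :
    AllLp (fun g => finField S s g x) noiseLaw := by
  have e : (fun g => finField S s g x) = fun g =>
      ∑ i : S, (s i * hartley i x) * restrictNoise S g i := by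
    funext g
    rw [finField, ← Finset.sum_coe_sort S]
    exact Finset.sum_congr rfl fun n _ => by rw [restrictNoise]; ring
  rw [e]
  exact AllLp.sum _ fun i _ => (allLp_const _).mul
    ((allLp_eval_gaussPi i).comp (measurePreserving_restrictNoise S))

theorem integral_finField_pow_four_le (S : Finset Freq) (s : Freq → ℝ) (x : Torus) :
    ∫ g, finField S s g x ^ 4 ∂noiseLaw ≤ 16 * fourthMoment * (∑ n ∈ S, s n ^ 2) ^ 2 := by
  have hm := measurePreserving_restrictNoise S
  set v : ℝ := ∑ i : S, (s i * hartley i x) ^ 2 with hv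
  have hv0 : 0 ≤ v := Finset.sum_nonneg fun i _ => sq_nonneg _
  have h1 : ∫ g, finField S s g x ^ 4 ∂noiseLaw = ∫ y, y ^ 4 ∂gaussianReal 0 v.toNNReal := by
    have hc : Continuous fun g : S → ℝ => ∑ i : S, s i * hartley i x * g i := by fun_prop
    rw [hv, ← map_sum_mul_gaussPi, integral_map hc.aemeasurable (by fun_prop), ← hm.map_eq,
      integral_map hm.aemeasurable (Continuous.aestronglyMeasurable (by fun_prop))]
    congr 1
    funext g
    rw [finField, ← Finset.sum_coe_sort S]
    congr 1
    exact Finset.sum_congr rfl fun n _ => by rw [restrictNoise]; ring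
  have h2 : ∫ y, y ^ 4 ∂gaussianReal 0 v.toNNReal = v ^ 2 * fourthMoment := by
    have h := gaussianReal_map_const_mul (μ := 0) (v := 1) (√v)
    have hv' : NNReal.mk (√v ^ 2) (sq_nonneg _) * 1 = v.toNNReal := by
      ext
      simp [Real.sq_sqrt hv0, Real.coe_toNNReal _ hv0]
    rw [mul_zero, hv'] at h
    rw [← h, integral_map (by fun_prop) (by fun_prop), fourthMoment, ← integral_const_mul]
    congr 1
    funext y
    rw [mul_pow, show √v ^ 4 = (√v ^ 2) ^ 2 by ring, Real.sq_sqrt hv0]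
  have h3 : v ≤ 4 * ∑ n ∈ S, s n ^ 2 := by
    rw [hv, ← Finset.sum_coe_sort S, Finset.mul_sum]
    refine Finset.sum_le_sum fun i _ => ?_
    have := abs_le.1 (abs_hartley_le i x)
    rw [mul_pow, mul_comm]
    exact mul_le_mul_of_nonneg_right (by nlinarith) (sq_nonneg _)
  rw [h1, h2]
  have h4 : v ^ 2 ≤ (4 * ∑ n ∈ S, s n ^ 2) ^ 2 := pow_le_pow_left₀ hv0 h3 2
  calc v ^ 2 * fourthMoment ≤ (4 * ∑ n ∈ S, s n ^ 2) ^ 2 * fourthMoment :=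
        mul_le_mul_of_nonneg_right h4 fourthMoment_nonneg
    _ = _ := by ring

/-- The Hartley functions as elements of `C(Ω)`. -/
noncomputable def hartleyMap (n : Freq) : C(Torus, ℝ) := ⟨hartley n, continuous_hartley n⟩

/-- The Gaussian field with coefficients `s n`, `n ∈ S`, as a random element of `C(Ω)`. -/
noncomputable def fieldMap (S : Finset Freq) (s : Freq → ℝ) (g : Noise) : C(Torus, ℝ) :=
  ∑ n ∈ S, (s n * g n) • hartleyMap n

theorem fieldMap_apply (S : Finset Freq) (s : Freq → ℝ) (g : Noise) (x : Torus) :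
    fieldMap S s g x = finField S s g x := by
  simp [fieldMap, finField, hartleyMap]

theorem continuous_fieldMap (S : Finset Freq) (s : Freq → ℝ) : Continuous (fieldMap S s) := by
  unfold fieldMap
  fun_prop

theorem continuous_finField_uncurry (S : Finset Freq) (s : Freq → ℝ) :
    Continuous fun p : Noise × Torus => finField S s p.1 p.2 := by
  unfold finField
  fun_prop

theorem norm_fieldMap_pow_four_le {K : ℕ} {S : Finset Freq} (hS : S ⊆ freqBox K) (s : Freq → ℝ)
    (g : Noise) : ‖fieldMap S s g‖ ^ 4 ≤ (4 * K + 1) ^ 2 * ∫ y, finField S s g y ^ 4 := by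
  obtain ⟨x, -, hx⟩ := isCompact_univ.exists_isMaxOn Set.univ_nonempty
    (fieldMap S s g).continuous.norm.continuousOn
  have h : ‖fieldMap S s g‖ ≤ ‖fieldMap S s g x‖ :=
    (ContinuousMap.norm_le _ (norm_nonneg _)).2 fun y => hx (Set.mem_univ y)
  refine (pow_le_pow_left₀ (norm_nonneg _) h 4).trans ?_
  rw [fieldMap_apply, Real.norm_eq_abs, Even.pow_abs (by decide)]
  exact finField_pow_four_le hS s g x

/-- The expected sup norm of a random trigonometric polynomial. -/
theorem lintegral_norm_fieldMap_pow_four_le {K : ℕ} {S : Finset Freq} (hS : S ⊆ freqBox K)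
    (s : Freq → ℝ) : ∫⁻ g, ‖fieldMap S s g‖ₑ ^ 4 ∂noiseLaw ≤
      ENNReal.ofReal ((4 * K + 1) ^ 2 * (16 * fourthMoment * (∑ n ∈ S, s n ^ 2) ^ 2)) := by
  have hc := continuous_finField_uncurry S s
  have hcx : ∀ g, Continuous fun y => finField S s g y := fun g => by unfold finField; fun_prop
  calc ∫⁻ g, ‖fieldMap S s g‖ₑ ^ 4 ∂noiseLaw
      ≤ ∫⁻ g, ENNReal.ofReal ((4 * K + 1) ^ 2) *
          (∫⁻ y : Torus, ENNReal.ofReal (finField S s g y ^ 4)) ∂noiseLaw := by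
        refine lintegral_mono fun g => ?_
        rw [← ofReal_integral_eq_lintegral_ofReal
          (integrable_of_continuous (by have := hcx g; fun_prop))
          (ae_of_all _ fun y => by positivity), ← ENNReal.ofReal_mul (by positivity),
          ← ofReal_norm, ← ENNReal.ofReal_pow (norm_nonneg _)]
        exact ENNReal.ofReal_le_ofReal (norm_fieldMap_pow_four_le hS s g)
    _ = ENNReal.ofReal ((4 * K + 1) ^ 2) *
          ∫⁻ y : Torus, ∫⁻ g, ENNReal.ofReal (finField S s g y ^ 4) ∂noiseLaw := by
        have hm : Measurable fun p : Noise × Torus => ENNReal.ofReal (finField S s p.1 p.2 ^ 4) :=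
          ENNReal.measurable_ofReal.comp (hc.measurable.pow_const 4)
        rw [lintegral_const_mul _ hm.lintegral_prod_right', lintegral_lintegral_swap
          hm.aemeasurable]
    _ ≤ ENNReal.ofReal ((4 * K + 1) ^ 2) *
          ∫⁻ _y : Torus, ENNReal.ofReal (16 * fourthMoment * (∑ n ∈ S, s n ^ 2) ^ 2) := by
        gcongr with y
        have h4 := (allLp_finField S s y).pow 4
        rw [← ofReal_integral_eq_lintegral_ofReal h4.integrable
          (ae_of_all _ fun g => by positivity)]
        exact ENNReal.ofReal_le_ofReal (integral_finField_pow_four_le S s y)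
    _ = _ := by
        rw [lintegral_const, measure_univ, mul_one, ← ENNReal.ofReal_mul (by positivity)]

/-! ### Continuous random series -/

theorem fieldMap_disjUnion {S T : Finset Freq} (h : Disjoint S T) (s : Freq → ℝ) (g : Noise) :
    fieldMap (S ∪ T) s g = fieldMap S s g + fieldMap T s g :=
  Finset.sum_union h

theorem exists_lintegral_norm_block_le (B : ℝ) : ∃ C, 0 ≤ C ∧
    ∀ (S : Finset Freq) (s : Freq → ℝ) (i : ℕ), (∀ n, s n ^ 2 ≤ B * bracket n ^ (-4 : ℝ)) →
      ∫⁻ g, ‖fieldMap (S ∩ (freqBox (2 ^ (i + 1)) \ freqBox (2 ^ i))) s g‖ₑ ∂noiseLaw ≤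
        ENNReal.ofReal (C * √(1 / 2) ^ i) := by
  have hκ := fourthMoment_nonneg
  refine ⟨1 + 81 * 16 * 625 * fourthMoment * B ^ 2, by positivity, ?_⟩
  intro S s i hs
  have hB : 0 ≤ B := by
    have := (sq_nonneg _).trans (hs 0)
    simpa [bracket] using this
  set T := S ∩ (freqBox (2 ^ (i + 1)) \ freqBox (2 ^ i)) with hT
  set lam : ℝ := √(1 / 2) ^ i with hlam
  have hlam0 : 0 < lam := by positivity
  have hlam4 : lam ^ 4 = ((4 : ℝ) ^ i)⁻¹ := by
    rw [hlam, ← pow_mul, mul_comm, pow_mul, show √(1 / 2 : ℝ) ^ 4 = (√(1 / 2) ^ 2) ^ 2 by ring,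
      Real.sq_sqrt (by norm_num), ← inv_pow]
    norm_num
  have hTK : T ⊆ freqBox (2 ^ (i + 1)) := Finset.inter_subset_right.trans Finset.sdiff_subset
  have h2i : (1 : ℝ) ≤ 2 ^ i := one_le_pow₀ (by norm_num)
  have hsum : ∑ n ∈ T, s n ^ 2 ≤ 25 * B * lam ^ 4 := by
    have h1 : ∀ n ∈ T, s n ^ 2 ≤ B * ((2 : ℝ) ^ i) ^ (-4 : ℝ) := by
      intro n hn
      refine (hs n).trans (mul_le_mul_of_nonneg_left ?_ hB)
      have h2 := (Finset.mem_sdiff.1 (Finset.mem_inter.1 hn).2).2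
      rw [mem_freqBox, not_le] at h2
      push_cast at h2
      exact Real.rpow_le_rpow_of_nonpos (by positivity) (by rw [bracket]; linarith) (by norm_num)
    have h3 : (T.card : ℝ) ≤ 25 * 4 ^ i := by
      have := (Finset.card_le_card hTK)
      rw [card_freqBox] at this
      have h4 : (T.card : ℝ) ≤ (2 * 2 ^ (i + 1) + 1) ^ 2 := by exact_mod_cast this
      refine h4.trans ?_
      have h5 : (2 * 2 ^ (i + 1) + 1 : ℝ) ≤ 5 * 2 ^ i := by rw [pow_succ]; linarith
      refine (pow_le_pow_left₀ (by positivity) h5 2).trans (le_of_eq ?_)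
      rw [mul_pow, ← pow_mul, mul_comm i, pow_mul]; norm_num
    refine (Finset.sum_le_card_nsmul _ _ _ h1).trans ?_
    rw [nsmul_eq_mul, hlam4, Real.rpow_neg (by positivity), show (4 : ℝ) = (4 : ℕ) by norm_num,
      Real.rpow_natCast]
    push_cast
    calc (T.card : ℝ) * (B * ((2 ^ i : ℝ) ^ 4)⁻¹) ≤ 25 * 4 ^ i * (B * ((2 ^ i : ℝ) ^ 4)⁻¹) := by
          gcongr
      _ = 25 * B * ((4 : ℝ) ^ i)⁻¹ := by
          have : ((2 : ℝ) ^ i) ^ 4 = 4 ^ i * 4 ^ i := by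
            rw [← mul_pow, ← pow_mul, mul_comm, pow_mul]; norm_num
          rw [this]
          field_simp
  have h4 := lintegral_norm_fieldMap_pow_four_le hTK s
  have hcoef : ((4 * (2 ^ (i + 1) : ℕ) + 1) ^ 2 * (16 * fourthMoment * (∑ n ∈ T, s n ^ 2) ^ 2) : ℝ) ≤
      81 * 16 * 625 * fourthMoment * B ^ 2 * lam ^ 4 := by
    have h5 : ((4 * (2 ^ (i + 1) : ℕ) + 1) ^ 2 : ℝ) ≤ 81 * 4 ^ i := by
      push_cast
      have h5 : (4 * 2 ^ (i + 1) + 1 : ℝ) ≤ 9 * 2 ^ i := by rw [pow_succ]; linarith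
      refine (pow_le_pow_left₀ (by positivity) h5 2).trans (le_of_eq ?_)
      rw [mul_pow, ← pow_mul, mul_comm i, pow_mul]; norm_num
    have h0 : 0 ≤ ∑ n ∈ T, s n ^ 2 := Finset.sum_nonneg fun n _ => sq_nonneg _
    calc _ ≤ 81 * 4 ^ i * (16 * fourthMoment * (25 * B * lam ^ 4) ^ 2) := by gcongr
      _ = 81 * 16 * 625 * fourthMoment * B ^ 2 * (4 ^ i * lam ^ 4) * lam ^ 4 := by ring
      _ = _ := by rw [hlam4, mul_inv_cancel₀ (by positivity), mul_one]
  -- `y ≤ λ + λ⁻³ y⁴`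
  calc ∫⁻ g, ‖fieldMap T s g‖ₑ ∂noiseLaw
      ≤ ∫⁻ g, (ENNReal.ofReal lam + ENNReal.ofReal (lam ^ 3)⁻¹ * ‖fieldMap T s g‖ₑ ^ 4)
          ∂noiseLaw := by
        refine lintegral_mono fun g => ?_
        rw [← ofReal_norm, ← ENNReal.ofReal_pow (norm_nonneg _),
          ← ENNReal.ofReal_mul (by positivity), ← ENNReal.ofReal_add hlam0.le (by positivity)]
        refine ENNReal.ofReal_le_ofReal ?_
        rcases le_total ‖fieldMap T s g‖ lam with h | h
        · exact h.trans (le_add_of_nonneg_right (by positivity))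
        · refine le_trans ?_ (le_add_of_nonneg_left hlam0.le)
          rw [inv_mul_eq_div, le_div_iff₀ (by positivity), pow_succ' _ 3]
          gcongr
    _ = ENNReal.ofReal lam + ENNReal.ofReal (lam ^ 3)⁻¹ *
          ∫⁻ g, ‖fieldMap T s g‖ₑ ^ 4 ∂noiseLaw := by
        rw [lintegral_add_left measurable_const, lintegral_const, measure_univ, mul_one,
          lintegral_const_mul]
        exact ((continuous_fieldMap T s).enorm.measurable).pow_const 4
    _ ≤ ENNReal.ofReal lam + ENNReal.ofReal (lam ^ 3)⁻¹ *
          ENNReal.ofReal (81 * 16 * 625 * fourthMoment * B ^ 2 * lam ^ 4) := by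
        gcongr
        exact h4.trans (ENNReal.ofReal_le_ofReal hcoef)
    _ = _ := by
        rw [← ENNReal.ofReal_mul (by positivity), ← ENNReal.ofReal_add hlam0.le (by positivity)]
        congr 1
        field_simp

theorem lintegral_norm_sdiff_le {T T' : Finset Freq} (h : T ⊆ T') (S : Finset Freq)
    (s : Freq → ℝ) : ∫⁻ g, ‖fieldMap (S \ T) s g‖ₑ ∂noiseLaw ≤
      ∫⁻ g, ‖fieldMap (S ∩ (T' \ T)) s g‖ₑ ∂noiseLaw +
        ∫⁻ g, ‖fieldMap (S \ T') s g‖ₑ ∂noiseLaw := by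
  have hsplit : S \ T = S ∩ (T' \ T) ∪ S \ T' := by
    ext n
    have := @h n
    simp only [Finset.mem_sdiff, Finset.mem_union, Finset.mem_inter]
    tauto
  have hdisj : Disjoint (S ∩ (T' \ T)) (S \ T') := by
    rw [Finset.disjoint_left]
    intro n h1 h2
    simp only [Finset.mem_sdiff, Finset.mem_inter] at h1 h2
    exact h2.2 h1.2.1
  rw [hsplit, ← lintegral_add_left (continuous_fieldMap _ s).enorm.measurable]
  refine lintegral_mono fun g => ?_
  rw [fieldMap_disjUnion hdisj]
  exact enorm_add_le (E := C(Torus, ℝ)) _ _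

/-- The expected sup norm of the high frequencies of a field. -/
theorem exists_lintegral_norm_tail_le (B : ℝ) : ∃ C, 0 ≤ C ∧
    ∀ (S : Finset Freq) (s : Freq → ℝ) (i : ℕ), (∀ n, s n ^ 2 ≤ B * bracket n ^ (-4 : ℝ)) →
      ∫⁻ g, ‖fieldMap (S \ freqBox (2 ^ i)) s g‖ₑ ∂noiseLaw ≤
        ENNReal.ofReal (C * √(1 / 2) ^ i) := by
  obtain ⟨C, hC0, hC⟩ := exists_lintegral_norm_block_le B
  refine ⟨4 * C, by positivity, ?_⟩
  have key : ∀ (l : ℕ) (i : ℕ) (S : Finset Freq) (s : Freq → ℝ),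
      (∀ n, s n ^ 2 ≤ B * bracket n ^ (-4 : ℝ)) → S ⊆ freqBox (2 ^ (i + l)) →
      ∫⁻ g, ‖fieldMap (S \ freqBox (2 ^ i)) s g‖ₑ ∂noiseLaw ≤
        ENNReal.ofReal (4 * C * √(1 / 2) ^ i) := by
    intro l
    induction l with
    | zero =>
      intro i S s hs hS
      rw [add_zero] at hS
      rw [Finset.sdiff_eq_empty_iff_subset.2 hS]
      have h0 : ∀ g, ‖fieldMap ∅ s g‖ₑ = 0 := fun g => enorm_zero (E := C(Torus, ℝ))
      simp only [h0, lintegral_zero]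
      exact zero_le
    | succ l ih =>
      intro i S s hs hS
      have h1 := ih (i + 1) S s hs (by rwa [add_assoc, add_comm 1 l])
      have hsub : freqBox (2 ^ i) ⊆ freqBox (2 ^ (i + 1)) :=
        freqBox_mono (Nat.pow_le_pow_right (by norm_num) (by omega))
      refine (lintegral_norm_sdiff_le hsub S s).trans ((add_le_add (hC S s i hs) h1).trans ?_)
      rw [← ENNReal.ofReal_add (by positivity) (by positivity)]
      refine ENNReal.ofReal_le_ofReal ?_
      have hq : √(1 / 2 : ℝ) ≤ 3 / 4 := by
        rw [Real.sqrt_le_left (by norm_num)]; norm_num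
      have h0 : 0 ≤ C * √(1 / 2 : ℝ) ^ i := by positivity
      rw [pow_succ]
      nlinarith
  intro S s i hs
  obtain ⟨K, hK⟩ : ∃ K, S ⊆ freqBox K := by
    have := (tendsto_freqBox.eventually_ge_atTop S).exists
    exact this
  refine key K i S s hs (hK.trans (freqBox_mono ?_))
  exact (Nat.lt_two_pow_self.le).trans (Nat.pow_le_pow_right (by norm_num) (by omega))

theorem memLp_fieldMap (S : Finset Freq) (s : Freq → ℝ) : MemLp (fieldMap S s) 1 noiseLaw := by
  refine memLp_finsetSum S (f := fun n (g : Noise) => (s n * g n) • hartleyMap n) fun n _ => ?_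
  have h : AllLp (fun g : Noise => g n) noiseLaw :=
    allLp_id_stdNormal.comp (measurePreserving_eval_infinitePi (fun _ : Freq => stdNormal) n)
  have h1 : Integrable (fun g : Noise => (s n * g n) • hartleyMap n) noiseLaw :=
    (h.integrable.const_mul (s n)).smul_const (hartleyMap n)
  exact memLp_one_iff_integrable.2 h1

/-- The partial sums of a random series with square summable enough coefficients converge in
`C(Ω)`. -/
theorem exists_limit_fieldMap {B : ℝ} {s : Freq → ℝ}
    (hs : ∀ n, s n ^ 2 ≤ B * bracket n ^ (-4 : ℝ)) : ∃ X : Noise → C(Torus, ℝ), Measurable X ∧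
      Tendsto (fun i => eLpNorm (fieldMap (freqBox (2 ^ i)) s - X) 1 noiseLaw) atTop (𝓝 0) := by
  obtain ⟨C, hC0, hC⟩ := exists_lintegral_norm_tail_le B
  have hM := fun i : ℕ => memLp_fieldMap (freqBox (2 ^ i)) s
  have hb : Tendsto (fun i : ℕ => C * √(1 / 2) ^ i) atTop (𝓝 0) := by
    rw [← mul_zero C]
    refine (tendsto_pow_atTop_nhds_zero_of_lt_one (by positivity) ?_).const_mul C
    rw [Real.sqrt_lt' one_pos]; norm_num
  set u : ℕ → Lp C(Torus, ℝ) 1 noiseLaw := fun i => (hM i).toLp with hu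
  have hcau : CauchySeq u := by
    refine cauchySeq_of_le_tendsto_0' _ (fun n m hnm => ?_) hb
    rw [dist_comm, ← ENNReal.ofReal_le_ofReal_iff (by positivity), ← edist_dist, hu,
      Lp.edist_toLp_toLp, eLpNorm_one_eq_lintegral_enorm]
    refine le_trans (le_of_eq ?_) (hC (freqBox (2 ^ m)) s n hs)
    congr 1
    funext g
    have hsub : freqBox (2 ^ n) ⊆ freqBox (2 ^ m) :=
      freqBox_mono (Nat.pow_le_pow_right (by norm_num) hnm)
    rw [Pi.sub_apply, sub_eq_iff_eq_add.2 (?_ : fieldMap (freqBox (2 ^ m)) s g =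
      fieldMap (freqBox (2 ^ m) \ freqBox (2 ^ n)) s g + fieldMap (freqBox (2 ^ n)) s g)]
    rw [← fieldMap_disjUnion Finset.sdiff_disjoint, Finset.sdiff_union_of_subset hsub]
  obtain ⟨X, hX⟩ := cauchySeq_tendsto_of_complete hcau
  refine ⟨X, (Lp.stronglyMeasurable X).measurable, ?_⟩
  refine (tendsto_iff_edist_tendsto_0.1 hX).congr fun i => ?_
  rw [Lp.edist_def]
  exact eLpNorm_congr_ae ((hM i).coeFn_toLp.sub (EventuallyEq.refl _ _))

theorem integral_hartley_mul (n k : Freq) :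
    ∫ x, hartley n x * hartley k x = if n = k then 1 else 0 := by
  have h1 : ∀ l : Freq, ∫ x : Torus, (UnitAddTorus.mFourier l x).re = if l = 0 then 1 else 0 := by
    intro l
    have h : Integrable (fun x : Torus => UnitAddTorus.mFourier l x) :=
      integrable_of_continuous (by fun_prop)
    have h2 := integral_re h
    simp only [RCLike.re_to_complex] at h2
    rw [h2, integral_mFourier]
    split_ifs <;> simp
  have h2 : ∀ l : Freq, ∫ x : Torus, (UnitAddTorus.mFourier l x).im = 0 := by
    intro l
    have h : Integrable (fun x : Torus => UnitAddTorus.mFourier l x) :=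
      integrable_of_continuous (by fun_prop)
    have h2 := integral_im h
    simp only [RCLike.im_to_complex] at h2
    rw [h2, integral_mFourier]
    split_ifs <;> simp
  have e : ∀ x, hartley n x * hartley k x = (UnitAddTorus.mFourier (n + -k) x).re +
      (UnitAddTorus.mFourier (n + k) x).im := by
    intro x
    rw [UnitAddTorus.mFourier_add, UnitAddTorus.mFourier_add, UnitAddTorus.mFourier_neg]
    simp only [hartley, Complex.mul_re, Complex.mul_im, Complex.conj_re, Complex.conj_im]
    ring
  simp only [e]
  rw [integral_add (integrable_of_continuous (by fun_prop))
    (integrable_of_continuous (by fun_prop)), h1, h2, add_zero]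
  simp only [← sub_eq_add_neg, sub_eq_zero]

theorem integral_fieldMap_mul_hartley (S : Finset Freq) (s : Freq → ℝ) (g : Noise) {n : Freq}
    (hn : n ∈ S) : ∫ x, fieldMap S s g x * hartley n x = s n * g n := by
  simp only [fieldMap_apply, finField, Finset.sum_mul]
  rw [integral_finsetSum _ fun k _ => integrable_of_continuous (by fun_prop)]
  simp only [mul_assoc, integral_const_mul, integral_hartley_mul]
  simp [hn]

theorem isContinuousField_of_tendsto {σ : Freq → ℝ} {X : Noise → C(Torus, ℝ)} (hX : Measurable X)
    (h : Tendsto (fun i => eLpNorm (fieldMap (freqBox (2 ^ i)) (fun n => √(σ n)) - X) 1 noiseLaw)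
      atTop (𝓝 0)) : IsContinuousField σ X := by
  refine ⟨hX, ?_⟩
  obtain ⟨ns, hns, hae⟩ := (tendstoInMeasure_of_tendsto_eLpNorm one_ne_zero
    (fun i => (memLp_fieldMap _ _).1) hX.aestronglyMeasurable h).exists_seq_tendsto_ae
  filter_upwards [hae] with g hg n
  have hcont : Continuous fun f : C(Torus, ℝ) => ∫ x, f x * hartley n x := by
    refine (LipschitzWith.of_dist_le_mul (K := 2) fun f h => ?_).continuous
    rw [dist_eq_norm, dist_eq_norm, ← integral_sub (integrable_of_continuous (by fun_prop))
      (integrable_of_continuous (by fun_prop))]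
    refine (norm_integral_le_of_norm_le_const (C := 2 * ‖f - h‖) (ae_of_all _ fun x => ?_)).trans
      (by simp)
    rw [← sub_mul, norm_mul, mul_comm]
    exact mul_le_mul (abs_hartley_le n x) ((f - h).norm_coe_le_norm x) (norm_nonneg _) (by norm_num)
  refine tendsto_nhds_unique ((hcont.tendsto _).comp hg) ?_
  refine tendsto_const_nhds.congr' ?_
  filter_upwards [(tendsto_freqBox.comp ((tendsto_pow_atTop_atTop_of_one_lt one_lt_two).comp
    hns.tendsto_atTop)).eventually_ge_atTop {n}] with i hi
  exact (integral_fieldMap_mul_hartley _ (fun n => √(σ n)) g (hi (Finset.mem_singleton_self n))).symm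

/-! ### Rotations of a pair of Gaussian noises -/

/-- The reflection `(x, y) ↦ (c x + s y, s x - c y)` of the plane. -/
def reflect (c s : ℝ) (p : ℝ × ℝ) : ℝ × ℝ := (c * p.1 + s * p.2, s * p.1 - c * p.2)

theorem map_reflect {c s : ℝ} (h : c ^ 2 + s ^ 2 = 1) :
    (stdNormal.prod stdNormal).map (reflect c s) = stdNormal.prod stdNormal := by
  set z : ℂ := ⟨c, s⟩ with hz
  have hz1 : ‖z‖ = 1 := by
    rw [← sq_eq_sq₀ (norm_nonneg _) zero_le_one, ← Complex.normSq_eq_norm_sq, Complex.normSq_mk]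
    linarith
  have hz0 : z ≠ 0 := by
    rw [← norm_ne_zero_iff, hz1]; exact one_ne_zero
  have hcos : Real.cos z.arg = c := by rw [Complex.cos_arg hz0, hz1, div_one]
  have hsin : Real.sin z.arg = s := by rw [Complex.sin_arg, hz1, div_one]
  have hrot := IsGaussian.map_rotation_eq_self (μ := stdNormal) (by simp [stdNormal]) z.arg
  have hneg : stdNormal.map (fun x : ℝ => -x) = stdNormal := by
    rw [stdNormal, gaussianReal_map_neg, neg_zero]
  have hmap : (stdNormal.prod stdNormal).map (Prod.map id fun x : ℝ => -x) =
      stdNormal.prod stdNormal := by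
    rw [← Measure.map_prod_map _ _ measurable_id measurable_neg, Measure.map_id, hneg]
  have e : reflect c s = (Prod.map id fun x : ℝ => -x) ∘
      (ContinuousLinearMap.rotation (E := ℝ) z.arg) := by
    funext p
    simp only [reflect, Function.comp, ContinuousLinearMap.rotation_apply, hcos, hsin, Prod.map,
      id, smul_eq_mul]
    ext
    · rfl
    · simp only; ring
  rw [e, ← Measure.map_map (by fun_prop) (by fun_prop), hrot, hmap]

/-- The law of the pairs of coordinates of two independent noises. -/
theorem map_zip_noiseLaw : (noiseLaw.prod noiseLaw).map (fun p (n : Freq) => (p.1 n, p.2 n)) =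
    Measure.infinitePi fun _ : Freq => stdNormal.prod stdNormal := by
  refine Measure.eq_infinitePi _ fun S t ht => ?_
  have hm : Measurable fun (p : Noise × Noise) (n : Freq) => (p.1 n, p.2 n) := by fun_prop
  rw [Measure.map_apply hm (MeasurableSet.pi S.countable_toSet fun i _ => ht i)]
  have h1 : MeasurePreserving (Prod.map (restrictNoise S) (restrictNoise S))
      (noiseLaw.prod noiseLaw) ((gaussPi S).prod (gaussPi S)) :=
    (measurePreserving_restrictNoise S).prod (measurePreserving_restrictNoise S)
  have h2 := measurePreserving_arrowProdEquivProdArrow ℝ ℝ S (fun _ => stdNormal)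
    (fun _ => stdNormal)
  have h3 : MeasurePreserving (MeasurableEquiv.arrowProdEquivProdArrow ℝ ℝ S).symm
      ((gaussPi S).prod (gaussPi S)) (Measure.pi fun _ : S => stdNormal.prod stdNormal) :=
    h2.symm
  have h4 := (h3.comp h1).measure_preimage
    (MeasurableSet.univ_pi fun i : S => ht i).nullMeasurableSet
  rw [Measure.pi_pi, Finset.prod_coe_sort S fun n => (stdNormal.prod stdNormal) (t n)] at h4
  rw [← h4]
  congr 1
  ext p
  simp only [Set.mem_preimage, Set.mem_pi, Set.mem_univ, true_implies, Subtype.forall]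
  rfl

/-- Coordinatewise reflections of a pair of noises. -/
def reflectNoise (c s : Freq → ℝ) (p : Noise × Noise) : Noise × Noise :=
  (fun n => c n * p.1 n + s n * p.2 n, fun n => s n * p.1 n - c n * p.2 n)

theorem measurePreserving_reflectNoise {c s : Freq → ℝ} (h : ∀ n, c n ^ 2 + s n ^ 2 = 1) :
    MeasurePreserving (reflectNoise c s) (noiseLaw.prod noiseLaw) (noiseLaw.prod noiseLaw) := by
  have hz : Measurable fun (p : Noise × Noise) (n : Freq) => (p.1 n, p.2 n) := by fun_prop
  have hu : Measurable fun (q : Freq → ℝ × ℝ) => ((fun n => (q n).1, fun n => (q n).2) :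
    Noise × Noise) := by fun_prop
  have hr : ∀ n, Measurable (reflect (c n) (s n)) := fun n => by unfold reflect; fun_prop
  have hr' : Measurable fun (q : Freq → ℝ × ℝ) n => reflect (c n) (s n) (q n) :=
    measurable_pi_lambda _ fun n => (hr n).comp (measurable_pi_apply n)
  refine ⟨by unfold reflectNoise; fun_prop, ?_⟩
  have e : reflectNoise c s = (fun (q : Freq → ℝ × ℝ) => ((fun n => (q n).1, fun n => (q n).2) :
      Noise × Noise)) ∘ (fun (q : Freq → ℝ × ℝ) n => reflect (c n) (s n) (q n)) ∘
      (fun (p : Noise × Noise) (n : Freq) => (p.1 n, p.2 n)) := rfl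
  rw [e, ← Measure.map_map hu (hr'.comp hz), ← Measure.map_map hr' hz, map_zip_noiseLaw,
    Measure.infinitePi_map_pi (μ := fun _ : Freq => stdNormal.prod stdNormal) hr]
  simp only [map_reflect (h _)]
  rw [← map_zip_noiseLaw, Measure.map_map hu hz]
  exact Measure.map_id

theorem reflectNoise_reflectNoise {c s : Freq → ℝ} (h : ∀ n, c n ^ 2 + s n ^ 2 = 1)
    (p : Noise × Noise) : reflectNoise c s (reflectNoise c s p) = p := by
  ext n
  · simp only [reflectNoise]
    linear_combination p.1 n * h n
  · simp only [reflectNoise]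
    linear_combination p.2 n * h n

/-! ### Weak convergence of tilted measures -/

/-- A sequence which converges almost everywhere and is bounded in `L²` converges in `L¹`. -/
theorem tendsto_integral_of_ae_of_sq {α : Type*} {mα : MeasurableSpace α} {μ : Measure α}
    [IsProbabilityMeasure μ] {f : ℕ → α → ℝ} {g : α → ℝ} (hf : ∀ n, AEStronglyMeasurable (f n) μ)
    {C : ℝ} (hC : ∀ n, ∫⁻ x, ENNReal.ofReal (f n x ^ 2) ∂μ ≤ ENNReal.ofReal C)
    (h : ∀ᵐ x ∂μ, Tendsto (fun n => f n x) atTop (𝓝 (g x))) :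
    Tendsto (fun n => ∫ x, f n x ∂μ) atTop (𝓝 (∫ x, g x ∂μ)) := by
  have hg : AEStronglyMeasurable g μ := aestronglyMeasurable_of_tendsto_ae atTop hf h
  have hcont : Continuous fun v : ℝ => ENNReal.ofReal (v ^ 2) :=
    ENNReal.continuous_ofReal.comp (by fun_prop)
  have hsq : ∀ x : ℝ, ‖x‖ₑ ^ 2 = ENNReal.ofReal (x ^ 2) := by
    intro x
    rw [← ofReal_norm, ← ENNReal.ofReal_pow (norm_nonneg _), Real.norm_eq_abs, sq_abs]
  have hg2 : ∫⁻ x, ENNReal.ofReal (g x ^ 2) ∂μ ≤ ENNReal.ofReal C := by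
    calc ∫⁻ x, ENNReal.ofReal (g x ^ 2) ∂μ
        ≤ ∫⁻ x, liminf (fun n => ENNReal.ofReal (f n x ^ 2)) atTop ∂μ := by
          refine lintegral_mono_ae ?_
          filter_upwards [h] with x hx
          exact (((hcont.tendsto _).comp hx).liminf_eq).ge
      _ ≤ liminf (fun n => ∫⁻ x, ENNReal.ofReal (f n x ^ 2) ∂μ) atTop :=
          lintegral_liminf_le' fun n => hcont.measurable.comp_aemeasurable (hf n).aemeasurable
      _ ≤ ENNReal.ofReal C := liminf_le_of_frequently_le' (Frequently.of_forall fun n => hC n)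
  have hmem : ∀ u : α → ℝ, AEStronglyMeasurable u μ →
      ∫⁻ x, ENNReal.ofReal (u x ^ 2) ∂μ ≤ ENNReal.ofReal C → MemLp u 1 μ := by
    intro u hu hu2
    have : MemLp u 2 μ := by
      refine ⟨hu, ?_⟩
      rw [eLpNorm_lt_top_iff_lintegral_rpow_enorm_lt_top (by norm_num) (by norm_num)]
      simp only [ENNReal.toReal_ofNat, ENNReal.rpow_ofNat, hsq]
      exact hu2.trans_lt ENNReal.ofReal_lt_top
    exact this.mono_exponent (by norm_num)
  have hui : UnifIntegrable f 1 μ := by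
    refine unifIntegrable_of le_rfl ENNReal.one_ne_top hf fun ε hε => ?_
    refine ⟨(max C 0 / ε).toNNReal + 1, fun n => ?_⟩
    set R : ℝ≥0 := (max C 0 / ε).toNNReal + 1 with hR
    have hR0 : 0 < (R : ℝ) := by rw [hR]; positivity
    have hRC : C / R ≤ ε := by
      rw [div_le_iff₀ hR0, hR]
      push_cast
      rw [Real.coe_toNNReal _ (by positivity), mul_add, mul_div_cancel₀ _ hε.ne']
      linarith [le_max_left C 0]
    rw [eLpNorm_one_eq_lintegral_enorm]
    calc ∫⁻ x, ‖({x | R ≤ ‖f n x‖₊}.indicator (f n)) x‖ₑ ∂μ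
        ≤ ∫⁻ x, ENNReal.ofReal (1 / R) * ENNReal.ofReal (f n x ^ 2) ∂μ := by
          refine lintegral_mono fun x => ?_
          rw [← ENNReal.ofReal_mul (by positivity)]
          by_cases hx : x ∈ {x | R ≤ ‖f n x‖₊}
          · rw [Set.indicator_of_mem hx, ← ofReal_norm]
            refine ENNReal.ofReal_le_ofReal ?_
            have hx' : (R : ℝ) ≤ ‖f n x‖ := by exact_mod_cast hx
            rw [one_div, inv_mul_eq_div, le_div_iff₀ hR0, ← sq_abs, ← Real.norm_eq_abs, sq]
            gcongr
          · rw [Set.indicator_of_notMem hx, enorm_zero]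
            exact zero_le
      _ ≤ ENNReal.ofReal (1 / R) * ENNReal.ofReal C := by
          rw [lintegral_const_mul' _ _ ENNReal.ofReal_ne_top]
          gcongr
          exact hC n
      _ ≤ ENNReal.ofReal ε := by
          rw [← ENNReal.ofReal_mul (by positivity), one_div, inv_mul_eq_div]
          exact ENNReal.ofReal_le_ofReal hRC
  have hg1 := hmem g hg hg2
  have hL := tendsto_Lp_finite_of_tendsto_ae le_rfl ENNReal.one_ne_top hf hg1 hui h
  refine tendsto_integral_of_L1' g hg
    (Eventually.of_forall fun n => memLp_one_iff_integrable.1 (hmem _ (hf n) (hC n))) hL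

/-- Convergence in measure of the observables and of the weights, with weights bounded in `L²`,
implies convergence of the expectations under the tilted measures. -/
theorem tendsto_integral_tilted {α E : Type*} {mα : MeasurableSpace α} {μ : Measure α}
    [IsProbabilityMeasure μ] [PseudoMetricSpace E] [MeasurableSpace E] [OpensMeasurableSpace E]
    {V : ℕ → α → ℝ} {W : α → ℝ} {Y : ℕ → α → E} {Z : α → E}
    (hVm : ∀ n, AEStronglyMeasurable (V n) μ) (hYm : ∀ n, AEMeasurable (Y n) μ)
    (hV : TendstoInMeasure μ V atTop W) (hY : TendstoInMeasure μ Y atTop Z) {C : ℝ}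
    (hC : ∀ n, ∫⁻ x, ENNReal.ofReal (Real.exp (-(2 * V n x))) ∂μ ≤ ENNReal.ofReal C)
    (hW : Integrable (fun x => Real.exp (-W x)) μ) {F : E → ℝ} (hF : Continuous F) {R : ℝ}
    (hR : ∀ y, |F y| ≤ R) :
    Tendsto (fun n => ∫ x, F (Y n x) ∂μ.tilted fun x => -V n x) atTop
      (𝓝 (∫ x, F (Z x) ∂μ.tilted fun x => -W x)) := by
  have key : ∀ {F : E → ℝ}, Continuous F → ∀ {R : ℝ}, (∀ y, |F y| ≤ R) →
      Tendsto (fun n => ∫ x, Real.exp (-V n x) * F (Y n x) ∂μ) atTop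
        (𝓝 (∫ x, Real.exp (-W x) * F (Z x) ∂μ)) := by
    intro F hF R hR
    refine tendsto_of_subseq_tendsto fun ns hns => ?_
    have h1 : TendstoInMeasure μ (fun n => V (ns n)) atTop W := fun ε hε => (hV ε hε).comp hns
    obtain ⟨ms, hms, hmae⟩ := h1.exists_seq_tendsto_ae
    have h2 : TendstoInMeasure μ (fun n => Y (ns (ms n))) atTop Z :=
      fun ε hε => (hY ε hε).comp (hns.comp hms.tendsto_atTop)
    obtain ⟨ls, hls, hlae⟩ := h2.exists_seq_tendsto_ae
    refine ⟨ms ∘ ls, ?_⟩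
    refine tendsto_integral_of_ae_of_sq (C := max C 0 * R ^ 2) (fun n => ?_) (fun n => ?_) ?_
    · exact (Real.continuous_exp.comp_aestronglyMeasurable (hVm _).neg).mul
        (hF.measurable.comp_aemeasurable (hYm _)).aestronglyMeasurable
    · have hCn := hC (ns ((ms ∘ ls) n))
      calc _ ≤ ∫⁻ x, ENNReal.ofReal (R ^ 2) *
            ENNReal.ofReal (Real.exp (-(2 * V (ns ((ms ∘ ls) n)) x))) ∂μ := by
              refine lintegral_mono fun x => ?_
              rw [← ENNReal.ofReal_mul (by positivity)]
              refine ENNReal.ofReal_le_ofReal ?_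
              rw [mul_pow, ← Real.exp_nat_mul, mul_comm]
              push_cast
              rw [mul_neg]
              refine mul_le_mul_of_nonneg_right ?_ (Real.exp_pos _).le
              rw [← sq_abs]
              exact pow_le_pow_left₀ (abs_nonneg _) (hR _) 2
        _ ≤ ENNReal.ofReal (R ^ 2) * ENNReal.ofReal (max C 0) := by
              rw [lintegral_const_mul' _ _ ENNReal.ofReal_ne_top]
              gcongr
              exact hCn.trans (ENNReal.ofReal_le_ofReal (le_max_left _ _))
        _ = _ := by rw [← ENNReal.ofReal_mul (by positivity), mul_comm]
    · filter_upwards [hmae, hlae] with x hx1 hx2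
      refine Tendsto.mul ?_ ((hF.tendsto _).comp hx2)
      exact (Real.continuous_exp.tendsto _).comp (hx1.comp hls.tendsto_atTop).neg
  have h0 := key (F := fun _ => 1) continuous_const (R := 1) (by simp)
  simp only [mul_one] at h0
  have hpos : 0 < ∫ x, Real.exp (-W x) ∂μ := integral_exp_pos hW
  have h1 := (key hF hR).div h0 hpos.ne'
  simp only [integral_tilted, smul_eq_mul, div_mul_eq_mul_div, integral_div]
  exact h1

/-- Approximation in measure along a sequence, by approximations which are uniformly close in
mean. -/
theorem tendstoInMeasure_of_approx {α E : Type*} {mα : MeasurableSpace α} {μ : Measure α}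
    [PseudoEMetricSpace E] {Y : ℕ → α → E} {Z : α → E} {A : ℕ → ℕ → α → E} {A' : ℕ → α → E}
    {b : ℕ → ℝ≥0∞} (hm : ∀ K n, AEMeasurable (fun x => edist (Y n x) (A K n x)) μ)
    (h1 : ∀ K n, ∫⁻ x, edist (Y n x) (A K n x) ∂μ ≤ b K) (hb : Tendsto b atTop (𝓝 0))
    (h2 : ∀ K, TendstoInMeasure μ (A K) atTop (A' K))
    (h3 : TendstoInMeasure μ A' atTop Z) : TendstoInMeasure μ Y atTop Z := by
  refine tendstoInMeasure_of_ne_top fun ε hε hεt => ?_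
  refine ENNReal.tendsto_nhds_zero.2 fun δ hδ => ?_
  have hε3 : 0 < ε / 3 := ENNReal.div_pos hε.ne' (by norm_num)
  have hδ3 : 0 < δ / 3 := ENNReal.div_pos hδ.ne' (by norm_num)
  have h1' : ∀ᶠ K in atTop, ∀ n, μ {x | ε / 3 ≤ edist (Y n x) (A K n x)} ≤ δ / 3 := by
    have hb' := ENNReal.Tendsto.div_const hb (b := ε / 3) (Or.inr hε3.ne')
    rw [ENNReal.zero_div] at hb'
    filter_upwards [ENNReal.tendsto_nhds_zero.1 hb' _ hδ3] with K hK n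
    exact (meas_ge_le_lintegral_div (hm K n) hε3.ne' (ENNReal.div_lt_top hεt (by norm_num)).ne).trans
      ((ENNReal.div_le_div_right (h1 K n) _).trans hK)
  obtain ⟨K, hK1, hK3⟩ := (h1'.and
    (ENNReal.tendsto_nhds_zero.1 (h3 _ hε3) _ hδ3)).exists
  filter_upwards [ENNReal.tendsto_nhds_zero.1 (h2 K _ hε3) _ hδ3] with n hn
  have hsub : {x | ε ≤ edist (Y n x) (Z x)} ⊆ {x | ε / 3 ≤ edist (Y n x) (A K n x)} ∪
      ({x | ε / 3 ≤ edist (A K n x) (A' K x)} ∪ {x | ε / 3 ≤ edist (A' K x) (Z x)}) := by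
    intro x hx
    by_contra hcon
    simp only [Set.mem_union, Set.mem_ofPred_eq, not_or, not_le] at hcon hx
    have : edist (Y n x) (Z x) < ε / 3 + (ε / 3 + ε / 3) :=
      (edist_triangle4 _ (A K n x) (A' K x) _).trans_lt (by
        rw [add_assoc]
        exact ENNReal.add_lt_add hcon.1 (ENNReal.add_lt_add hcon.2.1 hcon.2.2))
    rw [← add_assoc, ENNReal.add_thirds] at this
    exact absurd hx (not_le.2 this)
  calc μ {x | ε ≤ edist (Y n x) (Z x)} ≤ _ := measure_mono hsub
    _ ≤ δ / 3 + (δ / 3 + δ / 3) := (measure_union_le _ _).trans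
        (add_le_add (hK1 n) ((measure_union_le _ _).trans (add_le_add hn hK3)))
    _ = δ := by rw [← add_assoc, ENNReal.add_thirds]

/-! ### The limiting measure -/

/-- The multipliers of the covariance of `Y_∞ - Y_t`, with `M = m ^ 2 + 1 / t`. -/
noncomputable def diffMultiplier (m M : ℝ) (n : Freq) : ℝ :=
  covMultiplier (m ^ 2) n - covMultiplier M n

theorem diffMultiplier_nonneg {m M : ℝ} (hm : 0 < m) (hM : m ^ 2 ≤ M) (n : Freq) :
    0 ≤ diffMultiplier m M n :=
  sub_nonneg.2 (covMultiplier_anti (by positivity) hM n)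

theorem exists_diffMultiplier_le {m M : ℝ} (hm : 0 < m) (hM : m ^ 2 ≤ M) :
    ∃ B, 0 ≤ B ∧ ∀ n, √(diffMultiplier m M n) ^ 2 ≤ B * bracket n ^ (-4 : ℝ) := by
  have hm2 : 0 < m ^ 2 := by positivity
  have hM0 := hm2.trans_le hM
  refine ⟨|M - m ^ 2| * ((2 / m ^ 2 + 2) * (2 / M + 2)), by positivity, fun n => ?_⟩
  rw [Real.sq_sqrt (diffMultiplier_nonneg hm hM n)]
  exact (le_abs_self _).trans (abs_covMultiplier_sub_le hm2 hM0 n)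

/-- The share of `Y_∞ - Y_t` in the field `Y_∞`. -/
noncomputable def diffShare (m M : ℝ) (n : Freq) : ℝ := √(diffMultiplier m M n) / covRoot (m ^ 2) n

/-- The share of `Y_t` in the field `Y_∞`. -/
noncomputable def massShare (m M : ℝ) (n : Freq) : ℝ := covRoot M n / covRoot (m ^ 2) n

theorem covRoot_pos {M : ℝ} (hM : 0 < M) (n : Freq) : 0 < covRoot M n :=
  Real.sqrt_pos.2 (covMultiplier_pos hM n)

theorem diffShare_sq_add_massShare_sq {m M : ℝ} (hm : 0 < m) (hM : m ^ 2 ≤ M) (n : Freq) :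
    diffShare m M n ^ 2 + massShare m M n ^ 2 = 1 := by
  have hm2 : 0 < m ^ 2 := by positivity
  have h0 := (covRoot_pos hm2 n)
  rw [diffShare, massShare, div_pow, div_pow, ← add_div, div_eq_one_iff_eq (by positivity),
    Real.sq_sqrt (diffMultiplier_nonneg hm hM n), covRoot_sq hm2, covRoot_sq (hm2.trans_le hM),
    diffMultiplier]
  ring

/-- The noise of `Y_∞` in terms of independent noises of `Y_∞ - Y_t` and `Y_t`, and conversely the
noise of `Y_∞ - Y_t` in terms of that of `Y_∞` and an independent one. -/
noncomputable def mixNoise (m M : ℝ) : Noise × Noise → Noise × Noise :=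
  reflectNoise (diffShare m M) (massShare m M)

theorem measurePreserving_mixNoise {m M : ℝ} (hm : 0 < m) (hM : m ^ 2 ≤ M) :
    MeasurePreserving (mixNoise m M) (noiseLaw.prod noiseLaw) (noiseLaw.prod noiseLaw) :=
  measurePreserving_reflectNoise (diffShare_sq_add_massShare_sq hm hM)

theorem mixNoise_mixNoise {m M : ℝ} (hm : 0 < m) (hM : m ^ 2 ≤ M) (p : Noise × Noise) :
    mixNoise m M (mixNoise m M p) = p :=
  reflectNoise_reflectNoise (diffShare_sq_add_massShare_sq hm hM) p

/-- The pathwise decomposition `Y_∞ = (Y_∞ - Y_t) + Y_t` of the truncated fields. -/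
theorem truncInteraction_mixNoise {m M : ℝ} (hm : 0 < m) (hM : m ^ 2 ≤ M) (P : Polynomial ℝ)
    (K : ℕ) (p : Noise × Noise) :
    truncInteraction m P (m ^ 2) 0 K (mixNoise m M p).1 =
      wickSum volume P.natDegree (shiftCoeff P (varDiff m M K)
        (fieldMap (freqBox K) (fun n => √(diffMultiplier m M n)) p.1)) (freqBox K) (covRoot M)
        p.2 := by
  have hm2 : 0 < m ^ 2 := by positivity
  have hM0 := hm2.trans_le hM
  rw [← integral_wickPoly_eq_wickSum (c := truncVariance m K) P ?_ (truncVariance_pos hm K)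
    (ContinuousMap.continuous _)]
  · rw [truncInteraction]
    congr 1
    funext x
    congr 1
    rw [ContinuousMap.zero_apply, zero_add, fieldMap_apply, truncField, finField, finField,
      ← Finset.sum_add_distrib]
    refine Finset.sum_congr rfl fun n _ => ?_
    have h0 := (covRoot_pos hm2 n).ne'
    rw [← covRoot]
    simp only [mixNoise, reflectNoise, diffShare, massShare]
    field_simp
  · simp only [covRoot_sq hM0, varDiff, truncVariance, Finset.sum_sub_distrib]
    ring

/-- The interaction depends continuously on the shift, jointly with the removal of the truncation. -/
theorem tendsto_wickSum_interaction {m M : ℝ} (hm : 0 < m) (hM : m ^ 2 ≤ M) (P : Polynomial ℝ)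
    {φ : C(Torus, ℝ)} {K : ℕ → ℕ} (hK : Tendsto K atTop atTop) {ψ : ℕ → C(Torus, ℝ)}
    (hψ : Tendsto ψ atTop (𝓝 φ)) :
    Tendsto (fun i => eLpNorm (fun g => wickSum volume P.natDegree
      (shiftCoeff P (varDiff m M (K i)) (ψ i)) (freqBox (K i)) (covRoot M) g -
        interaction m P M φ g) 2 noiseLaw) atTop (𝓝 0) := by
  have hM0 : 0 < M := (by positivity : 0 < m ^ 2).trans_le hM
  obtain ⟨c, hc, -⟩ := exists_tendsto_varDiff hm hM
  obtain ⟨V, hV, hlim⟩ := exists_isInteraction hm hM P hc φ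
  have hI := isInteraction_interaction hm hM P φ
  have hD := FieldData.of_volume (covRoot_sq_le hM0) (covRoot_neg M)
  have hae : interaction m P M φ =ᵐ[noiseLaw] V := by
    refine ae_eq_of_tendsto_eLpNorm (fun K => ?_) hI.1.1 hV.1.1 hI.2 hV.2
    rw [funext (truncInteraction_eq_wickSum hm hM0 P φ K)]
    exact (allLp_wickSum (hD K) _ (continuous_shiftCoeff P _ φ.continuous)).memLp_two.1
  refine (hlim K (fun i => shiftCoeff P (varDiff m M (K i)) (ψ i)) hK
    (fun i => continuous_shiftCoeff P _ (ψ i).continuous)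
    (tendstoUniformly_shiftCoeff P (hc.comp hK) φ.continuous
      (ContinuousMap.tendsto_iff_tendstoUniformly.1 hψ))).congr fun i => ?_
  refine eLpNorm_congr_ae ?_
  filter_upwards [hae] with g hg
  rw [hg]

/-- The interaction of `Y_t` shifted by `Y_∞ - Y_t` is the interaction of `Y_∞`. -/
theorem interaction_mixNoise {m M : ℝ} (hm : 0 < m) (hM : m ^ 2 ≤ M) (P : Polynomial ℝ)
    {X : Noise → C(Torus, ℝ)} (hX : Measurable X)
    (hlim : Tendsto (fun i => eLpNorm (fieldMap (freqBox (2 ^ i))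
      (fun n => √(diffMultiplier m M n)) - X) 1 noiseLaw) atTop (𝓝 0)) :
    ∀ᵐ g ∂noiseLaw, ∀ᵐ g' ∂noiseLaw,
      interaction m P M (X g) g' = interaction m P (m ^ 2) 0 (mixNoise m M (g, g')).1 := by
  have hm2 : 0 < m ^ 2 := by positivity
  have hM0 := hm2.trans_le hM
  have hmix := measurePreserving_mixNoise hm hM
  have hmp : MeasurePreserving (fun p => (mixNoise m M p).1) (noiseLaw.prod noiseLaw) noiseLaw :=
    measurePreserving_fst.comp hmix
  obtain ⟨ns, hns, hnsX⟩ := (tendstoInMeasure_of_tendsto_eLpNorm one_ne_zero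
    (fun i => (memLp_fieldMap _ _).1) hX.aestronglyMeasurable hlim).exists_seq_tendsto_ae
  set K : ℕ → ℕ := fun i => 2 ^ ns i with hK
  have hKt : Tendsto K atTop atTop :=
    (tendsto_pow_atTop_atTop_of_one_lt one_lt_two).comp hns.tendsto_atTop
  have hI := isInteraction_interaction hm le_rfl P 0
  have hD := FieldData.of_volume (covRoot_sq_le hM0) (covRoot_neg M)
  have hD2 := FieldData.of_volume (covRoot_sq_le hm2) (covRoot_neg (m ^ 2))
  have hTm : ∀ K, AEStronglyMeasurable (truncInteraction m P (m ^ 2) 0 K) noiseLaw := by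
    intro K
    rw [funext (truncInteraction_eq_wickSum hm hm2 P 0 K)]
    exact (allLp_wickSum (hD2 K) _ (continuous_shiftCoeff P _ (ContinuousMap.continuous 0))).memLp_two.1
  have h1 : TendstoInMeasure (noiseLaw.prod noiseLaw)
      (fun i p => truncInteraction m P (m ^ 2) 0 (K i) (mixNoise m M p).1) atTop
      (fun p => interaction m P (m ^ 2) 0 (mixNoise m M p).1) := by
    refine tendstoInMeasure_of_tendsto_eLpNorm two_ne_zero
      (fun i => (hTm (K i)).comp_measurePreserving hmp) (hI.1.1.comp_measurePreserving hmp) ?_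
    refine (hI.2.comp hKt).congr fun i => ?_
    exact (eLpNorm_comp_measurePreserving ((hTm (K i)).sub hI.1.1) hmp).symm
  obtain ⟨ms, hms, hmsT⟩ := h1.exists_seq_tendsto_ae
  filter_upwards [hnsX, Measure.ae_ae_of_ae_prod hmsT] with g hg1 hg2
  have h2 := tendsto_wickSum_interaction hm hM P (hKt.comp hms.tendsto_atTop)
    (hg1.comp hms.tendsto_atTop)
  have hmeas : ∀ i, AEStronglyMeasurable (wickSum volume P.natDegree
      (shiftCoeff P (varDiff m M ((K ∘ ms) i)) (((fun i => fieldMap (freqBox (2 ^ ns i))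
        (fun n => √(diffMultiplier m M n)) g) ∘ ms) i)) (freqBox ((K ∘ ms) i)) (covRoot M))
      noiseLaw := fun i =>
    (allLp_wickSum (hD _) _ (continuous_shiftCoeff P _ (ContinuousMap.continuous _))).memLp_two.1
  have h3 := tendstoInMeasure_of_tendsto_eLpNorm two_ne_zero hmeas
    (isInteraction_interaction hm hM P (X g)).1.1 h2
  refine tendstoInMeasure_ae_unique h3 (tendstoInMeasure_of_tendsto_ae hmeas ?_)
  filter_upwards [hg2] with g' hg'
  refine hg'.congr fun i => ?_
  rw [truncInteraction_mixNoise hm hM]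
  rfl

theorem exp_neg_potential {m M : ℝ} (hm : 0 < m) (hM : m ^ 2 ≤ M) {P : Polynomial ℝ}
    (hdeg : Even P.natDegree) (hpos : 0 < P.natDegree) (hlead : 0 < P.leadingCoeff)
    (φ : C(Torus, ℝ)) :
    Real.exp (-potential m P M φ) = ∫ g, Real.exp (-interaction m P M φ g) ∂noiseLaw := by
  rw [potential, neg_neg, Real.exp_log]
  exact integral_exp_pos (integrable_exp_neg_interaction hm hM P hdeg hpos hlead φ)

/-- The expectations under the limiting measure, in terms of the field `Y_∞ - Y_t`. -/
theorem integral_tilted_interaction {m M : ℝ} (hm : 0 < m) (hM : m ^ 2 ≤ M) {P : Polynomial ℝ}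
    (hdeg : Even P.natDegree) (hpos : 0 < P.natDegree) (hlead : 0 < P.leadingCoeff)
    {X : Noise → C(Torus, ℝ)} (hX : Measurable X)
    (hlim : Tendsto (fun i => eLpNorm (fieldMap (freqBox (2 ^ i))
      (fun n => √(diffMultiplier m M n)) - X) 1 noiseLaw) atTop (𝓝 0))
    {F : C(Torus, ℝ) → ℝ} (hF : Measurable F) {C : ℝ} (hC : ∀ φ, |F φ| ≤ C) :
    Integrable (fun g => F (X g) * Real.exp (-potential m P M (X g))) noiseLaw ∧
    ∫ p, F (X (mixNoise m M p).1) ∂(noiseLaw.prod noiseLaw).tilted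
        (fun p => -interaction m P (m ^ 2) 0 p.1) =
      Real.exp (potential m P (m ^ 2) 0) *
        ∫ g, F (X g) * Real.exp (-potential m P M (X g)) ∂noiseLaw := by
  set W := interaction m P (m ^ 2) 0 with hW
  have hmix := measurePreserving_mixNoise hm hM
  have hmp : MeasurePreserving (fun p => (mixNoise m M p).1) (noiseLaw.prod noiseLaw) noiseLaw :=
    measurePreserving_fst.comp hmix
  have hexp : Integrable (fun g => Real.exp (-W g)) noiseLaw :=
    integrable_exp_neg_interaction hm le_rfl P hdeg hpos hlead 0
  have hint : Integrable (fun p : Noise × Noise => F (X p.1) * Real.exp (-W (mixNoise m M p).1))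
      (noiseLaw.prod noiseLaw) := by
    refine ((hmp.integrable_comp hexp.1).2 hexp).bdd_mul (c := C) ?_ (ae_of_all _ fun p => hC _)
    exact (hF.comp (hX.comp measurable_fst)).aestronglyMeasurable
  have hae : (fun g => F (X g) * Real.exp (-potential m P M (X g))) =ᵐ[noiseLaw]
      fun g => ∫ g', F (X g) * Real.exp (-W (mixNoise m M (g, g')).1) ∂noiseLaw := by
    filter_upwards [interaction_mixNoise hm hM P hX hlim] with g hg
    rw [exp_neg_potential hm hM hdeg hpos hlead, integral_const_mul]
    congr 1
    refine integral_congr_ae ?_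
    filter_upwards [hg] with g' hg'
    rw [hg']
  refine ⟨hint.integral_prod_left.congr hae.symm, ?_⟩
  rw [integral_congr_ae hae, integral_integral hint, integral_tilted]
  have hZ : ∫ p : Noise × Noise, Real.exp (-W p.1) ∂noiseLaw.prod noiseLaw =
      Real.exp (-potential m P (m ^ 2) 0) := by
    have h := integral_fun_fst (μ := noiseLaw) (ν := noiseLaw) fun g => Real.exp (-W g)
    rw [probReal_univ, one_smul] at h
    rw [exp_neg_potential hm le_rfl hdeg hpos hlead, h]
  rw [hZ]
  -- change variables by the involution
  let e : Noise × Noise ≃ᵐ Noise × Noise :=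
    MeasurableEquiv.ofInvolutive (mixNoise m M) (mixNoise_mixNoise hm hM) hmix.measurable
  have hch := hmix.integral_comp e.measurableEmbedding
    (fun p : Noise × Noise => F (X p.1) * Real.exp (-W (mixNoise m M p).1))
  simp only [mixNoise_mixNoise hm hM] at hch
  rw [← hch, ← integral_const_mul]
  congr 1
  funext p
  rw [smul_eq_mul, Real.exp_neg (potential m P (m ^ 2) 0), div_inv_eq_mul]
  ring

/-! ### Fourier analysis on the lattice -/

section Lattice

open UnitAddTorus

variable (N : ℕ) [NeZero N]

theorem mFourier_add_point (n : Freq) (x y : Torus) :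
    mFourier n (x + y) = mFourier n x * mFourier n y := by
  simp only [mFourier, ContinuousMap.coe_mk, ← Finset.prod_mul_distrib]
  refine Finset.prod_congr rfl fun i _ => ?_
  simp only [fourier_apply, Pi.add_apply, smul_add, AddCircle.toCircle_add, Circle.coe_mul]

theorem latticePoint_add (x y : Site N) :
    latticePoint N (x + y) = latticePoint N x + latticePoint N y := by
  funext i
  simp [latticePoint]

/-- The phase `2 π k / N`. -/
noncomputable def latticePhase (k : ℤ) : ℝ := 2 * Real.pi * k / N

theorem mFourier_latticePoint_single (n : Freq) (i : Fin 2) :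
    mFourier n (latticePoint N (Pi.single i 1)) =
      Complex.exp ((latticePhase N (n i) : ℝ) * Complex.I) := by
  simp only [mFourier, ContinuousMap.coe_mk]
  rw [Finset.prod_eq_single i]
  · rw [latticePoint, Pi.single_eq_same]
    have h := ZMod.toAddCircle_intCast (N := N) 1
    rw [Int.cast_one] at h
    rw [h, fourier_coe_apply, latticePhase]
    congr 1
    push_cast
    ring
  · intro j _ hj
    simp [latticePoint, Pi.single_eq_of_ne hj]
  · simp

theorem exp_latticePhase_eq_one {k : ℤ}
    (h : Complex.exp ((latticePhase N k : ℝ) * Complex.I) = 1) : (N : ℤ) ∣ k := by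
  rw [Complex.exp_eq_one_iff] at h
  obtain ⟨j, hj⟩ := h
  refine ⟨j, ?_⟩
  have hN : (N : ℂ) ≠ 0 := by exact_mod_cast NeZero.ne N
  have hpi : (Real.pi : ℂ) ≠ 0 := by exact_mod_cast Real.pi_ne_zero
  have hI := Complex.I_ne_zero
  rw [latticePhase] at hj
  push_cast at hj
  have : (k : ℂ) = N * j := by
    field_simp at hj
    rw [hj]
  exact_mod_cast this

theorem sum_mFourier_eq_zero {k : Freq} (hk : ∃ i, ¬ (N : ℤ) ∣ k i) :
    ∑ x : Site N, mFourier k (latticePoint N x) = 0 := by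
  obtain ⟨i, hi⟩ := hk
  have h1 : ∑ x : Site N, mFourier k (latticePoint N (x + Pi.single i 1)) =
      ∑ x : Site N, mFourier k (latticePoint N x) :=
    Equiv.sum_comp (Equiv.addRight (Pi.single i 1 : Site N)) fun x => mFourier k (latticePoint N x)
  simp only [latticePoint_add, mFourier_add_point, ← Finset.sum_mul,
    mFourier_latticePoint_single] at h1
  by_contra h0
  exact hi (exp_latticePhase_eq_one N (mul_left_cancel₀ h0 (h1.trans (mul_one _).symm)))

theorem mFourier_latticePoint_of_dvd {k : Freq} (hk : ∀ i, (N : ℤ) ∣ k i) (x : Site N) :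
    mFourier k (latticePoint N x) = 1 := by
  simp only [mFourier, ContinuousMap.coe_mk, latticePoint]
  refine Finset.prod_eq_one fun i _ => ?_
  obtain ⟨j, hj⟩ := hk i
  have hx : (N : ℤ) • ZMod.toAddCircle (x i) = 0 := by
    rw [← map_zsmul]
    simp
  rw [hj, fourier_apply, mul_comm, mul_smul, hx, smul_zero, AddCircle.toCircle_zero,
    Circle.coe_one]

theorem sum_mFourier (k : Freq) [Decidable (∀ i, (N : ℤ) ∣ k i)] :
    ∑ x : Site N, mFourier k (latticePoint N x) =
      if ∀ i, (N : ℤ) ∣ k i then (N : ℂ) ^ 2 else 0 := by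
  split_ifs with h
  · simp [mFourier_latticePoint_of_dvd N h]
  · push Not at h
    exact sum_mFourier_eq_zero N h

/-- The uniform probability measure on the lattice with mesh `1 / N`. -/
noncomputable def latticeMeasure : Measure Torus :=
  ((N : ℝ≥0∞) ^ 2)⁻¹ • ∑ x : Site N, Measure.dirac (latticePoint N x)

theorem integral_latticeMeasure {E : Type*} [NormedAddCommGroup E] [NormedSpace ℝ E]
    [CompleteSpace E] (f : Torus → E) :
    ∫ x, f x ∂latticeMeasure N = (1 / (N : ℝ) ^ 2) • ∑ x : Site N, f (latticePoint N x) := by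
  rw [latticeMeasure, integral_smul_measure, integral_finsetSum_measure]
  · simp
  · intro x _
    exact integrable_dirac (by simp)

instance : IsProbabilityMeasure (latticeMeasure N) := by
  refine ⟨?_⟩
  have h : ((N : ℝ≥0∞) ^ 2) ≠ 0 := by
    have := NeZero.ne N
    positivity
  rw [latticeMeasure, Measure.smul_apply, Measure.finsetSum_apply]
  simp only [measure_univ, Finset.sum_const, Finset.card_univ, Fintype.card_fun, ZMod.card,
    Fintype.card_fin, smul_eq_mul, nsmul_eq_mul, mul_one]
  push_cast
  exact ENNReal.inv_mul_cancel h (by finiteness)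

theorem sampling_latticeMeasure :
    Sampling (latticeMeasure N) (Set.range (latticePoint N)) N where
  ae_mem := by
    rw [ae_iff, latticeMeasure, Measure.smul_apply, Measure.finsetSum_apply]
    simp
  integral_mFourier k hk := by
    rw [integral_latticeMeasure, sum_mFourier_eq_zero N hk, smul_zero]

theorem mem_latticeDual {n : Freq} :
    n ∈ latticeDual N ↔ ∀ i, -(N : ℤ) < 2 * n i ∧ 2 * n i ≤ N := by
  simp only [latticeDual, Fintype.mem_piFinset, Finset.mem_filter, Finset.mem_Icc]
  exact forall_congr' fun i => ⟨fun h => h.2, fun h => ⟨by omega, h⟩⟩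

theorem card_latticeDual : (latticeDual N).card = N ^ 2 := by
  have h : ((Finset.Icc (-(N : ℤ)) N).filter fun j => -(N : ℤ) < 2 * j ∧ 2 * j ≤ N) =
      Finset.Icc (-(((N : ℤ) - 1) / 2)) ((N : ℤ) / 2) := by
    ext j
    simp only [Finset.mem_filter, Finset.mem_Icc]
    have := NeZero.pos N
    omega
  rw [latticeDual, Fintype.card_piFinset, h]
  simp only [Int.card_Icc, Finset.prod_const, Finset.card_univ, Fintype.card_fin]
  congr 1
  have := NeZero.pos N
  omega

theorem latticeDual_subset : latticeDual N ⊆ freqBox N := by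
  intro n hn
  rw [mem_latticeDual] at hn
  rw [freqBox, Fintype.mem_piFinset]
  intro i
  have := hn i
  rw [Finset.mem_Icc]
  omega

/-- The reflection `n ↦ -n` of the dual lattice, modulo `N`. -/
def dualNeg (n : Freq) : Freq := fun i => if 2 * n i = N then n i else -n i

theorem dualNeg_mem {n : Freq} (hn : n ∈ latticeDual N) : dualNeg N n ∈ latticeDual N := by
  rw [mem_latticeDual] at hn ⊢
  intro i
  have := hn i
  rw [dualNeg]
  split_ifs <;> omega

theorem dualNeg_dualNeg {n : Freq} (hn : n ∈ latticeDual N) : dualNeg N (dualNeg N n) = n := by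
  rw [mem_latticeDual] at hn
  funext i
  have := hn i
  simp only [dualNeg]
  split_ifs <;> omega

theorem norm_dualNeg (n : Freq) : ‖dualNeg N n‖ = ‖n‖ := by
  have h : ∀ i, ‖dualNeg N n i‖ = ‖n i‖ := by
    intro i
    rw [dualNeg]
    split_ifs
    exacts [rfl, norm_neg _]
  simp only [Pi.norm_def]
  congr 2
  funext i
  exact NNReal.eq (h i)

theorem mFourier_congr {n k : Freq} (h : ∀ i, (N : ℤ) ∣ n i - k i) (x : Site N) :
    mFourier n (latticePoint N x) = mFourier k (latticePoint N x) := by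
  have h1 := mFourier_latticePoint_of_dvd N (k := n - k) h x
  have h2 : n = n - k + k := by abel
  rw [h2, mFourier_add, h1, one_mul]

theorem mFourier_dualNeg (n : Freq) (x : Site N) :
    mFourier (dualNeg N n) (latticePoint N x) = mFourier (-n) (latticePoint N x) := by
  refine mFourier_congr N (fun i => ?_) x
  rw [dualNeg, Pi.neg_apply]
  split_ifs with h
  · exact ⟨1, by omega⟩
  · simp

/-- Covariances with reflection invariant multipliers on the dual lattice are symmetric. -/
theorem symmCov_latticeDual {b : Freq → ℝ} (hb : ∀ n ∈ latticeDual N, b (dualNeg N n) = b n)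
    (K : ℕ) : SymmCov (Set.range (latticePoint N)) (latticeDual N ∩ freqBox K) b := by
  refine symmCov_of_involution (dualNeg N) (fun n hn => ?_) (fun n hn => ?_) (fun n hn => ?_) ?_
  · rw [Finset.mem_inter, mem_freqBox] at hn ⊢
    exact ⟨dualNeg_mem N hn.1, by rw [norm_dualNeg]; exact hn.2⟩
  · exact dualNeg_dualNeg N (Finset.mem_inter.1 hn).1
  · exact hb n (Finset.mem_inter.1 hn).1
  · rintro _ ⟨x, rfl⟩ n _
    exact mFourier_dualNeg N n x

theorem eq_of_dvd_of_mem_latticeDual {n k : Freq} (hn : n ∈ latticeDual N)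
    (hk : k ∈ latticeDual N) (h : ∀ i, (N : ℤ) ∣ n i - k i) : n = k := by
  rw [mem_latticeDual] at hn hk
  funext i
  obtain ⟨j, hj⟩ := h i
  have h1 := hn i
  have h2 := hk i
  have hlt : |(N : ℤ) * j| < N := by
    rw [← hj, abs_lt]
    constructor <;> linarith
  have hj0 : j = 0 := by
    by_contra h0
    rw [abs_mul, Nat.abs_cast] at hlt
    have : 1 ≤ |j| := Int.one_le_abs h0
    nlinarith
  rw [hj0] at hj
  linarith

/-- Orthogonality of the Hartley functions on the lattice. -/
theorem sum_hartley_mul {n k : Freq} (hn : n ∈ latticeDual N) (hk : k ∈ latticeDual N) :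
    ∑ x : Site N, hartley n (latticePoint N x) * hartley k (latticePoint N x) =
      if n = k then (N : ℝ) ^ 2 else 0 := by
  classical
  have e : ∀ x, hartley n x * hartley k x = (mFourier (n + -k) x).re + (mFourier (n + k) x).im := by
    intro x
    rw [mFourier_add, mFourier_add, mFourier_neg]
    simp only [hartley, Complex.mul_re, Complex.mul_im, Complex.conj_re, Complex.conj_im]
    ring
  simp only [e, Finset.sum_add_distrib, ← Complex.re_sum, ← Complex.im_sum, sum_mFourier]
  have h2 : (if ∀ i, (N : ℤ) ∣ (n + k) i then (N : ℂ) ^ 2 else 0).im = 0 := by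
    split_ifs
    · have : ((N : ℂ) ^ 2) = (((N : ℝ) ^ 2 : ℝ) : ℂ) := by push_cast; rfl
      rw [this, Complex.ofReal_im]
    · rfl
  rw [h2, add_zero]
  by_cases h : n = k
  · subst h
    simp only [add_neg_cancel, Pi.zero_apply, dvd_zero, implies_true, if_true]
    have : ((N : ℂ) ^ 2) = (((N : ℝ) ^ 2 : ℝ) : ℂ) := by push_cast; rfl
    rw [this, Complex.ofReal_re]
  · rw [if_neg h, if_neg, Complex.zero_re]
    intro h'
    exact h (eq_of_dvd_of_mem_latticeDual N hn hk h')

/-- Completeness of the Hartley functions on the lattice. -/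
theorem sum_latticeDual_hartley_mul (x y : Site N) :
    ∑ n ∈ latticeDual N, hartley n (latticePoint N x) * hartley n (latticePoint N y) =
      if x = y then (N : ℝ) ^ 2 else 0 := by
  have hN : (N : ℝ) ≠ 0 := by exact_mod_cast NeZero.ne N
  set H : Matrix (latticeDual N) (Site N) ℝ :=
    Matrix.of fun n x => hartley n (latticePoint N x) / N with hH
  have h1 : H * H.transpose = 1 := by
    ext n k
    rw [Matrix.mul_apply, Matrix.one_apply]
    simp only [hH, Matrix.transpose_apply, Matrix.of_apply, div_mul_div_comm, ← Finset.sum_div]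
    rw [sum_hartley_mul N n.2 k.2]
    simp only [Subtype.ext_iff]
    split_ifs
    · rw [← sq, div_self (by positivity)]
    · rw [zero_div]
  have hcard : Fintype.card (latticeDual N) = Fintype.card (Site N) := by
    rw [Fintype.card_coe, card_latticeDual]
    simp
  have h2 := (Matrix.mul_eq_one_comm_of_equiv (Fintype.equivOfCardEq hcard)).1 h1
  have h3 := congr_fun (congr_fun h2 x) y
  rw [Matrix.mul_apply, Matrix.one_apply] at h3
  simp only [hH, Matrix.transpose_apply, Matrix.of_apply, div_mul_div_comm, ← Finset.sum_div] at h3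
  rw [Finset.sum_coe_sort (latticeDual N) fun n =>
    hartley n (latticePoint N x) * hartley n (latticePoint N y), div_eq_iff (by positivity)] at h3
  rw [h3]
  split_ifs
  · ring
  · ring

/-- The eigenvalue of `-Δ^ε` at the frequency `n`. -/
noncomputable def latticeSymbol (n : Freq) : ℝ :=
  ∑ i, 4 * (N : ℝ) ^ 2 * Real.sin (Real.pi * n i / N) ^ 2

theorem latticeSymbol_nonneg (n : Freq) : 0 ≤ latticeSymbol N n :=
  Finset.sum_nonneg fun i _ => by positivity

/-- The multiplier of `(-Δ^ε + M)⁻¹`. -/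
noncomputable def latticeMultiplier (M : ℝ) (n : Freq) : ℝ := 1 / (latticeSymbol N n + M)

theorem latticeMultiplier_pos {M : ℝ} (hM : 0 < M) (n : Freq) : 0 < latticeMultiplier N M n := by
  have := latticeSymbol_nonneg N n
  rw [latticeMultiplier]
  positivity

theorem latticeSymbol_dualNeg (n : Freq) : latticeSymbol N (dualNeg N n) = latticeSymbol N n := by
  refine Finset.sum_congr rfl fun i _ => ?_
  rw [dualNeg]
  split_ifs
  · rfl
  · push_cast
    rw [mul_neg, neg_div, Real.sin_neg, neg_sq]

theorem latticeMultiplier_dualNeg (M : ℝ) (n : Freq) :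
    latticeMultiplier N M (dualNeg N n) = latticeMultiplier N M n := by
  rw [latticeMultiplier, latticeSymbol_dualNeg, latticeMultiplier]

theorem hartley_add_add_hartley_sub (n : Freq) (x : Site N) (i : Fin 2) :
    hartley n (latticePoint N (x + Pi.single i 1)) + hartley n (latticePoint N (x - Pi.single i 1)) =
      2 * Real.cos (latticePhase N (n i)) * hartley n (latticePoint N x) := by
  set z := Complex.exp ((latticePhase N (n i) : ℝ) * Complex.I) with hz
  have h1 : mFourier n (latticePoint N (x + Pi.single i 1)) = mFourier n (latticePoint N x) * z := by
    rw [latticePoint_add, mFourier_add_point, mFourier_latticePoint_single]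
  have h2 : mFourier n (latticePoint N (x - Pi.single i 1)) =
      mFourier n (latticePoint N x) * starRingEnd ℂ z := by
    have h3 : mFourier n (latticePoint N x) =
        mFourier n (latticePoint N (x - Pi.single i 1)) * z := by
      rw [hz, ← mFourier_latticePoint_single, ← mFourier_add_point, ← latticePoint_add, sub_add_cancel]
    rw [h3, mul_assoc, Complex.mul_conj, hz, Complex.normSq_eq_norm_sq,
      Complex.norm_exp_ofReal_mul_I]
    simp
  simp only [hartley, h1, h2, Complex.mul_re, Complex.mul_im, Complex.conj_re, Complex.conj_im]
  rw [hz, Complex.exp_ofReal_mul_I_re, Complex.exp_ofReal_mul_I_im]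
  ring

theorem latticeLaplacian_hartley (n : Freq) :
    latticeLaplacian N (fun x => hartley n (latticePoint N x)) =
      fun x => -latticeSymbol N n * hartley n (latticePoint N x) := by
  funext x
  change (N : ℝ) ^ 2 * ∑ i : Fin 2, _ = _
  rw [latticeSymbol, Finset.mul_sum, ← Finset.sum_neg_distrib, Finset.sum_mul]
  refine Finset.sum_congr rfl fun i _ => ?_
  have h := hartley_add_add_hartley_sub N n x i
  have hcos : Real.cos (latticePhase N (n i)) = 1 - 2 * Real.sin (Real.pi * n i / N) ^ 2 := by
    rw [latticePhase, show 2 * Real.pi * (n i : ℝ) / N = 2 * (Real.pi * n i / N) by ring,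
      Real.cos_two_mul, Real.cos_sq']
    ring
  rw [hcos] at h
  linear_combination (N : ℝ) ^ 2 * h

/-- The spectral decomposition of the lattice covariance. -/
theorem latticeCov_eq {M : ℝ} (hM : 0 < M) (x y : Site N) :
    latticeCov N M x y = ∑ n ∈ latticeDual N, latticeMultiplier N M n *
      (hartley n (latticePoint N x) * hartley n (latticePoint N y)) := by
  have hN : (N : ℝ) ≠ 0 := by exact_mod_cast NeZero.ne N
  set A : Matrix (Site N) (Site N) ℝ :=
    M • (1 : Matrix (Site N) (Site N) ℝ) - LinearMap.toMatrix' (latticeLaplacian N) with hA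
  set C : Matrix (Site N) (Site N) ℝ := fun x y => ∑ n ∈ latticeDual N, latticeMultiplier N M n *
      (hartley n (latticePoint N x) * hartley n (latticePoint N y)) / (N : ℝ) ^ 2 with hC
  have hvec : ∀ n, A.mulVec (fun x => hartley n (latticePoint N x)) =
      fun x => (latticeSymbol N n + M) * hartley n (latticePoint N x) := by
    intro n
    rw [hA, Matrix.sub_mulVec, Matrix.smul_mulVec, Matrix.one_mulVec,
      LinearMap.toMatrix'_mulVec, latticeLaplacian_hartley]
    funext x
    simp only [Pi.sub_apply, Pi.smul_apply, smul_eq_mul]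
    ring
  have hAC : A * C = 1 := by
    ext x y
    rw [Matrix.mul_apply, Matrix.one_apply]
    have e : ∀ z, A x z * C z y = ∑ n ∈ latticeDual N, latticeMultiplier N M n *
        hartley n (latticePoint N y) / (N : ℝ) ^ 2 * (A x z * hartley n (latticePoint N z)) := by
      intro z
      rw [hC, Finset.mul_sum]
      exact Finset.sum_congr rfl fun n _ => by ring
    simp only [e]
    rw [Finset.sum_comm]
    have e2 : ∀ n, ∑ z, A x z * hartley n (latticePoint N z) =
        (latticeSymbol N n + M) * hartley n (latticePoint N x) := fun n =>
      congr_fun (hvec n) x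
    simp only [← Finset.mul_sum, e2]
    have h := sum_latticeDual_hartley_mul N x y
    calc _ = (∑ n ∈ latticeDual N, hartley n (latticePoint N x) * hartley n (latticePoint N y)) /
          (N : ℝ) ^ 2 := by
          rw [Finset.sum_div]
          refine Finset.sum_congr rfl fun n _ => ?_
          have := latticeSymbol_nonneg N n
          rw [latticeMultiplier]
          field_simp
      _ = _ := by
          rw [h]
          split_ifs
          · exact div_self (by positivity)
          · exact zero_div _
  rw [latticeCov, ← hA, Matrix.inv_eq_right_inv hAC, Matrix.smul_apply, hC, smul_eq_mul,
    Finset.mul_sum]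
  refine Finset.sum_congr rfl fun n _ => ?_
  field_simp

end Lattice

/-! ### Lattice fields as finite Gaussian fields -/

section Law

variable (N : ℕ) [NeZero N]

/-- The restriction of a finite field to the lattice. -/
noncomputable def sampleField (S : Finset Freq) (s : Freq → ℝ) (g : Noise) : LatticeField N :=
  WithLp.toLp 2 fun x => finField S s g (latticePoint N x)

theorem sampleField_apply (S : Finset Freq) (s : Freq → ℝ) (g : Noise) (x : Site N) :
    sampleField N S s g x = finField S s g (latticePoint N x) := rfl

theorem continuous_sampleField (S : Finset Freq) (s : Freq → ℝ) :
    Continuous (sampleField N S s) := by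
  unfold sampleField finField
  fun_prop

/-- The covariance matrix of the restriction of a finite field to the lattice. -/
noncomputable def sampleCov (S : Finset Freq) (b : Freq → ℝ) : Matrix (Site N) (Site N) ℝ :=
  Matrix.of fun x y =>
    ∑ n ∈ S, b n * (hartley n (latticePoint N x) * hartley n (latticePoint N y))

theorem posSemidef_sampleCov (S : Finset Freq) {b : Freq → ℝ} (hb : ∀ n ∈ S, 0 ≤ b n) :
    (sampleCov N S b).PosSemidef := by
  have e : sampleCov N S b = ∑ n ∈ S, b n • Matrix.vecMulVec
      (fun x => hartley n (latticePoint N x)) (star fun x => hartley n (latticePoint N x)) := by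
    ext x y
    rw [Matrix.sum_apply]
    rfl
  rw [e]
  refine Matrix.posSemidef_sum _ fun n hn => ?_
  exact (Matrix.posSemidef_vecMulVec_self_star _).smul (hb n hn)

/-- The restriction of a finite field to the lattice is a centred Gaussian vector. -/
theorem map_sampleField (S : Finset Freq) (s : Freq → ℝ) :
    noiseLaw.map (sampleField N S s) =
      multivariateGaussian 0 (sampleCov N S fun n => s n ^ 2) := by
  have hm := (continuous_sampleField N S s).measurable
  have := Measure.isProbabilityMeasure_map (μ := noiseLaw) hm.aemeasurable
  refine Measure.ext_of_charFun (funext fun t => ?_)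
  rw [charFun_multivariateGaussian (posSemidef_sampleCov N S fun n _ => sq_nonneg _),
    charFun_apply, integral_map hm.aemeasurable (by fun_prop)]
  set a : S → ℝ := fun n => s n * ∑ x, t x * hartley n (latticePoint N x) with ha
  have h1 : ∀ g, inner ℝ (sampleField N S s g) t = ∑ n : S, a n * restrictNoise S g n := by
    intro g
    simp only [PiLp.inner_apply, sampleField_apply, finField, RCLike.inner_apply, conj_trivial, ha]
    have h := Finset.sum_coe_sort S fun n =>
      (s n * ∑ x, t x * hartley n (latticePoint N x)) * g n
    refine Eq.trans ?_ h.symm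
    simp only [Finset.mul_sum, Finset.sum_mul]
    rw [Finset.sum_comm]
    exact Finset.sum_congr rfl fun n _ => Finset.sum_congr rfl fun x _ => by ring
  have h2 : ∫ g, Complex.exp ((∑ n : S, a n * restrictNoise S g n : ℝ) * Complex.I) ∂noiseLaw =
      Complex.exp (-((∑ n, a n ^ 2 : ℝ) : ℂ) / 2) := by
    have hm1 := measurePreserving_restrictNoise S
    have hc : Continuous fun g : S → ℝ => ∑ n : S, a n * g n := by fun_prop
    have h3 : ∫ y : ℝ, Complex.exp (y * Complex.I) ∂gaussianReal 0 (∑ n, a n ^ 2).toNNReal =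
        Complex.exp (-((∑ n, a n ^ 2 : ℝ) : ℂ) / 2) := by
      have h := charFun_gaussianReal (μ := 0) (v := (∑ n, a n ^ 2).toNNReal) 1
      rw [charFun_apply_real] at h
      simp only [Complex.ofReal_one, one_mul] at h
      rw [h, Real.coe_toNNReal _ (Finset.sum_nonneg fun i _ => sq_nonneg _)]
      congr 1
      simp
      ring
    rw [← h3, ← map_sum_mul_gaussPi, integral_map hc.aemeasurable (by fun_prop), ← hm1.map_eq,
      integral_map hm1.aemeasurable (Continuous.aestronglyMeasurable (by fun_prop))]
  simp only [h1, h2]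
  congr 1
  rw [inner_zero_right, Complex.ofReal_zero, zero_mul, zero_sub, neg_div, neg_inj]
  congr 2
  simp only [dotProduct, Matrix.mulVec, sampleCov, Matrix.of_apply, ha, Finset.mul_sum,
    Finset.sum_mul]
  rw [Finset.sum_coe_sort S fun n => (∑ x, s n * (t x * hartley n (latticePoint N x))) ^ 2]
  simp only [sq, Finset.sum_mul_sum]
  rw [Finset.sum_comm]
  refine Finset.sum_congr rfl fun x _ => ?_
  rw [Finset.sum_comm]
  refine Finset.sum_congr rfl fun y _ => Finset.sum_congr rfl fun n _ => ?_
  ring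

/-- The square roots of the multipliers of `(-Δ^ε + M)⁻¹` on the dual lattice, extended by zero. -/
noncomputable def latticeRoot (M : ℝ) (n : Freq) : ℝ :=
  if n ∈ latticeDual N then √(latticeMultiplier N M n) else 0

theorem latticeRoot_sq {M : ℝ} (hM : 0 < M) {n : Freq} (hn : n ∈ latticeDual N) :
    latticeRoot N M n ^ 2 = latticeMultiplier N M n := by
  rw [latticeRoot, if_pos hn, Real.sq_sqrt (latticeMultiplier_pos N hM n).le]

theorem norm_sq_le_latticeSymbol {n : Freq} (hn : n ∈ latticeDual N) :
    ‖n‖ ^ 2 ≤ latticeSymbol N n := by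
  refine (sum_sq_le_norm_sq n).trans (Finset.sum_le_sum fun i _ => ?_)
  have hN : (0 : ℝ) < N := by exact_mod_cast NeZero.pos N
  rw [mem_latticeDual] at hn
  have h1 : |(n i : ℝ)| ≤ N / 2 := by
    have h2 : (-(N : ℝ)) < 2 * n i := by exact_mod_cast (hn i).1
    have h3 : (2 : ℝ) * n i ≤ N := by exact_mod_cast (hn i).2
    rw [abs_le]
    constructor <;> linarith
  have h2 : |Real.pi * n i / N| ≤ Real.pi / 2 := by
    rw [abs_div, abs_mul, abs_of_pos Real.pi_pos, abs_of_pos hN, div_le_iff₀ hN]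
    nlinarith [Real.pi_pos]
  have h3 := Real.mul_abs_le_abs_sin h2
  rw [abs_div, abs_mul, abs_of_pos Real.pi_pos, abs_of_pos hN] at h3
  have h4 : 2 * |(n i : ℝ)| ≤ N * |Real.sin (Real.pi * n i / N)| := by
    have e : 2 / Real.pi * (Real.pi * |(n i : ℝ)| / N) = 2 * |(n i : ℝ)| / N := by
      field_simp
    rw [e, div_le_iff₀ hN] at h3
    linarith
  have h5 := pow_le_pow_left₀ (by positivity) h4 2
  rw [mul_pow, mul_pow, sq_abs, sq_abs] at h5
  nlinarith [sq_nonneg (n i : ℝ)]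

theorem latticeMultiplier_le {M : ℝ} (hM : 0 < M) {n : Freq} (hn : n ∈ latticeDual N) :
    latticeMultiplier N M n ≤ (2 / M + 2) * bracket n ^ (-2 : ℝ) :=
  inv_add_le_bracket hM n (norm_sq_le_latticeSymbol N hn)

theorem latticeRoot_sq_le {M : ℝ} (hM : 0 < M) (n : Freq) :
    latticeRoot N M n ^ 2 ≤ (2 / M + 2) * bracket n ^ (-2 : ℝ) := by
  by_cases hn : n ∈ latticeDual N
  · rw [latticeRoot_sq N hM hn]
    exact latticeMultiplier_le N hM hn
  · rw [latticeRoot, if_neg hn]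
    have := Real.rpow_nonneg (bracket_pos n).le (-2)
    rw [zero_pow two_ne_zero]
    positivity

theorem fieldData_lattice {M : ℝ} (hM : 0 < M) :
    FieldData (2 / M + 2) (latticeMeasure N) (Set.range (latticePoint N)) N (latticeDual N)
      (latticeRoot N M) where
  pos := NeZero.pos N
  sampling := sampling_latticeMeasure N
  subset := latticeDual_subset N
  le := latticeRoot_sq_le N hM
  symm := symmCov_latticeDual N fun n hn => by
    rw [latticeRoot_sq N hM hn, latticeRoot_sq N hM (dualNeg_mem N hn), latticeMultiplier_dualNeg]

theorem latticeMultiplier_anti {M M' : ℝ} (hM : 0 < M) (h : M ≤ M') (n : Freq) :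
    latticeMultiplier N M' n ≤ latticeMultiplier N M n := by
  have h0 := latticeSymbol_nonneg N n
  rw [latticeMultiplier, latticeMultiplier]
  gcongr

/-- The square roots of the multipliers of the difference of two lattice covariances on the dual
lattice, extended by zero. -/
noncomputable def latticeDiffRoot (m M : ℝ) (n : Freq) : ℝ :=
  if n ∈ latticeDual N then √(latticeMultiplier N (m ^ 2) n - latticeMultiplier N M n) else 0

theorem latticeDiffRoot_sq {m M : ℝ} (hm : 0 < m) (hM : m ^ 2 ≤ M) {n : Freq}
    (hn : n ∈ latticeDual N) : latticeDiffRoot N m M n ^ 2 =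
      latticeMultiplier N (m ^ 2) n - latticeMultiplier N M n := by
  rw [latticeDiffRoot, if_pos hn,
    Real.sq_sqrt (sub_nonneg.2 (latticeMultiplier_anti N (by positivity) hM n))]

theorem latticeDiffRoot_sq_le {m M : ℝ} (hm : 0 < m) (hM : m ^ 2 ≤ M) (n : Freq) :
    latticeDiffRoot N m M n ^ 2 ≤
      (M - m ^ 2) * ((2 / m ^ 2 + 2) * (2 / M + 2)) * bracket n ^ (-4 : ℝ) := by
  have hm2 : 0 < m ^ 2 := by positivity
  have hM0 := hm2.trans_le hM
  have hMm : 0 ≤ M - m ^ 2 := sub_nonneg.2 hM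
  by_cases hn : n ∈ latticeDual N
  · rw [latticeDiffRoot_sq N hm hM hn]
    have h1 := latticeMultiplier_le N hm2 hn
    have h2 := latticeMultiplier_le N hM0 hn
    have h1' := latticeMultiplier_pos N hm2 n
    have h2' := latticeMultiplier_pos N hM0 n
    have e : latticeMultiplier N (m ^ 2) n - latticeMultiplier N M n =
        (M - m ^ 2) * (latticeMultiplier N (m ^ 2) n * latticeMultiplier N M n) := by
      have h0 := latticeSymbol_nonneg N n
      rw [latticeMultiplier, latticeMultiplier]
      field_simp
      ring
    rw [e, mul_assoc]
    refine mul_le_mul_of_nonneg_left ?_ hMm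
    refine (mul_le_mul h1 h2 h2'.le (h1'.le.trans h1)).trans (le_of_eq ?_)
    rw [show (-4 : ℝ) = -2 + -2 by norm_num, Real.rpow_add (bracket_pos n)]
    ring
  · rw [latticeDiffRoot, if_neg hn]
    have := Real.rpow_nonneg (bracket_pos n).le (-4)
    rw [zero_pow two_ne_zero]
    positivity

theorem map_sampleField_latticeRoot {M : ℝ} (hM : 0 < M) :
    noiseLaw.map (sampleField N (latticeDual N) (latticeRoot N M)) =
      multivariateGaussian 0 (latticeCov N M) := by
  rw [map_sampleField]
  congr 1
  ext x y
  rw [latticeCov_eq N hM, sampleCov, Matrix.of_apply]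
  exact Finset.sum_congr rfl fun n hn => by rw [latticeRoot_sq N hM hn]

theorem map_sampleField_latticeDiffRoot {m M : ℝ} (hm : 0 < m) (hM : m ^ 2 ≤ M) :
    noiseLaw.map (sampleField N (latticeDual N) (latticeDiffRoot N m M)) =
      multivariateGaussian 0 (latticeCov N (m ^ 2) - latticeCov N M) := by
  have hm2 : 0 < m ^ 2 := by positivity
  rw [map_sampleField]
  congr 1
  ext x y
  rw [Matrix.sub_apply, latticeCov_eq N hm2, latticeCov_eq N (hm2.trans_le hM), sampleCov,
    Matrix.of_apply, ← Finset.sum_sub_distrib]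
  exact Finset.sum_congr rfl fun n hn => by rw [latticeDiffRoot_sq N hm hM hn]; ring

theorem latticeCov_diag {M : ℝ} (hM : 0 < M) :
    latticeCov N M 0 0 = ∑ n ∈ latticeDual N, latticeRoot N M n ^ 2 := by
  rw [latticeCov_eq N hM, ← (fieldData_lattice N hM).symm'.diag ⟨0, rfl⟩]
  exact Finset.sum_congr rfl fun n hn => by rw [latticeRoot_sq N hM hn]

theorem latticeCov_diag_pos {M : ℝ} (hM : 0 < M) : 0 < latticeCov N M 0 0 := by
  rw [latticeCov_diag N hM]
  refine Finset.sum_pos (fun n hn => ?_) ⟨0, ?_⟩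
  · rw [latticeRoot_sq N hM hn]
    exact latticeMultiplier_pos N hM n
  · rw [mem_latticeDual]
    intro i
    have := NeZero.pos N
    simpa using this

/-- The lattice interaction as the interaction of a finite Gaussian field. -/
theorem latticeInteraction_sampleField {m : ℝ} (hm : 0 < m) (P : Polynomial ℝ) (g : Noise) :
    latticeInteraction N m P (sampleField N (latticeDual N) (latticeRoot N (m ^ 2)) g) =
      wickSum (latticeMeasure N) P.natDegree (shiftCoeff P 0 fun _ => 0) (latticeDual N)
        (latticeRoot N (m ^ 2)) g := by
  have hm2 : 0 < m ^ 2 := by positivity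
  rw [← integral_wickPoly_eq_wickSum (c := latticeCov N (m ^ 2) 0 0) P
    (by rw [zero_add, latticeCov_diag N hm2]) (latticeCov_diag_pos N hm2) continuous_const,
    integral_latticeMeasure, latticeInteraction]
  simp only [zero_add, sampleField_apply, smul_eq_mul]

theorem continuous_latticeInteraction {m : ℝ} (hm : 0 < m) (P : Polynomial ℝ) :
    Continuous (latticeInteraction N m P) := by
  have h := continuous_wick (latticeCov N (m ^ 2) 0 0)
  unfold latticeInteraction wickPoly
  simp only [wickPow_eq_wick (latticeCov_diag_pos N (show 0 < m ^ 2 by positivity))]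
  fun_prop

theorem exists_latticeInteraction_ge {m : ℝ} (hm : 0 < m) {P : Polynomial ℝ}
    (hdeg : Even P.natDegree) (hpos : 0 < P.natDegree) (hlead : 0 < P.leadingCoeff) :
    ∃ C, ∀ φ, -C ≤ latticeInteraction N m P φ := by
  obtain ⟨D, E, hD0, hlow⟩ := exists_wick_lower_bound P hdeg hpos hlead
  have hc := latticeCov_diag_pos N (show 0 < m ^ 2 by positivity)
  have hN : (N : ℝ) ≠ 0 := by exact_mod_cast NeZero.ne N
  refine ⟨D * (1 + latticeCov N (m ^ 2) 0 0) ^ E, fun φ => ?_⟩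
  have h1 : ∑ _x : Site N, -(D * (1 + latticeCov N (m ^ 2) 0 0) ^ E) ≤
      ∑ x : Site N, wickPoly P (latticeCov N (m ^ 2) 0 0) (φ x) := by
    refine Finset.sum_le_sum fun x _ => ?_
    simp only [wickPoly, wickPow_eq_wick hc]
    exact hlow _ _ hc.le
  rw [latticeInteraction, one_div, inv_mul_eq_div, le_div_iff₀ (by positivity)]
  refine le_trans (le_of_eq ?_) h1
  simp only [Finset.sum_const, Finset.card_univ, Fintype.card_fun, ZMod.card, Fintype.card_fin,
    nsmul_eq_mul]
  push_cast
  ring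

theorem integrable_exp_neg_latticeInteraction {m : ℝ} (hm : 0 < m) {P : Polynomial ℝ}
    (hdeg : Even P.natDegree) (hpos : 0 < P.natDegree) (hlead : 0 < P.leadingCoeff)
    {μ : Measure Noise} [IsFiniteMeasure μ] {ψ : Noise → LatticeField N} (hψ : Continuous ψ) :
    Integrable (fun g => Real.exp (-latticeInteraction N m P (ψ g))) μ := by
  obtain ⟨C, hC⟩ := exists_latticeInteraction_ge N hm hdeg hpos hlead
  have hc := continuous_latticeInteraction N hm P
  refine Integrable.of_bound (Continuous.aestronglyMeasurable (by fun_prop)) (Real.exp C)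
    (ae_of_all _ fun g => ?_)
  rw [Real.norm_eq_abs, abs_of_pos (Real.exp_pos _), Real.exp_le_exp]
  have := hC (ψ g)
  linarith

theorem exp_neg_latticePotential {m M : ℝ} (hm : 0 < m) (hM : 0 < M) {P : Polynomial ℝ}
    (hdeg : Even P.natDegree) (hpos : 0 < P.natDegree) (hlead : 0 < P.leadingCoeff)
    (φ : LatticeField N) : Real.exp (-latticePotential N m P M φ) =
      ∫ g, Real.exp (-latticeInteraction N m P
        (φ + sampleField N (latticeDual N) (latticeRoot N M) g)) ∂noiseLaw := by
  have hs := continuous_sampleField N (latticeDual N) (latticeRoot N M)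
  have hc := continuous_latticeInteraction N hm P
  rw [latticePotential, neg_neg, ← map_sampleField_latticeRoot N hM,
    integral_map hs.measurable.aemeasurable (Continuous.aestronglyMeasurable (by fun_prop)),
    Real.exp_log]
  exact integral_exp_pos (integrable_exp_neg_latticeInteraction N hm hdeg hpos hlead
    (by fun_prop))

end Law

/-! ### The renormalised measure on the lattice -/

section Renormalised

variable (N : ℕ) [NeZero N]

theorem latticeRoot_pos {M : ℝ} (hM : 0 < M) {n : Freq} (hn : n ∈ latticeDual N) :
    0 < latticeRoot N M n := by
  rw [latticeRoot, if_pos hn]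
  exact Real.sqrt_pos.2 (latticeMultiplier_pos N hM n)

/-- The share of the fluctuation field with covariance `c_∞^ε - c_t^ε` in the lattice free field,
extended by `1` to the frequencies outside the dual lattice. -/
noncomputable def latticeDiffShare (m M : ℝ) (n : Freq) : ℝ :=
  if n ∈ latticeDual N then latticeDiffRoot N m M n / latticeRoot N (m ^ 2) n else 1

/-- The share of the field with covariance `c_t^ε` in the lattice free field, extended by `0` to
the frequencies outside the dual lattice. -/
noncomputable def latticeMassShare (m M : ℝ) (n : Freq) : ℝ :=
  if n ∈ latticeDual N then latticeRoot N M n / latticeRoot N (m ^ 2) n else 0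

theorem latticeShare_sq {m M : ℝ} (hm : 0 < m) (hM : m ^ 2 ≤ M) (n : Freq) :
    latticeDiffShare N m M n ^ 2 + latticeMassShare N m M n ^ 2 = 1 := by
  have hm2 : 0 < m ^ 2 := by positivity
  by_cases hn : n ∈ latticeDual N
  · have h0 := latticeRoot_pos N hm2 hn
    rw [latticeDiffShare, latticeMassShare, if_pos hn, if_pos hn, div_pow, div_pow, ← add_div,
      div_eq_one_iff_eq (by positivity), latticeDiffRoot_sq N hm hM hn, latticeRoot_sq N hm2 hn,
      latticeRoot_sq N (hm2.trans_le hM) hn]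
    ring
  · rw [latticeDiffShare, latticeMassShare, if_neg hn, if_neg hn]
    norm_num

/-- The lattice counterpart of `mixNoise`; it does not alter the noise outside the dual lattice,
except for a sign in the second component. -/
noncomputable def latticeMix (m M : ℝ) : Noise × Noise → Noise × Noise :=
  reflectNoise (latticeDiffShare N m M) (latticeMassShare N m M)

theorem measurePreserving_latticeMix {m M : ℝ} (hm : 0 < m) (hM : m ^ 2 ≤ M) :
    MeasurePreserving (latticeMix N m M) (noiseLaw.prod noiseLaw) (noiseLaw.prod noiseLaw) :=
  measurePreserving_reflectNoise (latticeShare_sq N hm hM)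

theorem latticeMix_latticeMix {m M : ℝ} (hm : 0 < m) (hM : m ^ 2 ≤ M) (p : Noise × Noise) :
    latticeMix N m M (latticeMix N m M p) = p :=
  reflectNoise_reflectNoise (latticeShare_sq N hm hM) p

/-- The pathwise decomposition of the lattice free field. -/
theorem sampleField_latticeMix {m : ℝ} (hm : 0 < m) (M : ℝ) (p : Noise × Noise) :
    sampleField N (latticeDual N) (latticeRoot N (m ^ 2)) (latticeMix N m M p).1 =
      sampleField N (latticeDual N) (latticeDiffRoot N m M) p.1 +
        sampleField N (latticeDual N) (latticeRoot N M) p.2 := by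
  ext x
  rw [PiLp.add_apply, sampleField_apply, sampleField_apply, sampleField_apply, finField, finField,
    finField, ← Finset.sum_add_distrib]
  refine Finset.sum_congr rfl fun n hn => ?_
  have h0 := (latticeRoot_pos N (show 0 < m ^ 2 by positivity) hn).ne'
  simp only [latticeMix, reflectNoise, latticeDiffShare, latticeMassShare, if_pos hn]
  field_simp

/-- The interaction of the lattice free field as a function of the noise. -/
noncomputable def noiseInteraction (m : ℝ) (P : Polynomial ℝ) (g : Noise) : ℝ :=
  latticeInteraction N m P (sampleField N (latticeDual N) (latticeRoot N (m ^ 2)) g)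

theorem continuous_noiseInteraction {m : ℝ} (hm : 0 < m) (P : Polynomial ℝ) :
    Continuous (noiseInteraction N m P) :=
  (continuous_latticeInteraction N hm P).comp (continuous_sampleField N _ _)

theorem integrable_exp_neg_noiseInteraction {m : ℝ} (hm : 0 < m) {P : Polynomial ℝ}
    (hdeg : Even P.natDegree) (hpos : 0 < P.natDegree) (hlead : 0 < P.leadingCoeff) :
    Integrable (fun g => Real.exp (-noiseInteraction N m P g)) noiseLaw :=
  integrable_exp_neg_latticeInteraction N hm hdeg hpos hlead (continuous_sampleField N _ _)

theorem integral_exp_neg_noiseInteraction {m : ℝ} (hm : 0 < m) {P : Polynomial ℝ}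
    (hdeg : Even P.natDegree) (hpos : 0 < P.natDegree) (hlead : 0 < P.leadingCoeff) :
    ∫ p : Noise × Noise, Real.exp (-noiseInteraction N m P p.1) ∂noiseLaw.prod noiseLaw =
      Real.exp (-latticePotential N m P (m ^ 2) 0) := by
  have h := integral_fun_fst (μ := noiseLaw) (ν := noiseLaw)
    fun g => Real.exp (-noiseInteraction N m P g)
  rw [probReal_univ, one_smul] at h
  rw [h, exp_neg_latticePotential N hm (show 0 < m ^ 2 by positivity) hdeg hpos hlead]
  simp only [zero_add, noiseInteraction]

theorem ofReal_exp_neg_latticePotential {m M : ℝ} (hm : 0 < m) (hM : m ^ 2 ≤ M) {P : Polynomial ℝ}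
    (hdeg : Even P.natDegree) (hpos : 0 < P.natDegree) (hlead : 0 < P.leadingCoeff) (g : Noise) :
    ENNReal.ofReal (Real.exp (-latticePotential N m P M
        (sampleField N (latticeDual N) (latticeDiffRoot N m M) g))) =
      ∫⁻ g', ENNReal.ofReal (Real.exp (-noiseInteraction N m P (latticeMix N m M (g, g')).1))
        ∂noiseLaw := by
  have hs := continuous_sampleField N (latticeDual N) (latticeRoot N M)
  rw [exp_neg_latticePotential N hm ((show 0 < m ^ 2 by positivity).trans_le hM) hdeg hpos hlead,
    ofReal_integral_eq_lintegral_ofReal (integrable_exp_neg_latticeInteraction N hm hdeg hpos hlead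
      (by fun_prop)) (ae_of_all _ fun g => (Real.exp_pos _).le)]
  simp only [noiseInteraction, sampleField_latticeMix N hm]

theorem measurable_exp_neg_latticePotential {m M : ℝ} (hm : 0 < m) (hM : 0 < M)
    {P : Polynomial ℝ} (hdeg : Even P.natDegree) (hpos : 0 < P.natDegree)
    (hlead : 0 < P.leadingCoeff) :
    Measurable fun φ => Real.exp (-latticePotential N m P M φ) := by
  have hs := continuous_sampleField N (latticeDual N) (latticeRoot N M)
  have hc := continuous_latticeInteraction N hm P
  rw [funext (exp_neg_latticePotential N hm hM hdeg hpos hlead)]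
  have h : Continuous fun p : LatticeField N × Noise => Real.exp (-latticeInteraction N m P
      (p.1 + sampleField N (latticeDual N) (latticeRoot N M) p.2)) := by fun_prop
  exact (h.stronglyMeasurable.integral_prod_right' (ν := noiseLaw)).measurable

/-- The renormalised measure is the law of the fluctuation field under the tilted law of the lattice
free field. -/
theorem renormalisedMeasure_eq {m t : ℝ} (hm : 0 < m) (ht : 0 < t) {P : Polynomial ℝ}
    (hdeg : Even P.natDegree) (hpos : 0 < P.natDegree) (hlead : 0 < P.leadingCoeff) :
    renormalisedMeasure N m P t =
      ((noiseLaw.prod noiseLaw).tilted fun p => -noiseInteraction N m P p.1).map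
        fun p => sampleField N (latticeDual N) (latticeDiffRoot N m (m ^ 2 + 1 / t))
          (latticeMix N m (m ^ 2 + 1 / t) p).1 := by
  have hM : m ^ 2 ≤ m ^ 2 + 1 / t := by
    have : 0 < 1 / t := by positivity
    linarith
  have hM0 : 0 < m ^ 2 + 1 / t := by positivity
  rw [renormalisedMeasure]
  set M := m ^ 2 + 1 / t with hMdef
  set ψ := sampleField N (latticeDual N) (latticeDiffRoot N m M) with hψ
  have hψc : Continuous ψ := continuous_sampleField N _ _
  have hV := continuous_noiseInteraction N hm P
  have hmix := measurePreserving_latticeMix N hm hM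
  have hmm := hmix.measurable
  have hψm : Measurable fun p => ψ (latticeMix N m M p).1 :=
    hψc.measurable.comp (measurable_fst.comp hmm)
  refine Measure.ext_of_lintegral _ fun f hf => ?_
  rw [lintegral_smul_measure, lintegral_withDensity_eq_lintegral_mul _
    (measurable_exp_neg_latticePotential N hm hM0 hdeg hpos hlead).ennreal_ofReal hf,
    ← map_sampleField_latticeDiffRoot N hm hM, lintegral_map
      ((measurable_exp_neg_latticePotential N hm hM0 hdeg hpos hlead).ennreal_ofReal.mul hf)
      hψc.measurable,
    lintegral_map hf hψm, lintegral_tilted]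
  simp only [Pi.mul_apply]
  rw [integral_exp_neg_noiseInteraction N hm hdeg hpos hlead, smul_eq_mul]
  have hVm : Measurable fun p : Noise × Noise =>
      ENNReal.ofReal (Real.exp (-noiseInteraction N m P p.1)) :=
    (hV.measurable.comp measurable_fst).neg.exp.ennreal_ofReal
  have hfm : Measurable fun p : Noise × Noise => f (ψ p.1) :=
    hf.comp (hψc.measurable.comp measurable_fst)
  have h1 : ∀ g, ENNReal.ofReal (Real.exp (-latticePotential N m P M (ψ g))) * f (ψ g) =
      ∫⁻ g', ENNReal.ofReal (Real.exp (-noiseInteraction N m P (latticeMix N m M (g, g')).1)) *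
        f (ψ g) ∂noiseLaw := by
    intro g
    have hVg : Measurable fun g' : Noise =>
        ENNReal.ofReal (Real.exp (-noiseInteraction N m P (latticeMix N m M (g, g')).1)) :=
      (hVm.comp hmm).comp measurable_prodMk_left
    rw [lintegral_mul_const _ hVg, ← ofReal_exp_neg_latticePotential N hm hM hdeg hpos hlead]
  simp only [h1]
  rw [lintegral_lintegral ((hVm.comp hmm).mul hfm).aemeasurable, ← lintegral_const_mul' _ _
    ENNReal.ofReal_ne_top]
  -- change variables by the involution
  have hch := hmix.lintegral_comp (f := fun p : Noise × Noise =>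
    ENNReal.ofReal (Real.exp (latticePotential N m P (m ^ 2) 0)) *
      (ENNReal.ofReal (Real.exp (-noiseInteraction N m P (latticeMix N m M p).1)) * f (ψ p.1)))
    (measurable_const.mul ((hVm.comp hmm).mul hfm))
  simp only [latticeMix_latticeMix N hm hM] at hch
  rw [← hch]
  congr 1
  funext p
  rw [← mul_assoc, ← ENNReal.ofReal_mul (Real.exp_pos _).le, Real.exp_neg (latticePotential N m P _ _),
    div_inv_eq_mul, mul_comm (Real.exp _) (Real.exp _)]

theorem measurable_trigExtension : Measurable (trigExtension N) := by
  refine Continuous.measurable ?_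
  unfold trigExtension latticeFourierCoeff
  fun_prop

end Renormalised

/-! ### The continuum limit of the interaction -/

section Sampling

open UnitAddTorus

theorem tendsto_integral_mFourier (k : Freq) :
    Tendsto (fun n : ℕ => ∫ x, mFourier k x ∂latticeMeasure (n + 1)) atTop
      (𝓝 (∫ x : Torus, mFourier k x)) := by
  by_cases hk : k = 0
  · subst hk
    simp [mFourier_zero]
  · rw [integral_mFourier, if_neg hk]
    obtain ⟨i, hi⟩ : ∃ i, k i ≠ 0 := by
      by_contra h
      push Not at h
      exact hk (funext h)
    refine tendsto_const_nhds.congr' ?_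
    filter_upwards [eventually_ge_atTop (k i).natAbs] with n hn
    refine ((sampling_latticeMeasure (n + 1)).integral_mFourier k ⟨i, fun hdvd => ?_⟩).symm
    have h1 := Int.le_of_dvd (abs_pos.2 hi) ((dvd_abs _ _).2 hdvd)
    rw [Int.abs_eq_natAbs] at h1
    omega

/-- Riemann sums of continuous functions on the torus converge. -/
theorem tendsto_integral_latticeMeasure_complex (f : C(Torus, ℂ)) :
    Tendsto (fun n : ℕ => ∫ x, f x ∂latticeMeasure (n + 1)) atTop (𝓝 (∫ x : Torus, f x)) := by
  have hnorm : ∀ (ν : Measure Torus) [IsProbabilityMeasure ν] (f : C(Torus, ℂ)),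
      ‖∫ x, f x ∂ν‖ ≤ ‖f‖ := by
    intro ν _ f
    refine (norm_integral_le_of_norm_le_const (C := ‖f‖)
      (ae_of_all _ fun x => f.norm_coe_le_norm x)).trans ?_
    rw [probReal_univ, mul_one]
  have hint : ∀ (ν : Measure Torus) [IsProbabilityMeasure ν] (f : C(Torus, ℂ)),
      Integrable (fun x => f x) ν := fun ν _ f => integrable_of_continuous (by fun_prop)
  have hspan : ∀ g ∈ Submodule.span ℂ (Set.range (mFourier (d := Fin 2))),
      Tendsto (fun n : ℕ => ∫ x, g x ∂latticeMeasure (n + 1)) atTop (𝓝 (∫ x : Torus, g x)) := by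
    intro g hg
    induction hg using Submodule.span_induction with
    | mem g hg =>
      obtain ⟨k, rfl⟩ := hg
      exact tendsto_integral_mFourier k
    | zero => simp
    | add g h _ _ hg hh =>
      simp only [ContinuousMap.add_apply, integral_add (hint _ g) (hint _ h)]
      exact hg.add hh
    | smul a g _ hg =>
      simp only [ContinuousMap.smul_apply, integral_smul]
      exact hg.const_smul a
  have hdense : f ∈ closure (Submodule.span ℂ (Set.range (mFourier (d := Fin 2))) : Set C(Torus, ℂ)) := by
    rw [← Submodule.topologicalClosure_coe, span_mFourier_closure_eq_top]
    trivial
  rw [Metric.tendsto_nhds]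
  intro ε hε
  obtain ⟨g, hg, hfg⟩ := Metric.mem_closure_iff.1 hdense (ε / 3) (by positivity)
  filter_upwards [Metric.tendsto_nhds.1 (hspan g hg) (ε / 3) (by positivity)] with n hn
  have h : ∀ (ν : Measure Torus) [IsProbabilityMeasure ν],
      dist (∫ x, f x ∂ν) (∫ x, g x ∂ν) < ε / 3 := by
    intro ν _
    rw [dist_eq_norm, ← integral_sub (hint ν f) (hint ν g)]
    refine (hnorm ν (f - g)).trans_lt ?_
    rwa [← dist_eq_norm]
  refine (dist_triangle4 _ (∫ x, g x ∂latticeMeasure (n + 1)) (∫ x : Torus, g x) _).trans_lt ?_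
  have h1 := h (latticeMeasure (n + 1))
  have h2 := h volume
  rw [dist_comm] at h2
  linarith

theorem tendsto_integral_latticeMeasure {f : Torus → ℝ} (hf : Continuous f) :
    Tendsto (fun n : ℕ => ∫ x, f x ∂latticeMeasure (n + 1)) atTop (𝓝 (∫ x : Torus, f x)) := by
  have h := tendsto_integral_latticeMeasure_complex (toComplex ⟨f, hf⟩)
  have e : ∀ ν : Measure Torus, ∫ x, toComplex ⟨f, hf⟩ x ∂ν = ((∫ x, f x ∂ν : ℝ) : ℂ) := fun ν =>
    integral_complex_ofReal
  simp only [e] at h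
  exact (Complex.continuous_re.tendsto _).comp h

theorem tendsto_integral_latticeMeasure_of_tendstoUniformly {F : ℕ → Torus → ℝ} {f : Torus → ℝ}
    (hF : ∀ n, Continuous (F n)) (hf : Continuous f) (h : TendstoUniformly F f atTop) :
    Tendsto (fun n : ℕ => ∫ x, F n x ∂latticeMeasure (n + 1)) atTop (𝓝 (∫ x : Torus, f x)) := by
  rw [Metric.tendsto_nhds]
  intro ε hε
  filter_upwards [Metric.tendsto_nhds.1 (tendsto_integral_latticeMeasure hf) (ε / 2)
    (by positivity), Metric.tendstoUniformly_iff.1 h (ε / 2) (by positivity)] with n h1 h2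
  have h3 : dist (∫ x, F n x ∂latticeMeasure (n + 1)) (∫ x, f x ∂latticeMeasure (n + 1)) ≤
      ε / 2 := by
    rw [dist_eq_norm, ← integral_sub (integrable_of_continuous (hF n))
      (integrable_of_continuous hf)]
    refine (norm_integral_le_of_norm_le_const (C := ε / 2) (ae_of_all _ fun x => ?_)).trans ?_
    · rw [← dist_eq_norm, dist_comm]
      exact (h2 x).le
    · rw [probReal_univ, mul_one]
  calc _ ≤ _ := dist_triangle _ _ _
    _ < ε / 2 + ε / 2 := add_lt_add_of_le_of_lt h3 h1
    _ = ε := add_halves ε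

end Sampling

theorem tendsto_nat_mul_sin_div (a : ℝ) :
    Tendsto (fun n : ℕ => ((n + 1 : ℕ) : ℝ) * Real.sin (a / (n + 1 : ℕ))) atTop (𝓝 a) := by
  have h1 : Tendsto (fun n : ℕ => a / ((n + 1 : ℕ) : ℝ)) atTop (𝓝 0) :=
    (tendsto_natCast_atTop_atTop.comp (tendsto_add_atTop_nat 1)).const_div_atTop a
  have h2 := ((Real.continuous_sinc.tendsto 0).comp h1).const_mul a
  rw [Real.sinc_zero, mul_one] at h2
  refine h2.congr fun n => ?_
  have hn : ((n + 1 : ℕ) : ℝ) ≠ 0 := by positivity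
  by_cases ha : a = 0
  · simp [ha]
  · rw [Function.comp_apply, Real.sinc_of_ne_zero (div_ne_zero ha hn)]
    field_simp

theorem tendsto_latticeMultiplier {M : ℝ} (hM : 0 < M) (k : Freq) :
    Tendsto (fun n : ℕ => latticeMultiplier (n + 1) M k) atTop (𝓝 (covMultiplier M k)) := by
  have h1 : Tendsto (fun n : ℕ => latticeSymbol (n + 1) k) atTop
      (𝓝 ((2 * Real.pi) ^ 2 * ∑ i, (k i : ℝ) ^ 2)) := by
    rw [Finset.mul_sum]
    refine tendsto_finsetSum _ fun i _ => ?_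
    have h := ((tendsto_nat_mul_sin_div (Real.pi * k i)).pow 2).const_mul 4
    refine (h.congr fun n => by ring).trans (le_of_eq (congrArg _ (by ring)))
  have h0 : 0 ≤ (2 * Real.pi) ^ 2 * ∑ i, (k i : ℝ) ^ 2 :=
    mul_nonneg (by positivity) (Finset.sum_nonneg fun i _ => sq_nonneg _)
  exact tendsto_const_nhds.div (h1.add_const M) (by positivity)

theorem eventually_mem_latticeDual (k : Freq) : ∀ᶠ n : ℕ in atTop, k ∈ latticeDual (n + 1) := by
  have h : ∀ i : Fin 2, ∀ᶠ n : ℕ in atTop,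
      -(((n + 1 : ℕ) : ℤ)) < 2 * k i ∧ 2 * k i ≤ ((n + 1 : ℕ) : ℤ) := by
    intro i
    filter_upwards [eventually_ge_atTop (2 * (k i).natAbs)] with n hn
    omega
  filter_upwards [eventually_all.2 h] with n hn
  exact (mem_latticeDual (n + 1)).2 hn

theorem eventually_subset_latticeDual (S : Finset Freq) :
    ∀ᶠ n : ℕ in atTop, S ⊆ latticeDual (n + 1) := by
  filter_upwards [(Finset.eventually_all S).2 fun k _ => eventually_mem_latticeDual k] with n hn
  exact hn

theorem tendsto_latticeRoot {M : ℝ} (hM : 0 < M) (k : Freq) :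
    Tendsto (fun n : ℕ => latticeRoot (n + 1) M k) atTop (𝓝 (covRoot M k)) := by
  refine (tendsto_latticeMultiplier hM k).sqrt.congr' ?_
  filter_upwards [eventually_mem_latticeDual k] with n hn
  rw [latticeRoot, if_pos hn]

theorem tendsto_fieldMap {S : Finset Freq} {s : ℕ → Freq → ℝ} {s₀ : Freq → ℝ} {g : ℕ → Noise}
    {g₀ : Noise} (hs : ∀ k ∈ S, Tendsto (fun n => s n k) atTop (𝓝 (s₀ k)))
    (hg : ∀ k ∈ S, Tendsto (fun n => g n k) atTop (𝓝 (g₀ k))) :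
    Tendsto (fun n => fieldMap S (s n) (g n)) atTop (𝓝 (fieldMap S s₀ g₀)) :=
  tendsto_finsetSum _ fun k hk => ((hs k hk).mul (hg k hk)).smul_const _

/-- Without shift, the interaction is the integral of the Wick ordered polynomial of the field, which
is the coefficient of order zero for the shift by the field. -/
theorem wickSum_shiftCoeff_zero (ν : Measure Torus) [IsFiniteMeasure ν] (P : Polynomial ℝ)
    (S : Finset Freq) (s : Freq → ℝ) (g : Noise) :
    wickSum ν P.natDegree (shiftCoeff P 0 fun _ => 0) S s g =
      ∫ x, shiftCoeff P (∑ n ∈ S, s n ^ 2) (finField S s g) 0 x ∂ν := by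
  have h1 := continuous_wick (∑ n ∈ S, s n ^ 2)
  have h2 := continuous_shiftCoeff P 0 (φ := fun _ => 0) continuous_const
  rw [wickSum, ← integral_finsetSum]
  · congr 1
    funext x
    rw [← sum_coeff_wick_add, shiftCoeff]
    simp
  · intro j _
    refine integrable_of_continuous ?_
    unfold finField
    fun_prop

/-- The interaction of finitely many modes converges pathwise. -/
theorem tendsto_wickSum_lattice {M : ℝ} (hM : 0 < M) (P : Polynomial ℝ) (K : ℕ) (g : Noise) :
    Tendsto (fun n : ℕ => wickSum (latticeMeasure (n + 1)) P.natDegree (shiftCoeff P 0 fun _ => 0)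
        (latticeDual (n + 1) ∩ freqBox K) (latticeRoot (n + 1) M) g) atTop
      (𝓝 (wickSum volume P.natDegree (shiftCoeff P 0 fun _ => 0) (freqBox K) (covRoot M) g)) := by
  have hcont : ∀ s : Freq → ℝ, Continuous (finField (freqBox K) s g) := fun s => by
    unfold finField; fun_prop
  have h1 : Tendsto (fun n : ℕ => ∑ k ∈ freqBox K, latticeRoot (n + 1) M k ^ 2) atTop
      (𝓝 (∑ k ∈ freqBox K, covRoot M k ^ 2)) :=
    tendsto_finsetSum _ fun k _ => (tendsto_latticeRoot hM k).pow 2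
  have h2 : TendstoUniformly (fun n : ℕ => finField (freqBox K) (latticeRoot (n + 1) M) g)
      (finField (freqBox K) (covRoot M) g) atTop := by
    have h := ContinuousMap.tendsto_iff_tendstoUniformly.1 (tendsto_fieldMap (S := freqBox K)
      (g := fun _ => g) (fun k _ => tendsto_latticeRoot hM k) fun k _ => tendsto_const_nhds)
    have e : ∀ s : Freq → ℝ, ⇑(fieldMap (freqBox K) s g) = finField (freqBox K) s g := fun s =>
      funext (fieldMap_apply _ _ _)
    simpa only [e] using h
  have h3 := tendsto_integral_latticeMeasure_of_tendstoUniformly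
    (fun n => continuous_shiftCoeff P _ (hcont _) 0) (continuous_shiftCoeff P _ (hcont _) 0)
    (tendstoUniformly_shiftCoeff P h1 (hcont _) h2 0)
  rw [wickSum_shiftCoeff_zero]
  refine h3.congr' ?_
  filter_upwards [eventually_subset_latticeDual (freqBox K)] with n hn
  rw [wickSum_shiftCoeff_zero, Finset.inter_eq_right.2 hn]

theorem noiseInteraction_eq_wickSum (N : ℕ) [NeZero N] {m : ℝ} (hm : 0 < m) (P : Polynomial ℝ) :
    noiseInteraction N m P = wickSum (latticeMeasure N) P.natDegree (shiftCoeff P 0 fun _ => 0)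
      (latticeDual N) (latticeRoot N (m ^ 2)) :=
  funext fun g => latticeInteraction_sampleField N hm P g

theorem truncInteraction_zero {m : ℝ} (hm : 0 < m) (P : Polynomial ℝ) (K : ℕ) :
    truncInteraction m P (m ^ 2) 0 K = wickSum volume P.natDegree (shiftCoeff P 0 fun _ => 0)
      (freqBox K) (covRoot (m ^ 2)) := by
  funext g
  rw [truncInteraction_eq_wickSum hm (by positivity) P 0 K g]
  simp only [varDiff, sub_self, Finset.sum_const_zero]
  rfl

theorem exists_abs_shiftCoeff_zero_le (P : Polynomial ℝ) :
    ∃ G, ∀ j x, |shiftCoeff P 0 (fun _ => 0) j x| ≤ G := by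
  obtain ⟨G, hG0, hG⟩ := exists_forall_abs_le
    (continuous_shiftCoeff P 0 (φ := fun _ => 0) continuous_const) P.natDegree
  refine ⟨G, fun j x => ?_⟩
  rcases le_or_gt j P.natDegree with h | h
  · exact hG j h x
  · rw [shiftCoeff_eq_zero P 0 _ h, abs_zero]; exact hG0

/-- The lattice interactions converge in probability to the continuum interaction. -/
theorem tendstoInMeasure_noiseInteraction {m : ℝ} (hm : 0 < m) (P : Polynomial ℝ) :
    TendstoInMeasure noiseLaw (fun n : ℕ => noiseInteraction (n + 1) m P) atTop
      (interaction m P (m ^ 2) 0) := by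
  have hm2 : 0 < m ^ 2 := by positivity
  set f := shiftCoeff P 0 fun _ => 0 with hf
  have hcont : ∀ j, Continuous (f j) := continuous_shiftCoeff P 0 continuous_const
  obtain ⟨G, hG⟩ := exists_abs_shiftCoeff_zero_le P
  obtain ⟨C, hC0, hC⟩ := exists_integral_wickSum_sub_pow_le (B := 2 / m ^ 2 + 2) (by positivity) G
    P.natDegree
  have hD := fun n : ℕ => fieldData_lattice (n + 1) hm2
  have hI := isInteraction_interaction hm le_rfl P 0
  have hmem : ∀ n : ℕ, MemLp (wickSum (latticeMeasure (n + 1)) P.natDegree f (latticeDual (n + 1))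
      (latticeRoot (n + 1) (m ^ 2))) 2 noiseLaw := fun n => (allLp_wickSum (hD n) _ hcont).memLp_two
  have hmem' : ∀ K n : ℕ, MemLp (wickSum (latticeMeasure (n + 1)) P.natDegree f
      (latticeDual (n + 1) ∩ freqBox K) (latticeRoot (n + 1) (m ^ 2))) 2 noiseLaw := fun K n =>
    (allLp_wickSum ((hD n).inter K) _ hcont).memLp_two
  have hmemc : ∀ K : ℕ, MemLp (wickSum volume P.natDegree f (freqBox K) (covRoot (m ^ 2))) 2
      noiseLaw := fun K => (allLp_wickSum (FieldData.of_volume (covRoot_sq_le hm2)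
        (covRoot_neg _) K) _ hcont).memLp_two
  refine tendstoInMeasure_of_approx (b := fun K : ℕ => ENNReal.ofReal √(C / √((K + 1 : ℕ) : ℝ)))
    (A := fun K n => wickSum (latticeMeasure (n + 1)) P.natDegree f
      (latticeDual (n + 1) ∩ freqBox (K + 1)) (latticeRoot (n + 1) (m ^ 2)))
    (A' := fun K => wickSum volume P.natDegree f (freqBox (K + 1)) (covRoot (m ^ 2)))
    (fun K n => ?_) (fun K n => ?_) ?_ (fun K => ?_) ?_
  · rw [noiseInteraction_eq_wickSum _ hm]
    exact ((hmem n).1.edist (hmem' (K + 1) n).1)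
  · rw [noiseInteraction_eq_wickSum _ hm]
    have h1 := eLpNorm_two_le (c := C / √((K + 1 : ℕ) : ℝ)) ((hmem n).sub (hmem' (K + 1) n)) (by
      have h := hC (latticeMeasure (n + 1)) _ _ _ _ f (K + 1) 0 (hD n) hcont hG (by omega)
      simpa using h)
    refine le_trans ?_ ((eLpNorm_le_eLpNorm_of_exponent_le (p := 1) (by norm_num)
      ((hmem n).sub (hmem' (K + 1) n)).1).trans h1)
    rw [eLpNorm_one_eq_lintegral_enorm]
    simp only [edist_eq_enorm_sub, Pi.sub_apply]
    exact le_rfl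
  · have h1 : Tendsto (fun K : ℕ => √((K + 1 : ℕ) : ℝ)) atTop atTop :=
      (Real.tendsto_sqrt_atTop.comp tendsto_natCast_atTop_atTop).comp (tendsto_add_atTop_nat 1)
    have h2 := (h1.const_div_atTop C).sqrt
    rw [Real.sqrt_zero] at h2
    simpa using ENNReal.tendsto_ofReal h2
  · exact tendstoInMeasure_of_tendsto_ae (fun n => (hmem' (K + 1) n).1)
      (ae_of_all _ fun g => tendsto_wickSum_lattice hm2 P (K + 1) g)
  · refine tendstoInMeasure_of_tendsto_eLpNorm two_ne_zero (fun K => (hmemc _).1) hI.1.1 ?_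
    have h := (tendsto_add_atTop_iff_nat 1).2 hI.2
    simp only [truncInteraction_zero hm] at h
    exact h

/-- The weights of the tilted lattice measures are bounded in `L²`. -/
theorem exists_lintegral_exp_noiseInteraction_le {m : ℝ} (hm : 0 < m) {P : Polynomial ℝ}
    (hdeg : Even P.natDegree) (hpos : 0 < P.natDegree) (hlead : 0 < P.leadingCoeff) :
    ∃ C, ∀ n : ℕ, ∫⁻ g, ENNReal.ofReal (Real.exp (-(2 * noiseInteraction (n + 1) m P g)))
      ∂noiseLaw ≤ ENNReal.ofReal C := by
  have hm2 : 0 < m ^ 2 := by positivity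
  obtain ⟨G, hG⟩ := exists_abs_shiftCoeff_zero_le P
  have hcont := continuous_shiftCoeff P 0 (φ := fun _ => 0) continuous_const
  obtain ⟨D, E, hD0, hlow⟩ := exists_wick_lower_bound P hdeg hpos hlead
  obtain ⟨C, -, hC⟩ := exists_lintegral_exp_wickSum_le (B := 2 / m ^ 2 + 2) (by positivity) (2 * G)
    P.natDegree (2 * D) (by positivity) E
  refine ⟨C, fun n => ?_⟩
  have h := hC (latticeMeasure (n + 1)) _ _ _ _
    (fun j x => 2 * shiftCoeff P 0 (fun _ => 0) j x) (fieldData_lattice (n + 1) hm2)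
    (fun j => (hcont j).const_mul 2) (fun j x => ?_) (fun x _ c y hc => ?_)
  · refine le_trans (le_of_eq ?_) h
    congr 1
    funext g
    rw [noiseInteraction_eq_wickSum _ hm]
    simp only [wickSum, mul_assoc, integral_const_mul, Finset.mul_sum]
  · rw [abs_mul, abs_two]
    exact mul_le_mul_of_nonneg_left (hG j x) zero_le_two
  · have h1 := shiftCoeff_lower_bound hD0 hlow le_rfl le_rfl (fun _ => 0) x c y hc
    simp only [mul_assoc, ← Finset.mul_sum]
    rw [add_zero, one_pow, mul_one] at h1
    linarith

/-! ### The trigonometric extension of the lattice field -/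

section TrigExtension

open UnitAddTorus

variable (N : ℕ) [NeZero N]

/-- The trigonometric extension is read off from any expansion in the characters of the dual
lattice. -/
theorem trigExtension_of_eq {f : LatticeField N} {c : Freq → ℂ}
    (h : ∀ x, (f x : ℂ) = ∑ k ∈ latticeDual N, c k * mFourier k (latticePoint N x)) :
    trigExtension N f = ∑ k ∈ latticeDual N, c k • mFourier k := by
  classical
  have hN : (N : ℂ) ≠ 0 := by exact_mod_cast NeZero.ne N
  refine Finset.sum_congr rfl fun n hn => ?_
  congr 1
  have h1 : ∑ x : Site N, (f x : ℂ) * mFourier (-n) (latticePoint N x) =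
      ∑ k ∈ latticeDual N, c k * if k = n then (N : ℂ) ^ 2 else 0 := by
    simp only [h, Finset.sum_mul]
    rw [Finset.sum_comm]
    refine Finset.sum_congr rfl fun k hk => ?_
    simp only [mul_assoc, ← Finset.mul_sum, ← mFourier_add]
    rw [sum_mFourier]
    congr 1
    refine if_congr ⟨fun h => eq_of_dvd_of_mem_latticeDual N hk hn fun i => ?_, ?_⟩ rfl rfl
    · have := h i
      rwa [Pi.add_apply, Pi.neg_apply, ← sub_eq_add_neg] at this
    · rintro rfl
      simp
  rw [latticeFourierCoeff, h1]
  simp only [mul_ite, mul_zero, Finset.sum_ite_eq', hn, if_true]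
  field_simp

theorem sum_latticeDual_dualNeg {E : Type*} [AddCommMonoid E] (F : Freq → Freq → E) :
    ∑ k ∈ latticeDual N, F k (dualNeg N k) = ∑ k ∈ latticeDual N, F (dualNeg N k) k := by
  refine Finset.sum_nbij' (dualNeg N) (dualNeg N) (fun k hk => dualNeg_mem N hk)
    (fun k hk => dualNeg_mem N hk) (fun k hk => dualNeg_dualNeg N hk)
    (fun k hk => dualNeg_dualNeg N hk) fun k hk => ?_
  rw [dualNeg_dualNeg N hk]

/-- The trigonometric extension of the restriction of a Hartley function to the lattice. It is the
Hartley function itself unless `2 * n i = N` for some `i`. -/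
noncomputable def hartleyExt (n : Freq) : C(Torus, ℂ) :=
  ((1 - Complex.I) / 2) • mFourier n + ((1 + Complex.I) / 2) • mFourier (dualNeg N n)

/-- The random trigonometric polynomial built from the functions `hartleyExt`. -/
noncomputable def extMap (S : Finset Freq) (s : Freq → ℝ) (g : Noise) : C(Torus, ℂ) :=
  ∑ k ∈ S, ((s k * g k : ℝ) : ℂ) • hartleyExt N k

theorem trigExtension_sampleField (s : Freq → ℝ) (g : Noise) :
    trigExtension N (sampleField N (latticeDual N) s g) = extMap N (latticeDual N) s g := by
  set a : Freq → ℂ := fun k => ((s k * g k : ℝ) : ℂ) with ha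
  rw [trigExtension_of_eq N (c := fun k => (1 - Complex.I) / 2 * a k +
    (1 + Complex.I) / 2 * a (dualNeg N k))]
  · have e : extMap N (latticeDual N) s g =
        ∑ k ∈ latticeDual N, ((1 - Complex.I) / 2 * a k) • mFourier k +
          ∑ k ∈ latticeDual N, ((1 + Complex.I) / 2 * a k) • mFourier (dualNeg N k) := by
      rw [extMap, ← Finset.sum_add_distrib]
      refine Finset.sum_congr rfl fun k _ => ?_
      ext x
      change a k * ((1 - Complex.I) / 2 * mFourier k x +
        (1 + Complex.I) / 2 * mFourier (dualNeg N k) x) = (1 - Complex.I) / 2 * a k * mFourier k x +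
          (1 + Complex.I) / 2 * a k * mFourier (dualNeg N k) x
      ring
    rw [e, sum_latticeDual_dualNeg N fun k l => ((1 + Complex.I) / 2 * a k) • mFourier l,
      ← Finset.sum_add_distrib]
    refine Finset.sum_congr rfl fun k _ => ?_
    ext x
    exact add_mul _ _ _
  · intro x
    simp only [add_mul, Finset.sum_add_distrib]
    rw [← sum_latticeDual_dualNeg N
      fun k l => (1 + Complex.I) / 2 * a k * mFourier l (latticePoint N x), ← Finset.sum_add_distrib,
      sampleField_apply, finField]
    push_cast
    refine Finset.sum_congr rfl fun k _ => ?_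
    rw [hartley_eq, mFourier_dualNeg, ha]
    push_cast
    ring

theorem norm_hartleyExt_le (n : Freq) : ‖hartleyExt N n‖ ≤ 2 := by
  have h1 : ‖(1 - Complex.I) / 2‖ ≤ 1 := by
    rw [norm_div, Complex.norm_ofNat, div_le_one two_pos]
    refine (norm_sub_le _ _).trans ?_
    rw [norm_one, Complex.norm_I]; norm_num
  have h2 : ‖(1 + Complex.I) / 2‖ ≤ 1 := by
    rw [norm_div, Complex.norm_ofNat, div_le_one two_pos]
    refine (norm_add_le _ _).trans ?_
    rw [norm_one, Complex.norm_I]; norm_num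
  refine (norm_add_le _ _).trans ?_
  rw [norm_smul, norm_smul, mFourier_norm, mFourier_norm]
  linarith

theorem dualNeg_of_mem_freqBox {n : Freq} (hn : n ∈ freqBox ((N - 1) / 2)) :
    dualNeg N n = -n := by
  rw [freqBox, Fintype.mem_piFinset] at hn
  funext i
  have h := hn i
  rw [Finset.mem_Icc] at h
  have := NeZero.pos N
  rw [dualNeg, if_neg (by omega), Pi.neg_apply]

theorem hartleyExt_of_mem_freqBox {n : Freq} (hn : n ∈ freqBox ((N - 1) / 2)) :
    hartleyExt N n = toComplex (hartleyMap n) := by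
  ext x
  change _ = ((hartley n x : ℝ) : ℂ)
  rw [hartley_eq, hartleyExt, dualNeg_of_mem_freqBox N hn]
  rfl

theorem toComplex_sub (f h : C(Torus, ℝ)) : toComplex (f - h) = toComplex f - toComplex h := by
  ext x
  exact Complex.ofReal_sub _ _

theorem enorm_toComplex_le (f : C(Torus, ℝ)) : ‖toComplex f‖ₑ ≤ ‖f‖ₑ := by
  rw [← ofReal_norm, ← ofReal_norm]
  refine ENNReal.ofReal_le_ofReal ((ContinuousMap.norm_le _ (norm_nonneg _)).2 fun x => ?_)
  refine le_trans (le_of_eq ?_) (f.norm_coe_le_norm x)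
  exact Complex.norm_real _

theorem extMap_of_subset {S : Finset Freq} (hS : S ⊆ freqBox ((N - 1) / 2)) (s : Freq → ℝ)
    (g : Noise) : extMap N S s g = toComplex (fieldMap S s g) := by
  ext x
  change _ = ((fieldMap S s g x : ℝ) : ℂ)
  rw [fieldMap_apply, finField, extMap, ContinuousMap.sum_apply, Complex.ofReal_sum]
  refine Finset.sum_congr rfl fun k hk => ?_
  rw [hartleyExt_of_mem_freqBox N (hS hk)]
  exact (Complex.ofReal_mul _ _).symm

theorem extMap_union {S T : Finset Freq} (h : Disjoint S T) (s : Freq → ℝ) (g : Noise) :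
    extMap N (S ∪ T) s g = extMap N S s g + extMap N T s g :=
  Finset.sum_union h

theorem continuous_extMap (S : Finset Freq) (s : Freq → ℝ) : Continuous (extMap N S s) := by
  unfold extMap
  fun_prop

theorem lintegral_enorm_noise_le (n : Freq) : ∫⁻ g : Noise, ‖g n‖ₑ ∂noiseLaw ≤ 1 := by
  have hmp := measurePreserving_eval_infinitePi (fun _ : Freq => stdNormal) n
  have h1 : ∫⁻ g : Noise, ‖g n‖ₑ ∂noiseLaw = eLpNorm (fun y : ℝ => y) 1 stdNormal := by
    rw [eLpNorm_one_eq_lintegral_enorm, ← hmp.lintegral_comp (by fun_prop)]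
    rfl
  rw [h1]
  refine (eLpNorm_le_eLpNorm_of_exponent_le (q := 2) (by norm_num) (by fun_prop)).trans ?_
  have h2 : ∫ y, y ^ 2 ∂stdNormal = 1 := by
    have h := variance_fun_id_gaussianReal (μ := 0) (v := 1)
    rw [variance_of_integral_eq_zero (by fun_prop) (by simp)] at h
    simpa [stdNormal] using h
  have h3 := eLpNorm_two_le (memLp_id_gaussianReal (μ := 0) (v := 1) 2) (c := 1) (le_of_eq (by
    simpa [stdNormal] using h2))
  exact h3.trans (by simp)

/-- The frequencies on the boundary of the dual lattice, where the extension of a Hartley function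
is not a Hartley function, do not contribute in the limit. -/
theorem lintegral_norm_extMap_boundary_le {B : ℝ} {s : Freq → ℝ}
    (hs : ∀ n, s n ^ 2 ≤ B * bracket n ^ (-4 : ℝ)) (i : ℕ) :
    ∫⁻ g, ‖extMap N ((latticeDual N \ freqBox ((N - 1) / 2)) \ freqBox (2 ^ i)) s g‖ₑ ∂noiseLaw ≤
      ENNReal.ofReal (16 * √B * (1 / 2) ^ i) := by
  set T := (latticeDual N \ freqBox ((N - 1) / 2)) \ freqBox (2 ^ i) with hT
  have hN : (0 : ℝ) < N := by exact_mod_cast NeZero.pos N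
  rcases T.eq_empty_or_nonempty with h0 | ⟨k₀, hk₀⟩
  · rw [h0]
    have h0 : ∀ g, ‖extMap N ∅ s g‖ₑ = 0 := fun g => enorm_zero (E := C(Torus, ℂ))
    simp only [h0, lintegral_zero]
    exact zero_le
  have hNi : (2 : ℝ) ^ i ≤ N := by
    rw [hT, Finset.mem_sdiff, Finset.mem_sdiff] at hk₀
    have h1 := hk₀.2
    have h2 := mem_freqBox.1 (latticeDual_subset N hk₀.1.1)
    rw [mem_freqBox, not_le] at h1
    push_cast at h1
    linarith
  have hcard : (T.card : ℝ) ≤ 2 * N := by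
    have hsub : freqBox ((N - 1) / 2) ⊆ latticeDual N := by
      intro n hn
      rw [freqBox, Fintype.mem_piFinset] at hn
      rw [mem_latticeDual]
      intro i
      have h := hn i
      have := NeZero.pos N
      rw [Finset.mem_Icc] at h
      omega
    have h1 : T.card ≤ N ^ 2 - (2 * ((N - 1) / 2) + 1) ^ 2 := by
      rw [← card_latticeDual, ← card_freqBox, ← Finset.card_sdiff_of_subset hsub]
      exact Finset.card_le_card Finset.sdiff_subset
    have h2 : N ^ 2 ≤ (2 * ((N - 1) / 2) + 1) ^ 2 + 2 * N := by
      have h3 : N ≤ 2 * ((N - 1) / 2) + 1 + 1 := by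
        have := NeZero.pos N
        omega
      generalize 2 * ((N - 1) / 2) + 1 = q at h3 ⊢
      rcases h3.lt_or_eq with h | h
      · have := Nat.pow_le_pow_left (Nat.lt_succ_iff.1 h) 2
        omega
      · rw [h]
        ring_nf
        omega
    have h3 : T.card ≤ 2 * N := by omega
    exact_mod_cast h3
  have hterm : ∀ k ∈ T, |s k| * 2 ≤ 8 * √B / N ^ 2 := by
    intro k hk
    have hbr : (N : ℝ) / 2 ≤ bracket k := by
      have h1 := (Finset.mem_sdiff.1 (Finset.mem_sdiff.1 hk).1).2
      rw [mem_freqBox, not_le] at h1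
      have h2 : (N : ℝ) ≤ 2 * (((N - 1) / 2 : ℕ) : ℝ) + 2 := by
        have : N ≤ 2 * ((N - 1) / 2) + 2 := by omega
        exact_mod_cast this
      rw [bracket]
      linarith
    have hB : 0 ≤ B := by
      have := (sq_nonneg _).trans (hs 0)
      simpa [bracket] using this
    have h1 : |s k| ≤ √(B * (16 / N ^ 4)) := by
      refine Real.abs_le_sqrt ((hs k).trans (mul_le_mul_of_nonneg_left ?_ hB))
      refine (Real.rpow_le_rpow_of_nonpos (by positivity) hbr (by norm_num)).trans (le_of_eq ?_)
      rw [Real.rpow_neg (by positivity), show (4 : ℝ) = (4 : ℕ) by norm_num, Real.rpow_natCast]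
      field_simp
      norm_num
    have h2 : √(B * (16 / N ^ 4)) = √B * (4 / N ^ 2) := by
      rw [Real.sqrt_mul hB, show (16 / (N : ℝ) ^ 4) = (4 / N ^ 2) ^ 2 by field_simp; norm_num,
        Real.sqrt_sq (by positivity)]
    rw [h2] at h1
    calc |s k| * 2 ≤ √B * (4 / N ^ 2) * 2 := by gcongr
      _ = _ := by ring
  calc ∫⁻ g, ‖extMap N T s g‖ₑ ∂noiseLaw
      ≤ ∫⁻ g, ∑ k ∈ T, ENNReal.ofReal (8 * √B / N ^ 2) * ‖g k‖ₑ ∂noiseLaw := by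
        refine lintegral_mono fun g => ?_
        refine (enorm_sum_le (ε := C(Torus, ℂ)) _ _).trans (Finset.sum_le_sum fun k hk => ?_)
        rw [enorm_smul, ← ofReal_norm, ← ofReal_norm, ← ofReal_norm, Complex.norm_real, norm_mul,
          ← ENNReal.ofReal_mul (by positivity), ← ENNReal.ofReal_mul (by positivity)]
        refine ENNReal.ofReal_le_ofReal ?_
        have h1 := hterm k hk
        have h2 := norm_hartleyExt_le N k
        calc ‖s k‖ * ‖g k‖ * ‖hartleyExt N k‖ ≤ ‖s k‖ * ‖g k‖ * 2 := by gcongr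
          _ = |s k| * 2 * ‖g k‖ := by rw [Real.norm_eq_abs (s k)]; ring
          _ ≤ _ := by gcongr
    _ = ∑ k ∈ T, ENNReal.ofReal (8 * √B / N ^ 2) * ∫⁻ g : Noise, ‖g k‖ₑ ∂noiseLaw := by
        rw [lintegral_finsetSum _ fun k _ => by fun_prop]
        exact Finset.sum_congr rfl fun k _ => lintegral_const_mul _ (by fun_prop)
    _ ≤ ∑ _k ∈ T, ENNReal.ofReal (8 * √B / N ^ 2) := by
        refine Finset.sum_le_sum fun k _ => ?_
        exact (mul_le_mul_right (lintegral_enorm_noise_le k) _).trans (mul_one _).le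
    _ ≤ ENNReal.ofReal (16 * √B * (1 / 2) ^ i) := by
        rw [Finset.sum_const, nsmul_eq_mul, ← ENNReal.ofReal_natCast,
          ← ENNReal.ofReal_mul (by positivity)]
        refine ENNReal.ofReal_le_ofReal ?_
        calc (T.card : ℝ) * (8 * √B / N ^ 2) ≤ 2 * N * (8 * √B / N ^ 2) := by gcongr
          _ = 16 * √B * (1 / N) := by field_simp; ring
          _ ≤ _ := by
            rw [one_div_pow]
            gcongr

/-- The expected sup norm of the high frequencies of the extended lattice field. -/
theorem exists_lintegral_norm_extMap_tail_le (B : ℝ) : ∃ C, 0 ≤ C ∧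
    ∀ (N : ℕ) [NeZero N] (s : Freq → ℝ) (i : ℕ), (∀ n, s n ^ 2 ≤ B * bracket n ^ (-4 : ℝ)) →
      ∫⁻ g, ‖extMap N (latticeDual N \ freqBox (2 ^ i)) s g‖ₑ ∂noiseLaw ≤
        ENNReal.ofReal (C * √(1 / 2) ^ i) := by
  obtain ⟨C, hC0, hC⟩ := exists_lintegral_norm_tail_le B
  refine ⟨C + 16 * √B, by positivity, ?_⟩
  intro N _ s i hs
  set Q := freqBox ((N - 1) / 2) with hQ
  have hsplit : latticeDual N \ freqBox (2 ^ i) =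
      (latticeDual N ∩ Q) \ freqBox (2 ^ i) ∪ (latticeDual N \ Q) \ freqBox (2 ^ i) := by
    ext n
    simp only [Finset.mem_sdiff, Finset.mem_union, Finset.mem_inter]
    tauto
  have hdisj : Disjoint ((latticeDual N ∩ Q) \ freqBox (2 ^ i))
      ((latticeDual N \ Q) \ freqBox (2 ^ i)) := by
    rw [Finset.disjoint_left]
    intro n h1 h2
    simp only [Finset.mem_sdiff, Finset.mem_inter] at h1 h2
    exact h2.1.2 h1.1.2
  have hsub : (latticeDual N ∩ Q) \ freqBox (2 ^ i) ⊆ Q :=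
    Finset.sdiff_subset.trans Finset.inter_subset_right
  calc ∫⁻ g, ‖extMap N (latticeDual N \ freqBox (2 ^ i)) s g‖ₑ ∂noiseLaw
      ≤ ∫⁻ g, (‖fieldMap ((latticeDual N ∩ Q) \ freqBox (2 ^ i)) s g‖ₑ +
          ‖extMap N ((latticeDual N \ Q) \ freqBox (2 ^ i)) s g‖ₑ) ∂noiseLaw := by
        refine lintegral_mono fun g => ?_
        rw [hsplit, extMap_union N hdisj, extMap_of_subset N hsub]
        exact (enorm_add_le (E := C(Torus, ℂ)) _ _).trans
          (add_le_add (enorm_toComplex_le _) le_rfl)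
    _ = _ := lintegral_add_left (continuous_fieldMap _ s).enorm.measurable _
    _ ≤ ENNReal.ofReal (C * √(1 / 2) ^ i) + ENNReal.ofReal (16 * √B * (1 / 2) ^ i) :=
        add_le_add (hC _ s i hs) (lintegral_norm_extMap_boundary_le N hs i)
    _ ≤ _ := by
        rw [← ENNReal.ofReal_add (by positivity) (by positivity), add_mul]
        have h : (1 / 2 : ℝ) ≤ √(1 / 2) := Real.le_sqrt_of_sq_le (by norm_num)
        gcongr

end TrigExtension

/-! ### The continuum limit of the fluctuation field -/

theorem tendsto_latticeDiffRoot {m M : ℝ} (hm : 0 < m) (hM : m ^ 2 ≤ M) (k : Freq) :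
    Tendsto (fun n : ℕ => latticeDiffRoot (n + 1) m M k) atTop (𝓝 √(diffMultiplier m M k)) := by
  have hm2 : 0 < m ^ 2 := by positivity
  refine ((tendsto_latticeMultiplier hm2 k).sub
    (tendsto_latticeMultiplier (hm2.trans_le hM) k)).sqrt.congr' ?_
  filter_upwards [eventually_mem_latticeDual k] with n hn
  rw [latticeDiffRoot, if_pos hn]

/-- The noise of the lattice fluctuation field converges coordinatewise. -/
theorem tendsto_latticeMix {m M : ℝ} (hm : 0 < m) (hM : m ^ 2 ≤ M) (p : Noise × Noise) (k : Freq) :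
    Tendsto (fun n : ℕ => (latticeMix (n + 1) m M p).1 k) atTop (𝓝 ((mixNoise m M p).1 k)) := by
  have hm2 : 0 < m ^ 2 := by positivity
  have h0 := tendsto_latticeRoot hm2 k
  have h1 := (tendsto_latticeDiffRoot hm hM k).div h0 (covRoot_pos hm2 k).ne'
  have h2 := (tendsto_latticeRoot (hm2.trans_le hM) k).div h0 (covRoot_pos hm2 k).ne'
  refine ((h1.mul_const (p.1 k)).add (h2.mul_const (p.2 k))).congr' ?_
  filter_upwards [eventually_mem_latticeDual k] with n hn
  simp only [latticeMix, reflectNoise, latticeDiffShare, latticeMassShare, if_pos hn, Pi.div_apply]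

theorem continuous_toComplex : Continuous toComplex := ContinuousMap.continuous_postcomp _

/-- The extended lattice fluctuation field as a function of the noise of the lattice free field and
of an independent noise. -/
noncomputable def extField (N : ℕ) [NeZero N] (m M : ℝ) (p : Noise × Noise) : C(Torus, ℂ) :=
  trigExtension N (sampleField N (latticeDual N) (latticeDiffRoot N m M) (latticeMix N m M p).1)

theorem measurable_extField (N : ℕ) [NeZero N] {m M : ℝ} (hm : 0 < m) (hM : m ^ 2 ≤ M) :
    Measurable (extField N m M) :=
  (measurable_trigExtension N).comp ((continuous_sampleField N _ _).measurable.comp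
    (measurable_fst.comp (measurePreserving_latticeMix N hm hM).measurable))

theorem continuous_reflectNoise (c s : Freq → ℝ) : Continuous (reflectNoise c s) := by
  unfold reflectNoise
  fun_prop

/-- The extended lattice fluctuation fields converge in probability to `Y_∞ - Y_t`. -/
theorem tendstoInMeasure_extField {m M : ℝ} (hm : 0 < m) (hM : m ^ 2 ≤ M)
    {X : Noise → C(Torus, ℝ)} (hX : Measurable X)
    (hlim : Tendsto (fun i => eLpNorm (fieldMap (freqBox (2 ^ i))
      (fun n => √(diffMultiplier m M n)) - X) 1 noiseLaw) atTop (𝓝 0)) :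
    TendstoInMeasure (noiseLaw.prod noiseLaw) (fun n : ℕ => extField (n + 1) m M) atTop
      (fun p => toComplex (X (mixNoise m M p).1)) := by
  obtain ⟨C, hC0, hC⟩ := exists_lintegral_norm_extMap_tail_le
    ((M - m ^ 2) * ((2 / m ^ 2 + 2) * (2 / M + 2)))
  have hmix := measurePreserving_mixNoise hm hM
  have hmp : MeasurePreserving (fun p => (mixNoise m M p).1) (noiseLaw.prod noiseLaw) noiseLaw :=
    measurePreserving_fst.comp hmix
  have hmpN : ∀ n : ℕ, MeasurePreserving (fun p => (latticeMix (n + 1) m M p).1)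
      (noiseLaw.prod noiseLaw) noiseLaw := fun n =>
    measurePreserving_fst.comp (measurePreserving_latticeMix (n + 1) hm hM)
  have hcN : ∀ n : ℕ, Continuous fun p => (latticeMix (n + 1) m M p).1 := fun n =>
    continuous_fst.comp (continuous_reflectNoise _ _)
  have hcA : ∀ i n : ℕ, Continuous fun p => extMap (n + 1) (latticeDual (n + 1) ∩ freqBox (2 ^ i))
      (latticeDiffRoot (n + 1) m M) (latticeMix (n + 1) m M p).1 := fun i n =>
    (continuous_extMap _ _ _).comp (hcN n)
  have hY : ∀ n : ℕ, extField (n + 1) m M = fun p => extMap (n + 1) (latticeDual (n + 1))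
      (latticeDiffRoot (n + 1) m M) (latticeMix (n + 1) m M p).1 := fun n =>
    funext fun p => trigExtension_sampleField (n + 1) _ _
  refine tendstoInMeasure_of_approx (b := fun i => ENNReal.ofReal (C * √(1 / 2) ^ i))
    (A := fun i n p => extMap (n + 1) (latticeDual (n + 1) ∩ freqBox (2 ^ i))
      (latticeDiffRoot (n + 1) m M) (latticeMix (n + 1) m M p).1)
    (A' := fun i p => toComplex (fieldMap (freqBox (2 ^ i)) (fun n => √(diffMultiplier m M n))
      (mixNoise m M p).1)) (fun i n => ?_) (fun i n => ?_) ?_ (fun i => ?_) ?_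
  · rw [hY]
    exact (((continuous_extMap _ _ _).comp (hcN n)).edist (hcA i n)).aemeasurable
  · have hdisj : Disjoint (latticeDual (n + 1) \ freqBox (2 ^ i))
        (latticeDual (n + 1) ∩ freqBox (2 ^ i)) := by
      rw [Finset.disjoint_left]
      intro k h1 h2
      exact (Finset.mem_sdiff.1 h1).2 (Finset.mem_inter.1 h2).2
    have e : ∀ p, edist (extField (n + 1) m M p)
        (extMap (n + 1) (latticeDual (n + 1) ∩ freqBox (2 ^ i)) (latticeDiffRoot (n + 1) m M)
          (latticeMix (n + 1) m M p).1) = ‖extMap (n + 1) (latticeDual (n + 1) \ freqBox (2 ^ i))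
            (latticeDiffRoot (n + 1) m M) (latticeMix (n + 1) m M p).1‖ₑ := by
      intro p
      have h := extMap_union (n + 1) hdisj (latticeDiffRoot (n + 1) m M)
        (latticeMix (n + 1) m M p).1
      rw [Finset.sdiff_union_inter] at h
      rw [edist_eq_enorm_sub, congrFun (hY n) p, h, add_sub_cancel_right]
    simp only [e]
    rw [(hmpN n).lintegral_comp (f := fun g => ‖extMap (n + 1)
      (latticeDual (n + 1) \ freqBox (2 ^ i)) (latticeDiffRoot (n + 1) m M) g‖ₑ)
      (continuous_extMap _ _ _).enorm.measurable]
    exact hC (n + 1) _ i (latticeDiffRoot_sq_le (n + 1) hm hM)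
  · have hb : Tendsto (fun i : ℕ => C * √(1 / 2) ^ i) atTop (𝓝 0) := by
      rw [← mul_zero C]
      refine (tendsto_pow_atTop_nhds_zero_of_lt_one (by positivity) ?_).const_mul C
      rw [Real.sqrt_lt' one_pos]; norm_num
    simpa using ENNReal.tendsto_ofReal hb
  · refine tendstoInMeasure_of_tendsto_ae (fun n => (hcA i n).aestronglyMeasurable)
      (ae_of_all _ fun p => ?_)
    refine ((continuous_toComplex.tendsto _).comp (tendsto_fieldMap
      (fun k _ => tendsto_latticeDiffRoot hm hM k)
      fun k _ => tendsto_latticeMix hm hM p k)).congr' ?_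
    filter_upwards [eventually_subset_latticeDual (freqBox (2 ^ i)),
      eventually_ge_atTop (2 * 2 ^ i)] with n hn hn2
    rw [Finset.inter_eq_right.2 hn, extMap_of_subset (n + 1) (freqBox_mono (by omega))]
    rfl
  · have h1 : TendstoInMeasure (noiseLaw.prod noiseLaw) (fun i p => fieldMap (freqBox (2 ^ i))
        (fun n => √(diffMultiplier m M n)) (mixNoise m M p).1) atTop
        (fun p => X (mixNoise m M p).1) := by
      refine tendstoInMeasure_of_tendsto_eLpNorm one_ne_zero
        (fun i => (memLp_fieldMap _ _).1.comp_measurePreserving hmp)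
        (hX.aestronglyMeasurable.comp_measurePreserving hmp) ?_
      refine hlim.congr fun i => ?_
      exact (eLpNorm_comp_measurePreserving
        ((memLp_fieldMap _ _).1.sub hX.aestronglyMeasurable) hmp).symm
    intro ε hε
    refine tendsto_of_tendsto_of_tendsto_of_le_of_le tendsto_const_nhds (h1 ε hε)
      (fun _ => zero_le) fun i => measure_mono fun p hp => ?_
    simp only [Set.mem_ofPred_eq] at hp ⊢
    refine le_trans hp ?_
    rw [edist_eq_enorm_sub, edist_eq_enorm_sub, ← toComplex_sub]
    exact enorm_toComplex_le _

/-- The extended renormalised measure is the law of the extended fluctuation field under the tilted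
law of the free field. -/
theorem map_renormalisedMeasure (N : ℕ) [NeZero N] {m t : ℝ} (hm : 0 < m) (ht : 0 < t)
    {P : Polynomial ℝ} (hdeg : Even P.natDegree) (hpos : 0 < P.natDegree)
    (hlead : 0 < P.leadingCoeff) : (renormalisedMeasure N m P t).map (trigExtension N) =
      ((noiseLaw.prod noiseLaw).tilted fun p => -noiseInteraction N m P p.1).map
        (extField N m (m ^ 2 + 1 / t)) := by
  have hM : m ^ 2 ≤ m ^ 2 + 1 / t := le_add_of_nonneg_right (by positivity)
  have h : Measurable fun p => sampleField N (latticeDual N)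
      (latticeDiffRoot N m (m ^ 2 + 1 / t)) (latticeMix N m (m ^ 2 + 1 / t) p).1 :=
    (continuous_sampleField N _ _).measurable.comp
      (measurable_fst.comp (measurePreserving_latticeMix N hm hM).measurable)
  rw [renormalisedMeasure_eq N hm ht hdeg hpos hlead,
    Measure.map_map (measurable_trigExtension N) h]
  rfl

theorem integrable_comp_fst {f : Noise → ℝ} (hf : Integrable f noiseLaw) :
    Integrable (fun p : Noise × Noise => f p.1) (noiseLaw.prod noiseLaw) :=
  (measurePreserving_fst.integrable_comp hf.1).2 hf

theorem isProbabilityMeasure_map_renormalisedMeasure (N : ℕ) [NeZero N] {m t : ℝ} (hm : 0 < m)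
    (ht : 0 < t) {P : Polynomial ℝ} (hdeg : Even P.natDegree) (hpos : 0 < P.natDegree)
    (hlead : 0 < P.leadingCoeff) :
    IsProbabilityMeasure ((renormalisedMeasure N m P t).map (trigExtension N)) := by
  rw [map_renormalisedMeasure N hm ht hdeg hpos hlead]
  have := isProbabilityMeasure_tilted
    (integrable_comp_fst (integrable_exp_neg_noiseInteraction N hm hdeg hpos hlead))
  exact Measure.isProbabilityMeasure_map (measurable_extField N hm
    (le_add_of_nonneg_right (by positivity))).aemeasurable

end PPhi2

theorem proposition5p6 (m : ℝ) (hm : 0 < m) (P : Polynomial ℝ) (hdeg : Even P.natDegree)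
    (hpos : 0 < P.natDegree) (hlead : 0 < P.leadingCoeff) (t : ℝ) (ht : 0 < t) :
    -- the continuum interactions exist, and their exponentials are integrable
    (∀ M ∈ ({m ^ 2, m ^ 2 + 1 / t} : Set ℝ), ∀ φ : C(PPhi2.Torus, ℝ),
      PPhi2.IsInteraction m P M φ (PPhi2.interaction m P M φ) ∧
      Integrable (fun g => Real.exp (-PPhi2.interaction m P M φ g)) PPhi2.noiseLaw) ∧
    -- `X` is the field `Y_∞ - Y_t`, `ν` the limit, `μ n` the pushforward for `ε = 1 / (n + 1)`
    ∃ (X : PPhi2.Noise → C(PPhi2.Torus, ℝ)) (ν : ProbabilityMeasure C(PPhi2.Torus, ℝ))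
      (μ : ℕ → ProbabilityMeasure C(PPhi2.Torus, ℂ)),
      PPhi2.IsContinuousField
        (fun n => PPhi2.covMultiplier (m ^ 2) n - PPhi2.covMultiplier (m ^ 2 + 1 / t) n) X ∧
      (∀ n, (μ n : Measure C(PPhi2.Torus, ℂ)) =
        (PPhi2.renormalisedMeasure (n + 1) m P t).map (PPhi2.trigExtension (n + 1))) ∧
      -- the explicit formula for the limit
      (∀ F : C(PPhi2.Torus, ℝ) → ℝ, Measurable F → (∃ C, ∀ φ, |F φ| ≤ C) →
        Integrable (fun g => F (X g) * Real.exp (-PPhi2.potential m P (m ^ 2 + 1 / t) (X g)))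
          PPhi2.noiseLaw ∧
        ∫ φ, F φ ∂(ν : Measure C(PPhi2.Torus, ℝ)) =
          Real.exp (PPhi2.potential m P (m ^ 2) 0) *
            ∫ g, F (X g) * Real.exp (-PPhi2.potential m P (m ^ 2 + 1 / t) (X g))
              ∂PPhi2.noiseLaw) ∧
      -- weak convergence as `ε → 0`, and uniqueness of the subsequential limits
      Tendsto μ atTop (𝓝 (ν.map PPhi2.measurable_toComplex.aemeasurable)) ∧
      (∀ (s : ℕ → ℕ) (μ' : ProbabilityMeasure C(PPhi2.Torus, ℂ)), StrictMono s →
        Tendsto (fun j => μ (s j)) atTop (𝓝 μ') →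
        μ' = ν.map PPhi2.measurable_toComplex.aemeasurable) := by
  have hm2 : 0 < m ^ 2 := by positivity
  have hM : m ^ 2 ≤ m ^ 2 + 1 / t := le_add_of_nonneg_right (by positivity)
  refine ⟨fun M hMmem φ => ?_, ?_⟩
  · have hMle : m ^ 2 ≤ M := by
      rcases hMmem with rfl | rfl
      exacts [le_rfl, hM]
    exact ⟨PPhi2.isInteraction_interaction hm hMle P φ,
      PPhi2.integrable_exp_neg_interaction hm hMle P hdeg hpos hlead φ⟩
  obtain ⟨B, hB0, hB⟩ := PPhi2.exists_diffMultiplier_le hm hM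
  obtain ⟨X, hX, hlim⟩ := PPhi2.exists_limit_fieldMap hB
  set W := PPhi2.interaction m P (m ^ 2) 0 with hW
  have hWint := PPhi2.integrable_comp_fst
    (PPhi2.integrable_exp_neg_interaction hm le_rfl P hdeg hpos hlead 0)
  have hprob := isProbabilityMeasure_tilted (f := fun p : PPhi2.Noise × PPhi2.Noise => -W p.1) hWint
  have hZ : Measurable fun p => X (PPhi2.mixNoise m (m ^ 2 + 1 / t) p).1 :=
    hX.comp (measurable_fst.comp (PPhi2.measurePreserving_mixNoise hm hM).measurable)
  set ν : ProbabilityMeasure C(PPhi2.Torus, ℝ) :=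
    ⟨((PPhi2.noiseLaw.prod PPhi2.noiseLaw).tilted fun p => -W p.1).map
      fun p => X (PPhi2.mixNoise m (m ^ 2 + 1 / t) p).1,
      Measure.isProbabilityMeasure_map hZ.aemeasurable⟩ with hν
  set μ : ℕ → ProbabilityMeasure C(PPhi2.Torus, ℂ) := fun n =>
    ⟨(PPhi2.renormalisedMeasure (n + 1) m P t).map (PPhi2.trigExtension (n + 1)),
      PPhi2.isProbabilityMeasure_map_renormalisedMeasure (n + 1) hm ht hdeg hpos hlead⟩ with hμ
  have hconv : Tendsto μ atTop (𝓝 (ν.map PPhi2.measurable_toComplex.aemeasurable)) := by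
    rw [ProbabilityMeasure.tendsto_iff_forall_integral_tendsto]
    intro F
    obtain ⟨C, hC⟩ := PPhi2.exists_lintegral_exp_noiseInteraction_le hm hdeg hpos hlead
    have hV := PPhi2.tendstoInMeasure_noiseInteraction hm P
    have hfst : MeasurePreserving Prod.fst (PPhi2.noiseLaw.prod PPhi2.noiseLaw) PPhi2.noiseLaw :=
      measurePreserving_fst
    have hVc := fun n : ℕ => PPhi2.continuous_noiseInteraction (n + 1) hm P
    have hWm := (PPhi2.isInteraction_interaction hm le_rfl P 0).1.1
    have hV' : TendstoInMeasure (PPhi2.noiseLaw.prod PPhi2.noiseLaw)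
        (fun n p => PPhi2.noiseInteraction (n + 1) m P p.1) atTop (fun p => W p.1) := by
      intro ε hε
      refine (hV ε hε).congr fun n => ?_
      refine (hfst.measure_preimage ?_).symm
      exact nullMeasurableSet_le aemeasurable_const
        ((hVc n).aestronglyMeasurable.edist hWm)
    have h := PPhi2.tendsto_integral_tilted (F := F)
      (fun n => ((hVc n).comp continuous_fst).aestronglyMeasurable)
      (fun n => (PPhi2.measurable_extField (n + 1) hm hM).aemeasurable) hV'
      (PPhi2.tendstoInMeasure_extField hm hM hX hlim) (C := C) (fun n => ?_) hWint F.continuous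
      F.norm_coe_le_norm
    · have h1 : ∀ n, ∫ φ, F φ ∂(μ n : Measure C(PPhi2.Torus, ℂ)) =
          ∫ p, F (PPhi2.extField (n + 1) m (m ^ 2 + 1 / t) p)
            ∂(PPhi2.noiseLaw.prod PPhi2.noiseLaw).tilted
              fun p => -PPhi2.noiseInteraction (n + 1) m P p.1 := by
        intro n
        change ∫ φ, F φ ∂(PPhi2.renormalisedMeasure (n + 1) m P t).map
          (PPhi2.trigExtension (n + 1)) = _
        rw [PPhi2.map_renormalisedMeasure (n + 1) hm ht hdeg hpos hlead,
          integral_map (PPhi2.measurable_extField (n + 1) hm hM).aemeasurable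
            F.continuous.aestronglyMeasurable]
      have h2 : ∫ φ, F φ ∂(ν.map PPhi2.measurable_toComplex.aemeasurable :
          Measure C(PPhi2.Torus, ℂ)) =
          ∫ p, F (PPhi2.toComplex (X (PPhi2.mixNoise m (m ^ 2 + 1 / t) p).1))
            ∂(PPhi2.noiseLaw.prod PPhi2.noiseLaw).tilted fun p => -W p.1 := by
        rw [ProbabilityMeasure.toMeasure_map,
          integral_map PPhi2.measurable_toComplex.aemeasurable F.continuous.aestronglyMeasurable]
        exact integral_map hZ.aemeasurable
          (F.continuous.comp PPhi2.continuous_toComplex).aestronglyMeasurable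
      simp only [h1, h2]
      exact h
    · refine le_trans (le_of_eq ?_) (hC n)
      exact hfst.lintegral_comp ((hVc n).measurable.const_mul 2).neg.exp.ennreal_ofReal
  refine ⟨X, ν, μ, PPhi2.isContinuousField_of_tendsto hX hlim, fun n => rfl, ?_, hconv, ?_⟩
  · rintro F hF ⟨C, hC⟩
    have h := PPhi2.integral_tilted_interaction hm hM hdeg hpos hlead hX hlim hF hC
    refine ⟨h.1, ?_⟩
    rw [← h.2]
    exact integral_map hZ.aemeasurable hF.aestronglyMeasurable
  · intro s μ' hs hμ'
    exact tendsto_nhds_unique hμ' (hconv.comp hs.tendsto_atTop)
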